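/- **Notation.** Write $q=e^{2\pi i\tau}$, $\operatorname{Im}\tau>0$. For a positive integer $k$ and $j\in\mathbb Z$ put $\Theta_{j,k}(\tau,z)=\sum_{n\in\mathbb Z+j/2k}q^{kn^2}e^{2\pi iknz}$, and let $$\vartheta_{00}=\Theta_{2,2}+\Theta_{0,2},\quad \vartheta_{01}=-\Theta_{2,2}+\Theta_{0,2},\quad \vartheta_{10}=\Theta_{1,2}+\Theta_{-1,2},\quad \vartheta_{11}=i\Theta_{1,2}-i\Theta_{-1,2}.$$ Let $\eta$ be the Dedekind eta function, $E(x)=2\int_0^xe^{-\pi u^2}du$, and for a positive integer $n$ and $j\in\mathbb Z$ let $$R_{n;j}(\tau,v)=\sum_{r\equiv j\bmod 2n}\Big(\operatorname{sign}(r+\tfrac12)-E\big((r+2n\tfrac{\operatorname{Im}v}{\operatorname{Im}\tau})\sqrt{\operatorname{Im}\tau/n}\big)\Big)e^{-\frac{\pi ir^2}{2n}\tau-2\pi irv}.$$ For an integer $m\ge0$ let $\tilde\Phi^{[m]}=\Phi^{[m]}+\Phi^{[m]}_{\rm add}$, where $$\Phi^{[m]}(\tau,z_1,z_2,t)=e^{2\pi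 i(m+1)t}\sum_{j\in\mathbb Z}\Big(\frac{e^{2\pi ij(m+1)(z_1+z_2)}q^{j^2(m+1)}}{1-e^{2\pi iz_1}q^j}-\frac{e^{-2\pi ij(m+1)(z_1+z_2)}q^{j^2(m+1)}}{1-e^{-2\pi iz_2}q^j}\Big),$$ $$\Phi^{[m]}_{\rm add}(\tau,z_1,z_2,t)=-\tfrac12e^{2\pi i(m+1)t}\sum_{j=0}^{2m+1}R_{m+1;j}\big(\tau,\tfrac{z_1-z_2}2\big)\,(\Theta_{j,m+1}-\Theta_{-j,m+1})(\tau,z_1+z_2).$$ For a positive integer $M$, $\epsilon,\epsilon'\in\{0,\tfrac12\}$ and $j,k\in\epsilon'+\mathbb Z$ let $$\tilde\Psi^{[M,m;\epsilon]}_{j,k;\epsilon'}(\tau,z_1,z_2,t)=q^{\frac{(m+1)jk}M}e^{\frac{2\pi i(m+1)}M(kz_1+jz_2)}\,\tilde\Phi^{[m]}\big(M\tau,z_1+j\tau+\epsilon,z_2+k\tau+\epsilon,\tfrac tM\big)$$ (the modified $\widehat{sl}_{2|1}$ numerators). Let $$D_1=\frac1{2\pi i}\Big(\frac{\partial}{\partial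 z_1}-\frac{\partial}{\partial z_2}-\frac{z_1-z_2}{2\tau}\frac{\partial}{\partial t}\Big),\qquad \frac{\partial}{\partial z}=\frac12\Big(\frac{\partial}{\partial x}-i\frac{\partial}{\partial y}\Big)\ \text{ for } z=x+iy.$$ For $m\ge1$ define the modified normalized characters ($\epsilon=\frac12$) and supercharacters ($\epsilon=0$), untwisted ($\epsilon'=0$) and twisted ($\epsilon'=\frac12$), of admissible $\hat A_{1|1}=\widehat{psl}_{2|2}$-modules of level $m/M$ by $$\tilde{\rm ch}^{A_{1|1}[M,m;\epsilon]}_{j,k;\epsilon'}=\frac{D_1\tilde\Psi^{[M,m-1;\epsilon]}_{j,k;\epsilon'}}{\hat R^{(\epsilon)}_{\epsilon'}},\qquad \hat R^{(\epsilon)}_{\epsilon'}(\tau,z_1,z_2)=(-1)^{2\epsilon'}\eta(\tau)^4\,\frac{\vartheta_{11}(\tau,z_1-z_2)\,\vartheta_{11}(\tau,z_1+z_2)}{\vartheta_{1-2\epsilon',1-2\epsilon}(\tau,z_1)^2\,\vartheta_{1-2\epsilon',1-2\epsilon}(\tau,z_2)^2}.$$ Call $(\tau,z_1,z_2)$, $\operatorname{Im}\tau>0$,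 *regular for* $(\epsilon,\epsilon')$ if none of $\vartheta_{11}(\tau,z_1\pm z_2)$, $\vartheta_{1-2\epsilon',1-2\epsilon}(\tau,z_1)$, $\vartheta_{1-2\epsilon',1-2\epsilon}(\tau,z_2)$ vanishes, i.e. if $\hat R^{(\epsilon)}_{\epsilon'}$ is defined and non-zero there. **Theorem 8.4.** Let $M,m$ be positive integers such that $\gcd(M,2m)=1$ if $m>1$. Let $\epsilon,\epsilon'\in\{0,\tfrac12\}$ and $j,k\in\epsilon'+\mathbb Z$. 1. If $(\tau,z_1,z_2)$ is regular for $(\epsilon,\epsilon')$ and $t\in\mathbb C$, then $\tilde\Psi^{[M,m-1;\epsilon]}_{j,k;\epsilon'}(\tau,\cdot,\cdot,\cdot)$ is differentiable in the real sense at $(z_1,z_2,t)$ (so the modified (super)character is well defined there). 2. If $(\tau,z_1,z_2)$ is regular for $(\epsilon',\epsilon)$ and $t\in\mathbb C$, then $(-\frac1\tau,\frac{z_1}\tau,\frac{z_2}\tau)$ is regular for $(\epsilon,\epsilon')$ and $$\tilde{\rm ch}^{A_{1|1}[M,m;\epsilon]}_{j,k;\epsilon'}\Big(-\frac1\tau,\frac{z_1}\tau,\frac{z_2}\tau,t-\frac{z_1z_2}\tau\Big)=-(-1)^{2(\epsilon-\epsilon')}\,\frac{i\tau}M\sum_{\substack{a,b\in\epsilon+\mathbb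 Z\\0\le a,b<M}}e^{-\frac{2\pi im}M(ak+bj)}\,\tilde{\rm ch}^{A_{1|1}[M,m;\epsilon']}_{a,b;\epsilon}(\tau,z_1,z_2,t).$$ 3. There is no $T$-invariance: the function $\tilde{\rm ch}^{A_{1|1}[M,m;\epsilon]}_{j,k;\epsilon'}(\tau+1,z_1,z_2,t)$ is not a linear combination, with constant complex coefficients, of the functions $\tilde{\rm ch}^{A_{1|1}[M,m;\sigma]}_{a,b;\sigma'}(\tau,z_1,z_2,t)$ with $\sigma,\sigma'\in\{0,\frac12\}$, $a,b\in\sigma'+\mathbb Z$, $0\le a,b<M$ (as functions on the set of points that are regular for all pairs $(\sigma,\sigma')$). -/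

import Mathlib

open Complex

noncomputable section

namespace A11

/-- Degree `k` theta function
`Θ_{j,k}(τ,z) = ∑_{n ∈ ℤ + j/(2k)} q^{k n²} e^{2π i k n z}`, `q = e^{2π i τ}`. -/
def bigTheta (j : ℤ) (k : ℕ) (τ z : ℂ) : ℂ :=
  ∑' n : ℤ, cexp (2 * Real.pi * I *
    (k * ((n : ℂ) + j / (2 * k)) ^ 2 * τ + k * ((n : ℂ) + j / (2 * k)) * z))

/-- The four Jacobi theta functions `ϑ_{ab}(τ,z)`, `a, b ∈ {0,1}`. -/
def vartheta : Fin 2 → Fin 2 → ℂ → ℂ → ℂ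
  | 0, 0, τ, z => bigTheta 2 2 τ z + bigTheta 0 2 τ z
  | 0, 1, τ, z => -bigTheta 2 2 τ z + bigTheta 0 2 τ z
  | 1, 0, τ, z => bigTheta 1 2 τ z + bigTheta (-1) 2 τ z
  | 1, 1, τ, z => I * bigTheta 1 2 τ z - I * bigTheta (-1) 2 τ z

/-- The odd function `E(x) = 2 ∫_0^x e^{-π u²} du`. -/
def errE (x : ℝ) : ℝ := 2 * ∫ u in (0 : ℝ)..x, Real.exp (-Real.pi * u ^ 2)

/-- The summand, with index `n`, of Zwegers' function `R_{m;j}(τ,v)`. -/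
def zwegersTerm (m : ℕ) (τ v : ℂ) (n : ℤ) : ℂ :=
  ((Real.sign ((n : ℝ) + 1 / 2)
      - errE (((n : ℝ) + 2 * m * (v.im / τ.im)) * Real.sqrt (τ.im / m)) : ℝ) : ℂ)
    * cexp (-(Real.pi * I * (n : ℂ) ^ 2 / (2 * m)) * τ - 2 * Real.pi * I * n * v)

/-- Zwegers' function `R_{m;j}(τ,v)`: the sum over all integers `n = j + 2 m l ≡ j mod 2m`. -/
def zwegersR (m : ℕ) (j : ℤ) (τ v : ℂ) : ℂ :=
  ∑' l : ℤ, zwegersTerm m τ v (j + 2 * m * l)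

/-- The mock theta function `Φ^{[m]}(τ,z₁,z₂,t)` (the numerator of the normalized supercharacter
of the level `m` vacuum module over affine `sl(2|1)`). -/
def Phi (m : ℕ) (τ z₁ z₂ t : ℂ) : ℂ :=
  cexp (2 * Real.pi * I * (m + 1) * t) *
    ∑' j : ℤ,
      (cexp (2 * Real.pi * I * (j * (m + 1) * (z₁ + z₂) + (j : ℂ) ^ 2 * (m + 1) * τ))
          / (1 - cexp (2 * Real.pi * I * (z₁ + j * τ)))
        - cexp (2 * Real.pi * I * (-(j * (m + 1) * (z₁ + z₂)) + (j : ℂ) ^ 2 * (m + 1) * τ))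
          / (1 - cexp (2 * Real.pi * I * (-z₂ + j * τ))))

/-- The real analytic correction `Φ_add^{[m]}`; the sum is over `j ∈ ℤ/(2m+2)ℤ`. -/
def PhiAdd (m : ℕ) (τ z₁ z₂ t : ℂ) : ℂ :=
  -(1 / 2) * cexp (2 * Real.pi * I * (m + 1) * t) *
    ∑ j ∈ Finset.range (2 * m + 2),
      zwegersR (m + 1) j τ ((z₁ - z₂) / 2) *
        (bigTheta j (m + 1) τ (z₁ + z₂) - bigTheta (-j) (m + 1) τ (z₁ + z₂))

/-- The modification `Φ̃^{[m]} = Φ^{[m]} + Φ_add^{[m]}`. -/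
def PhiTilde (m : ℕ) (τ z₁ z₂ t : ℂ) : ℂ := Phi m τ z₁ z₂ t + PhiAdd m τ z₁ z₂ t

/-- The number `ε = e/2 ∈ {0, 1/2}` attached to `e ∈ {0,1}`. -/
def half (e : Fin 2) : ℂ := ((e : ℕ) : ℂ) / 2

/-- The modified `sl(2|1)^` numerators `Ψ̃^{[M,m;ε]}_{j,k;ε'}`, `ε = e/2`. The right-hand side
depends on `ε'` only through the requirement `j, k ∈ ε' + ℤ`. -/
def PsiTilde (M m : ℕ) (e : Fin 2) (j k : ℂ) (τ z₁ z₂ t : ℂ) : ℂ :=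
  cexp (2 * Real.pi * I * ((m + 1) * j * k / M) * τ) *
    cexp (2 * Real.pi * I * (m + 1) / M * (k * z₁ + j * z₂)) *
      PhiTilde m (M * τ) (z₁ + j * τ + half e) (z₂ + k * τ + half e) (t / M)

/-- The (Wirtinger) derivative `∂f/∂z = ½ (∂f/∂x - i ∂f/∂y)`, `z = x + i y`, of a function
that is differentiable in the real sense; it is the complex derivative if `f` is holomorphic. -/
def wirtinger (f : ℂ → ℂ) (z : ℂ) : ℂ :=
  (1 / 2) * (fderiv ℝ f z 1 - I * fderiv ℝ f z I)

/-- `D₁ = (1/2πi) (∂/∂z₁ - ∂/∂z₂ - ((z₁-z₂)/(2τ)) ∂/∂t)`. -/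
def D₁ (F : ℂ → ℂ → ℂ → ℂ → ℂ) (τ z₁ z₂ t : ℂ) : ℂ :=
  1 / (2 * Real.pi * I) *
    (wirtinger (fun w => F τ w z₂ t) z₁ - wirtinger (fun w => F τ z₁ w t) z₂
      - (z₁ - z₂) / (2 * τ) * wirtinger (fun w => F τ z₁ z₂ w) t)

/-- The modified numerators `D₁ Ψ̃^{[M,m-1;ε]}_{j,k;ε'}` for the affine superalgebra of type
`A(1|1)`; meant for `m ≥ 1`. -/
def PsiTildeA (M m : ℕ) (e : Fin 2) (j k : ℂ) : ℂ → ℂ → ℂ → ℂ → ℂ :=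
  D₁ (PsiTilde M (m - 1) e j k)

/-- The normalized affine (super)denominators `R̂^{(ε)}_{ε'}(τ,z₁,z₂)`, `ε = e/2`, `ε' = e'/2`.
The theta function in the denominator is `ϑ_{1-2ε',1-2ε}`. -/
def Rhat (e e' : Fin 2) (τ z₁ z₂ : ℂ) : ℂ :=
  (-1) ^ (e' : ℕ) * ModularForm.eta τ ^ 4 *
    (vartheta 1 1 τ (z₁ - z₂) * vartheta 1 1 τ (z₁ + z₂)) /
      (vartheta (1 - e') (1 - e) τ z₁ ^ 2 * vartheta (1 - e') (1 - e) τ z₂ ^ 2)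

/-- The points at which `R̂^{(ε)}_{ε'}` is defined and non-zero. -/
def Regular (e e' : Fin 2) (τ z₁ z₂ : ℂ) : Prop :=
  vartheta 1 1 τ (z₁ - z₂) ≠ 0 ∧ vartheta 1 1 τ (z₁ + z₂) ≠ 0 ∧
    vartheta (1 - e') (1 - e) τ z₁ ≠ 0 ∧ vartheta (1 - e') (1 - e) τ z₂ ≠ 0

/-- The modified normalized (super)characters `ch̃^{[M,m;ε]}_{j,k;ε'}`, `j, k ∈ ε' + ℤ`:
`ε = 1/2` gives characters, `ε = 0` supercharacters, `ε' = 0` the untwisted sector and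
`ε' = 1/2` the twisted one. -/
def chTilde (M m : ℕ) (e e' : Fin 2) (j k : ℂ) (τ z₁ z₂ t : ℂ) : ℂ :=
  PsiTildeA M m e j k τ z₁ z₂ t / Rhat e e' τ z₁ z₂

end A11

end

/-! Everything reduces to `phiMod N`, the value of Φ̃^{[N-1]} at t = 0, taken with N = m. For fixed
z₂ it is determined, as a function of z₁, by three data: its ∂̄-derivative, which comes from R alone
and is a multiple of the Gaussian sum `gaussSum` (`hasDbar_phiMod`); its simple poles with residue
-1/(2πi) at the integers (`tendsto_mul_phiMod`); and its multipliers 1 and e^{-2πiNz₂} under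
translation by 1 and τ (`phiMod_add_one`, `phiMod_add_tau`). The correction Φ_add is what makes the
second multiplier exact: its defect cancels that of the Appell sums.

Two functions with the same data differ by an entire quasi-periodic function, and such a function
vanishes unless its multiplier is an integral power of q (`eq_zero_of_quasiperiodic`). The
exceptional values of z₂ are recovered by continuity. This rigidity yields two identities: the
behaviour of Φ̃ under τ ↦ -1/τ (`phiMod_S`), and, for M prime to N, an expansion of Φ̃ at τ into M²
terms at M²τ (`phiMod_split`). In both, equality of the ∂̄-derivatives is an identity between
products of theta functions and conjugate theta functions (`gaussSum_S`, `gaussSum_split`).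

Applying the first identity at τ/M and expanding the result by the second gives the S-transformation
of the numerators (`psiMod_S`). The ∂/∂t term of D₁ compensates the derivative of the automorphy
factor (`reducedD_S`), and dividing by the denominators (`Rhat_S`) gives `chTilde_S`. Part 1 holds
because the poles of Ψ̃ are zeros of the theta functions in the denominator of R̂.

For the failure of T-invariance: Ψ̃ at t = 0 and R̂ are unchanged by z₁ ↦ z₁ + 2M and have period
24Mm in τ, but D₁ contains the coefficient (z₁ - z₂)/(2τ) explicitly. Subtracting a supposed
relation at z₁ from the same relation at z₁ + 2M leaves A(τ+1)/(τ+1) = B(τ)/τ with A and B periodic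
in τ. This forces A = 0, so the numerator vanishes at regular points, contrary to its having a pole
(`not_T_invariant`). -/

namespace A11

open Filter Topology Metric

/-! ### The Cauchy–Riemann operator -/

/-- `f` is real differentiable at `z` and `2 ∂f/∂z̄ = d` there. -/
def HasDbar (f : ℂ → ℂ) (d z : ℂ) : Prop :=
  ∃ f' : ℂ →L[ℝ] ℂ, HasFDerivAt f f' z ∧ f' 1 + I * f' I = d

lemma HasDbar.differentiableAt_real {f : ℂ → ℂ} {d z : ℂ} (h : HasDbar f d z) :
    DifferentiableAt ℝ f z := by
  obtain ⟨f', h, -⟩ := h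
  exact h.differentiableAt

/-- Vanishing of ∂̄f is the Cauchy–Riemann equation. This is how a difference of two non-holomorphic
functions is recognised as holomorphic. -/
lemma HasDbar.differentiableAt {f : ℂ → ℂ} {z : ℂ} (h : HasDbar f 0 z) :
    DifferentiableAt ℂ f z := by
  obtain ⟨f', hf, h0⟩ := h
  refine differentiableAt_complex_iff_differentiableAt_real.2 ⟨hf.differentiableAt, ?_⟩
  rw [hf.fderiv, smul_eq_mul, eq_neg_of_add_eq_zero_left h0]
  linear_combination (f' I) * I_mul_I

lemma hasDbar_zero {f : ℂ → ℂ} {z : ℂ} (h : DifferentiableAt ℂ f z) : HasDbar f 0 z := by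
  refine ⟨fderiv ℝ f z, (h.restrictScalars ℝ).hasFDerivAt, ?_⟩
  rw [(differentiableAt_complex_iff_differentiableAt_real.1 h).2, smul_eq_mul]
  linear_combination (fderiv ℝ f z 1) * I_mul_I

lemma HasDbar.add {f g : ℂ → ℂ} {d e z : ℂ} (hf : HasDbar f d z) (hg : HasDbar g e z) :
    HasDbar (fun w => f w + g w) (d + e) z := by
  obtain ⟨f', hf, rfl⟩ := hf
  obtain ⟨g', hg, rfl⟩ := hg
  refine ⟨f' + g', hf.add hg, ?_⟩
  simp only [add_apply]; ring

lemma HasDbar.sum {ι : Type*} {s : Finset ι} {f : ι → ℂ → ℂ} {d : ι → ℂ} {z : ℂ}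
    (h : ∀ i ∈ s, HasDbar (f i) (d i) z) :
    HasDbar (fun w => ∑ i ∈ s, f i w) (∑ i ∈ s, d i) z := by
  classical
  induction s using Finset.induction_on with
  | empty => simpa using hasDbar_zero (differentiableAt_const (0 : ℂ))
  | insert a s ha ih =>
    simp only [Finset.sum_insert ha]
    exact (h a (by simp)).add (ih fun i hi => h i (by simp [hi]))

lemma HasDbar.mul_left {f g : ℂ → ℂ} {d z : ℂ} (hf : HasDbar f d z)
    (hg : DifferentiableAt ℂ g z) : HasDbar (fun w => g w * f w) (g z * d) z := by
  obtain ⟨f', hf, rfl⟩ := hf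
  have h := (differentiableAt_complex_iff_differentiableAt_real.1 hg).2
  refine ⟨_, (hg.restrictScalars ℝ).hasFDerivAt.mul hf, ?_⟩
  simp only [add_apply, smul_apply, smul_eq_mul, h]
  linear_combination (f z * fderiv ℝ g z 1) * I_mul_I

lemma HasDbar.const_mul {f : ℂ → ℂ} {d z : ℂ} (hf : HasDbar f d z) (c : ℂ) :
    HasDbar (fun w => c * f w) (c * d) z :=
  hf.mul_left (g := fun _ => c) (differentiableAt_const c)

lemma HasDbar.sub {f g : ℂ → ℂ} {d e z : ℂ} (hf : HasDbar f d z) (hg : HasDbar g e z) :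
    HasDbar (fun w => f w - g w) (d - e) z := by
  convert! hf.add (hg.const_mul (-1)) using 1
  · ext w; ring
  · ring

/-- For a holomorphic inner map, ∂̄ picks up the conjugate of its derivative. In the
S-transformation this is the source of the conjugate of 1/τ. -/
lemma HasDbar.comp {f g : ℂ → ℂ} {d g' z : ℂ} (hf : HasDbar f d (g z))
    (hg : HasDerivAt g g' z) :
    HasDbar (fun w => f (g w)) ((starRingEnd ℂ) g' * d) z := by
  obtain ⟨f', hf, rfl⟩ := hf
  refine ⟨_, hf.comp z (hg.hasFDerivAt.restrictScalars ℝ), ?_⟩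
  have key : ∀ w : ℂ, f' w = w.re * f' 1 + w.im * f' I := by
    intro w
    conv_lhs => rw [show w = w.re • (1 : ℂ) + w.im • I by simp [re_add_im]]
    rw [map_add, map_smul, map_smul]; simp
  simp only [ContinuousLinearMap.comp_apply, ContinuousLinearMap.coe_restrictScalars',
    ContinuousLinearMap.toSpanSingleton_apply, smul_eq_mul, one_mul]
  rw [key g', key (I * g'), show (starRingEnd ℂ) g' = g'.re - g'.im * I by
    apply Complex.ext <;> simp]
  simp only [mul_re, I_re, zero_mul, I_im, one_mul, zero_sub, mul_im, zero_add]
  push_cast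
  linear_combination ((g'.im : ℂ) * f' I) * I_mul_I

lemma HasDbar.congr {f g : ℂ → ℂ} {d z : ℂ} (hf : HasDbar f d z) (h : g =ᶠ[𝓝 z] f) :
    HasDbar g d z := by
  obtain ⟨f', hf, rfl⟩ := hf
  exact ⟨f', hf.congr_of_eventuallyEq h, rfl⟩

/-! ### Holomorphic series in several variables -/

/-- Cauchy's estimate on each complex line through y. -/
lemma norm_fderiv_le_of_ball {E : Type*} [NormedAddCommGroup E] [NormedSpace ℂ E] {f : E → ℂ}
    {x : E} {r C : ℝ} (hr : 0 < r) (hf : DifferentiableOn ℂ f (ball x r))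
    (hb : ∀ y ∈ ball x r, ‖f y‖ ≤ C) {y : E} (hy : y ∈ ball x (r / 2)) :
    ‖fderiv ℂ f y‖ ≤ C * (4 / r) := by
  have hC : 0 ≤ C := (norm_nonneg _).trans (hb x (mem_ball_self hr))
  refine ContinuousLinearMap.opNorm_le_bound _ (by positivity) fun v => ?_
  rcases eq_or_ne v 0 with rfl | hv
  · simp
  have hv' : 0 < ‖v‖ := norm_pos_iff.2 hv
  -- With this radius `s • v` has norm at most r/4, so the disc around y stays within 3r/4 of x.
  set ρ : ℝ := r / 4 / ‖v‖ with hρ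
  have hρ0 : 0 < ρ := by positivity
  have hmem : ∀ s ∈ closedBall (0 : ℂ) ρ, y + s • v ∈ ball x r := by
    intro s hs
    rw [mem_closedBall_zero_iff] at hs
    rw [mem_ball, dist_eq_norm] at hy ⊢
    have h1 : ‖s • v‖ ≤ r / 4 := by
      rw [norm_smul]
      calc ‖s‖ * ‖v‖ ≤ ρ * ‖v‖ := by gcongr
        _ = r / 4 := by rw [hρ]; field_simp
    calc ‖y + s • v - x‖ = ‖(y - x) + s • v‖ := by congr 1; abel
      _ ≤ ‖y - x‖ + ‖s • v‖ := norm_add_le _ _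
      _ < r := by linarith
  have hd : DifferentiableOn ℂ (fun s : ℂ => f (y + s • v)) (closedBall 0 ρ) := by
    refine hf.comp (by fun_prop) hmem
  have hcd : DiffContOnCl ℂ (fun s : ℂ => f (y + s • v)) (ball 0 ρ) :=
    DifferentiableOn.diffContOnCl (by rwa [closure_ball _ hρ0.ne'])
  have h := Complex.norm_deriv_le_of_forall_mem_sphere_norm_le hρ0 hcd
    (fun z hz => hb _ (hmem z (sphere_subset_closedBall hz)))
  have hfy : DifferentiableAt ℂ f (y + (0 : ℂ) • v) :=
    hf.differentiableAt (isOpen_ball.mem_nhds (hmem 0 (by simp [hρ0.le])))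
  have hl : HasDerivAt (fun s : ℂ => y + s • v) v 0 := by
    simpa using ((hasDerivAt_id (0 : ℂ)).smul_const v).const_add y
  have h2 : deriv (fun s : ℂ => f (y + s • v)) 0 = fderiv ℂ f y v := by
    have := (hfy.hasFDerivAt.comp_hasDerivAt (0 : ℂ) hl).deriv
    simpa [Function.comp_def] using this
  rw [h2] at h
  refine h.trans (le_of_eq ?_)
  rw [hρ]; field_simp

/-- Bounds on the terms suffice: Cauchy's estimate turns them into bounds on the derivatives over
the half ball. -/
lemma differentiableAt_tsum_of_norm_le {E : Type*} [NormedAddCommGroup E] [NormedSpace ℂ E]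
    {ι : Type*} {f : ι → E → ℂ} {u : ι → ℝ} (hu : Summable u) {x : E} {r : ℝ} (hr : 0 < r)
    (hf : ∀ i, DifferentiableOn ℂ (f i) (ball x r)) (hb : ∀ i, ∀ y ∈ ball x r, ‖f i y‖ ≤ u i) :
    DifferentiableAt ℂ (fun y => ∑' i, f i y) x := by
  have hx : x ∈ ball x (r / 2) := mem_ball_self (by positivity)
  -- The real structure serves only to speak of convexity of the ball.
  let _ : NormedSpace ℝ E := NormedSpace.restrictScalars ℝ ℂ E
  refine (hasFDerivAt_tsum_of_isPreconnected (𝕜 := ℂ) (u := fun i => u i * (4 / r))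
    (hu.mul_right _) isOpen_ball (convex_ball x (r / 2)).isPreconnected
    (f' := fun i y => fderiv ℂ (f i) y) (fun i y hy => ?_)
    (fun i y hy => norm_fderiv_le_of_ball hr (hf i) (hb i) hy) hx
    (Summable.of_norm_bounded hu fun i => hb i x (mem_ball_self hr)) hx).differentiableAt
  exact ((hf i).differentiableAt (isOpen_ball.mem_nhds
    (ball_subset_ball (by linarith) hy))).hasFDerivAt

/-! ### Sums over residue classes -/

lemma sum_range_eq_sum_zmod {M : ℕ} [NeZero M] {φ : ℤ → ℂ} (hφ : ∀ x, φ (x + M) = φ x)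
    (g : ZMod M → ZMod M) (h : ℤ → ℤ) (hgh : ∀ b : ℤ, ((h b : ℤ) : ZMod M) = g b) :
    ∑ b ∈ Finset.range M, φ (h b) = ∑ x : ZMod M, φ ((g x).val) := by
  have hper : ∀ x y : ℤ, (x : ZMod M) = y → φ x = φ y := by
    intro x y hxy
    have hp : Function.Periodic φ (M : ℤ) := hφ
    obtain ⟨k, hk⟩ := (ZMod.intCast_eq_intCast_iff_dvd_sub x y M).1 hxy
    have := (hp.int_mul k) x
    rw [show y = x + k * M by linarith [mul_comm (M : ℤ) k], ← this]; rfl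
  refine Finset.sum_bij' (fun b _ => ((b : ℕ) : ZMod M)) (fun x _ => x.val) (by simp)
    (fun x _ => by simpa using x.val_lt) (fun b hb => ?_) (by simp) (fun b _ => ?_)
  · simpa using ZMod.val_cast_of_lt (Finset.mem_range.1 hb)
  · refine hper _ _ ?_
    rw [hgh]; simp

/-- N is a unit mod M, so b ↦ N(b - c) permutes the residues. This is how coprimality enters the
splitting of the Gaussian sums. -/
lemma sum_range_mul_sub {M N : ℕ} (hM : 0 < M) (hMN : Nat.Coprime M N) {φ : ℤ → ℂ}
    (hφ : ∀ x, φ (x + M) = φ x) (c : ℤ) :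
    ∑ b ∈ Finset.range M, φ (N * (b - c)) = ∑ b ∈ Finset.range M, φ b := by
  have : NeZero M := ⟨hM.ne'⟩
  rw [sum_range_eq_sum_zmod hφ (fun x => (N : ZMod M) * (x - c)) (fun b => N * (b - c))
    (by intro b; push_cast; ring), sum_range_eq_sum_zmod hφ (fun x => x) (fun b => b) (by simp)]
  let e : ZMod M ≃ ZMod M := (Equiv.subRight (c : ZMod M)).trans
    (Units.mulLeft (ZMod.unitOfCoprime N hMN.symm))
  exact Equiv.sum_comp e fun x => φ (x.val)

lemma sum_range_add_int {M : ℕ} (hM : 0 < M) {φ : ℤ → ℂ}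
    (hφ : ∀ x, φ (x + M) = φ x) (c : ℤ) :
    ∑ b ∈ Finset.range M, φ (b + c) = ∑ b ∈ Finset.range M, φ b := by
  simpa using sum_range_mul_sub (N := 1) hM (by simp) hφ (-c)

lemma sum_range_neg_int {M : ℕ} (hM : 0 < M) {φ : ℤ → ℂ}
    (hφ : ∀ x, φ (x + M) = φ x) :
    ∑ b ∈ Finset.range M, φ (-b) = ∑ b ∈ Finset.range M, φ b := by
  have : NeZero M := ⟨hM.ne'⟩
  rw [sum_range_eq_sum_zmod hφ (fun x => -x) (fun b => -b) (by simp),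
    sum_range_eq_sum_zmod hφ (fun x => x) (fun b => b) (by simp)]
  exact Equiv.sum_comp (Equiv.neg (ZMod M)) fun x => φ (x.val)

lemma tsum_int_eq_sum_range {M : ℕ} (hM : 0 < M) {f : ℤ → ℂ} (hf : Summable f) :
    ∑' n, f n = ∑ a ∈ Finset.range M, ∑' l : ℤ, f (a + M * l) := by
  have : NeZero M := ⟨hM.ne'⟩
  have hs := ((Int.divModEquiv M).symm.summable_iff (f := f)).2 hf
  rw [← (Int.divModEquiv M).symm.tsum_eq f]
  have hs2 := (Equiv.prodComm (Fin M) ℤ).summable_iff.2 hs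
  rw [← (Equiv.prodComm (Fin M) ℤ).tsum_eq]
  have := hs2.tsum_prod
  simp only [Function.comp_def] at this
  rw [this, tsum_fintype, Finset.sum_range]
  refine Finset.sum_congr rfl fun a _ => tsum_congr fun l => ?_
  simp [Int.divModEquiv, add_comm, mul_comm]

lemma tsum_int_eq_sum_range_mul {M N : ℕ} (hM : 0 < M) (hMN : Nat.Coprime M N) {f : ℤ → ℂ}
    (hf : Summable f) (c : ℤ) :
    ∑' n, f n = ∑ b ∈ Finset.range M, ∑' l : ℤ, f (N * (b - c) + M * l) := by
  rw [tsum_int_eq_sum_range hM hf]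
  refine (sum_range_mul_sub (φ := fun x => ∑' l : ℤ, f (x + M * l)) hM hMN (fun x => ?_) c).symm
  rw [← (Equiv.addRight (1 : ℤ)).tsum_eq fun l => f (x + M * l)]
  refine tsum_congr fun l => congrArg f ?_
  simp; ring

/-! ### Quasi-periodic functions with removable singularities -/

lemma eq_of_lattice_close {τ : ℂ} (hτ : 0 < τ.im) {M : ℕ} (hM : 0 < M) :
    ∃ δ > 0, ∀ a b c d : ℤ, ‖((a / M + b * τ : ℂ)) - (c / M + d * τ)‖ < δ →
      (a / M + b * τ : ℂ) = c / M + d * τ := by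
  have hM' : (0 : ℝ) < M := by exact_mod_cast hM
  -- Distinct points differ by at least Im τ in imaginary part or, on a common horizontal line, by
  -- at least 1/M in real part.
  refine ⟨min (1 / M) τ.im, by positivity, fun a b c d h => ?_⟩
  have e : ((a / M + b * τ : ℂ)) - (c / M + d * τ) =
      ((((a - c : ℤ) : ℝ) / M : ℝ) : ℂ) + (((b - d : ℤ) : ℝ) : ℂ) * τ := by
    push_cast; ring
  rw [e] at h
  have him := (abs_im_le_norm _).trans_lt h
  have hre := (abs_re_le_norm _).trans_lt h
  rw [add_im, im_ofReal_mul, ofReal_im, zero_add, abs_mul, abs_of_pos hτ] at him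
  have hbd : b - d = 0 := by
    by_contra hne
    have h1 : (1 : ℝ) ≤ |((b - d : ℤ) : ℝ)| := by exact_mod_cast Int.one_le_abs hne
    have := him.trans_le (min_le_right _ _)
    nlinarith
  rw [add_re, re_ofReal_mul, hbd, Int.cast_zero, zero_mul, add_zero, ofReal_re, abs_div,
    abs_of_pos hM'] at hre
  have hac : a - c = 0 := by
    by_contra hne
    have h1 : (1 : ℝ) ≤ |((a - c : ℤ) : ℝ)| := by exact_mod_cast Int.one_le_abs hne
    have h2 := hre.trans_le (min_le_left _ _)
    exact absurd h2 (not_lt.2 (by gcongr))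
  rw [sub_eq_zero.1 hbd, sub_eq_zero.1 hac]

lemma eventually_not_lattice {τ : ℂ} (hτ : 0 < τ.im) {M : ℕ} (hM : 0 < M) (p : ℂ) :
    ∀ᶠ z in 𝓝[≠] p, ∀ a b : ℤ, z ≠ a / M + b * τ := by
  obtain ⟨δ, hδ, h⟩ := eq_of_lattice_close hτ hM
  have hball : ∀ᶠ z in 𝓝[≠] p, z ∈ ball p (δ / 2) :=
    nhdsWithin_le_nhds (ball_mem_nhds p (by positivity))
  -- A ball of radius δ/2 contains at most one lattice point; if that point is not p, it has to be
  -- avoided as well.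
  by_cases hex : ∃ c d : ℤ, (c / M + d * τ : ℂ) ∈ ball p (δ / 2) ∧ (c / M + d * τ : ℂ) ≠ p
  · obtain ⟨c, d, hcd, hne⟩ := hex
    filter_upwards [hball, nhdsWithin_le_nhds (isOpen_ne.mem_nhds hne.symm)] with z hz hzne a b hab
    refine hzne ?_
    rw [hab]
    refine h a b c d ?_
    rw [← hab, ← dist_eq_norm]
    calc dist z (c / M + d * τ) ≤ dist z p + dist (c / M + d * τ : ℂ) p := dist_triangle_right _ _ _
      _ < δ := by linarith [mem_ball.1 hz, mem_ball.1 hcd]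
  · push Not at hex
    filter_upwards [hball, self_mem_nhdsWithin] with z hz hzne a b hab
    exact hzne (hab.trans (hex a b (hab ▸ hz)))

/-- Liouville: |g| takes all its values on the compact period parallelogram. -/
lemma eq_const_of_norm_periodic {τ : ℂ} (hτ : 0 < τ.im) {g : ℂ → ℂ} (hg : Differentiable ℂ g)
    (h1 : ∀ z, ‖g (z + 1)‖ = ‖g z‖) (h2 : ∀ z, ‖g (z + τ)‖ = ‖g z‖) (z w : ℂ) : g z = g w := by
  refine hg.apply_eq_apply_of_bounded ?_ z w
  have hc : IsCompact ((fun p : ℝ × ℝ => (p.1 + p.2 * τ : ℂ)) '' (Set.Icc 0 1 ×ˢ Set.Icc 0 1)) :=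
    (isCompact_Icc.prod isCompact_Icc).image (by fun_prop)
  obtain ⟨C, hC⟩ := (hc.image hg.continuous).isBounded.exists_norm_le
  rw [isBounded_iff_forall_norm_le]
  refine ⟨C, ?_⟩
  rintro _ ⟨z, rfl⟩
  have hp1 : Function.Periodic (fun z => ‖g z‖) 1 := h1
  have hp2 : Function.Periodic (fun z => ‖g z‖) τ := h2
  set y := z.im / τ.im with hy
  set x := (z - y * τ).re with hx
  have hz : z = x + y * τ := by
    have : (z - y * τ).im = 0 := by
      rw [sub_im, im_ofReal_mul, hy]; field_simp; ring
    rw [← sub_eq_iff_eq_add, ← re_add_im (z - y * τ), this]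
    simp [hx]
  have e : ‖g z‖ = ‖g ((Int.fract x : ℝ) + (Int.fract y : ℝ) * τ)‖ := by
    have a1 := (hp1.int_mul ⌊x⌋) ((Int.fract x : ℝ) + (Int.fract y : ℝ) * τ)
    have a2 := (hp2.int_mul ⌊y⌋) ((Int.fract x : ℝ) + (Int.fract y : ℝ) * τ + ⌊x⌋ * 1)
    rw [← a1, ← a2]
    congr 2
    rw [hz]
    nth_rw 1 [← Int.fract_add_floor x, ← Int.fract_add_floor y]
    push_cast; ring
  rw [e]
  refine hC _ ⟨_, ⟨(Int.fract x, Int.fract y), ?_, rfl⟩, rfl⟩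
  exact ⟨⟨Int.fract_nonneg _, (Int.fract_lt_one _).le⟩, ⟨Int.fract_nonneg _, (Int.fract_lt_one _).le⟩⟩

/-- An entire function with multipliers `1` and `β` along `1` and `τ` vanishes unless
`β = e^{2πinτ}`. -/
lemma entire_eq_zero_of_quasiperiodic {τ β : ℂ} (hτ : 0 < τ.im) (hβ0 : β ≠ 0)
    (hβ : ∀ n : ℤ, β ≠ cexp (2 * Real.pi * I * n * τ)) {F : ℂ → ℂ} (hF : Differentiable ℂ F)
    (h1 : ∀ z, F (z + 1) = F z) (h2 : ∀ z, F (z + τ) = β * F z) (z : ℂ) : F z = 0 := by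
  -- κ is real, so the twist by e^{2πiκz} keeps the multiplier along 1 unimodular; its value is
  -- chosen to make the multiplier along τ unimodular too.
  set κ : ℝ := Real.log ‖β‖ / (2 * Real.pi * τ.im) with hκ
  set g : ℂ → ℂ := fun z => cexp (2 * Real.pi * I * κ * z) * F z with hgdef
  have g1 : ∀ z, g (z + 1) = cexp (2 * Real.pi * I * κ) * g z := by
    intro z; simp only [hgdef, h1]; rw [← mul_assoc, ← Complex.exp_add]; ring_nf
  have g2 : ∀ z, g (z + τ) = (cexp (2 * Real.pi * I * κ * τ) * β) * g z := by
    intro z; simp only [hgdef, h2, mul_add, Complex.exp_add]; ring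
  have n1 : ‖cexp (2 * Real.pi * I * κ)‖ = 1 := by
    rw [Complex.norm_exp]; simp
  have n2 : ‖cexp (2 * Real.pi * I * κ * τ) * β‖ = 1 := by
    rw [norm_mul, Complex.norm_exp]
    have : (2 * Real.pi * I * κ * τ).re = - Real.log ‖β‖ := by
      rw [show (2 * Real.pi * I * κ * τ : ℂ) = ((2 * Real.pi * κ : ℝ) : ℂ) * (τ * I) by
        push_cast; ring, re_ofReal_mul, mul_I_re, hκ]
      field_simp
    rw [this, Real.exp_neg, Real.exp_log (norm_pos_iff.2 hβ0)]
    exact inv_mul_cancel₀ (norm_ne_zero_iff.2 hβ0)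
  have hc := eq_const_of_norm_periodic hτ (g := g) (by fun_prop)
    (fun z => by rw [g1, norm_mul, n1, one_mul]) (fun z => by rw [g2, norm_mul, n2, one_mul])
  by_contra hz
  have hgz : g z ≠ 0 := mul_ne_zero (Complex.exp_ne_zero _) hz
  -- A nonzero constant has trivial multipliers, so κ is an integer and β = e^{-2πiκτ}, which is
  -- excluded.
  have e1 : cexp (2 * Real.pi * I * κ) = 1 :=
    mul_right_cancel₀ hgz (by rw [← g1, one_mul]; exact hc _ _)
  have e2 : cexp (2 * Real.pi * I * κ * τ) * β = 1 :=
    mul_right_cancel₀ hgz (by rw [← g2, one_mul]; exact hc _ _)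
  obtain ⟨n, hn⟩ := Complex.exp_eq_one_iff.1 e1
  have hκn : (κ : ℂ) = n := by
    have h0 := Complex.two_pi_I_ne_zero
    exact mul_left_cancel₀ h0 (by rw [hn]; ring)
  refine hβ (-n) ?_
  rw [eq_comm, ← mul_right_inj' (Complex.exp_ne_zero (2 * Real.pi * I * κ * τ)), e2,
    ← Complex.exp_add, hκn, Complex.exp_eq_one_iff]
  exact ⟨0, by push_cast; ring⟩

/-- A quasi-periodic function that is holomorphic off the lattice `ℤ/M + ℤτ`, with removable
singularities there, vanishes unless its multiplier is `e^{2πinτ}`. -/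
lemma eq_zero_of_quasiperiodic {τ β : ℂ} (hτ : 0 < τ.im) {M : ℕ} (hM : 0 < M) (hβ0 : β ≠ 0)
    (hβ : ∀ n : ℤ, β ≠ cexp (2 * Real.pi * I * n * τ)) {f : ℂ → ℂ}
    (hd : ∀ z, (∀ a b : ℤ, z ≠ a / M + b * τ) → DifferentiableAt ℂ f z)
    (hp : ∀ a : ℤ, Tendsto (fun z => (z - a / M) * f z) (𝓝[≠] (a / M : ℂ)) (𝓝 0))
    (h1 : ∀ z, (∀ a b : ℤ, z ≠ a / M + b * τ) → f (z + 1) = f z)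
    (h2 : ∀ z, (∀ a b : ℤ, z ≠ a / M + b * τ) → f (z + τ) = β * f z)
    (z : ℂ) (hz : ∀ a b : ℤ, z ≠ a / M + b * τ) : f z = 0 := by
  set S : Set ℂ := {z | ∃ a b : ℤ, z = a / M + b * τ} with hS
  have hmem : ∀ z, z ∉ S ↔ ∀ a b : ℤ, z ≠ a / M + b * τ := by intro z; simp [hS]
  have hshift : ∀ z, z ∉ S → ∀ c : ℤ, z + c * τ ∉ S := by
    rintro z hz c ⟨a, b, hab⟩
    exact hz ⟨a, b - c, by push_cast; linear_combination hab⟩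
  have hM' : (M : ℂ) ≠ 0 := by exact_mod_cast hM.ne'
  have hshift1 : ∀ z, z ∉ S → z + 1 ∉ S := by
    rintro z hz ⟨a, b, hab⟩
    exact hz ⟨a - M, b, by push_cast; field_simp; field_simp at hab; linear_combination hab⟩
  have hz2 : ∀ b : ℤ, ∀ z, z ∉ S → f (z + b * τ) = β ^ b * f z := by
    intro b
    induction b using Int.induction_on with
    | zero => simp
    | succ n ih =>
      intro z hz
      rw [show z + ((n + 1 : ℤ) : ℂ) * τ = (z + (n : ℤ) * τ) + τ by push_cast; ring,
        h2 _ ((hmem _).1 (hshift z hz n)), ih z hz, zpow_add_one₀ hβ0]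
      ring
    | pred n ih =>
      intro z hz
      have := h2 _ ((hmem _).1 (hshift z hz (-n - 1)))
      rw [show z + ((-n - 1 : ℤ) : ℂ) * τ + τ = (z + (-n : ℤ) * τ) by push_cast; ring,
        ih z hz] at this
      rw [zpow_sub_one₀ hβ0, mul_comm _ β⁻¹, mul_assoc, this, inv_mul_cancel_left₀ hβ0]
  have hev : ∀ p : ℂ, ∀ᶠ z in 𝓝[≠] p, z ∉ S := fun p =>
    (eventually_not_lattice hτ hM p).mono fun z hz => (hmem z).2 hz
  -- The hypothesis only concerns the points a/M; the iterated multiplier β^b carries it to the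
  -- whole lattice.
  have hlim : ∀ p : ℂ, Tendsto (fun z => (z - p) * f z) (𝓝[≠] p) (𝓝 0) := by
    intro p
    by_cases hpS : p ∈ S
    · obtain ⟨a, b, rfl⟩ := hpS
      have hmap : Tendsto (fun z : ℂ => z - b * τ) (𝓝[≠] (a / M + b * τ : ℂ))
          (𝓝[≠] (a / M : ℂ)) := by
        refine tendsto_nhdsWithin_iff.2 ⟨?_, ?_⟩
        · refine tendsto_nhdsWithin_of_tendsto_nhds ?_
          have : Continuous fun z : ℂ => z - b * τ := by fun_prop
          simpa using this.tendsto (a / M + b * τ : ℂ)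
        · filter_upwards [self_mem_nhdsWithin] with z hz h
          exact hz (by simp only [Set.mem_singleton_iff] at h ⊢; linear_combination h)
      have := ((hp a).comp hmap).const_mul (β ^ b)
      rw [mul_zero] at this
      refine this.congr' ?_
      filter_upwards [hev (a / M + b * τ)] with z hz
      have := hz2 b (z - b * τ) (by
        have := hshift z hz (-b); push_cast at this; rwa [neg_mul, ← sub_eq_add_neg] at this)
      rw [sub_add_cancel] at this
      simp only [Function.comp, this]; ring
    · have hc := (hd p ((hmem p).1 hpS)).continuousAt
      have : ContinuousAt (fun z => (z - p) * f z) p := by fun_prop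
      have := this.tendsto
      simp only [sub_self, zero_mul] at this
      exact tendsto_nhdsWithin_of_tendsto_nhds this
  -- F fills in the punctures by limits; Riemann's removable singularity theorem makes it entire.
  set F : ℂ → ℂ := fun z => limUnder (𝓝[≠] z) f with hFdef
  have hFf : ∀ z, z ∉ S → F z = f z := fun z hz =>
    (tendsto_nhdsWithin_of_tendsto_nhds (hd z ((hmem z).1 hz)).continuousAt.tendsto).limUnder_eq
  have hF : Differentiable ℂ F := by
    intro p
    have hsub : (fun z => f z - f p) =o[𝓝[≠] p] fun z => (z - p)⁻¹ := by
      rw [Asymptotics.isLittleO_iff_tendsto']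
      · have hcst : Tendsto (fun z => (z - p) * f p) (𝓝[≠] p) (𝓝 0) := by
          have : Continuous (fun z => (z - p) * f p) := by fun_prop
          simpa using tendsto_nhdsWithin_of_tendsto_nhds (this.tendsto p)
        refine (sub_zero (0 : ℂ) ▸ (hlim p).sub hcst).congr fun z => ?_
        rw [div_inv_eq_mul]; ring
      · filter_upwards [self_mem_nhdsWithin] with z hz h
        exact absurd (inv_eq_zero.1 h) (sub_ne_zero.2 hz)
    have hset : {z | z ∉ S} ∈ 𝓝[≠] p := hev p
    obtain ⟨U, hU, hpU, hUs⟩ := mem_nhdsWithin.1 hset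
    have := Complex.differentiableOn_update_limUnder_of_isLittleO (hU.mem_nhds hpU) (f := f)
      (fun z hz => (hd z ((hmem z).1 (hUs ⟨hz.1, hz.2⟩))).differentiableWithinAt) hsub
    refine (this.differentiableAt (hU.mem_nhds hpU)).congr_of_eventuallyEq ?_
    filter_upwards [hU.mem_nhds hpU] with z hz
    by_cases hzp : z = p
    · simp [hzp, hFdef]
    · rw [Function.update_of_ne hzp, hFf z (hUs ⟨hz, hzp⟩)]
  -- Identities known off the discrete set S extend to all of ℂ by continuity.
  have hext : ∀ {g h : ℂ → ℂ}, Differentiable ℂ g → Differentiable ℂ h →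
      (∀ z, z ∉ S → g z = h z) → ∀ z, g z = h z := by
    intro g h hg hh hgh p
    exact ((hg p).continuousAt.eventuallyEq_nhds_iff_eventuallyEq_nhdsNE
      (hh p).continuousAt |>.1 ((hev p).mono hgh)).eq_of_nhds
  have hz0 := entire_eq_zero_of_quasiperiodic hτ hβ0 hβ hF
    (hext (by fun_prop) hF fun z hz => by
      rw [hFf z hz, hFf _ (hshift1 z hz), h1 z ((hmem z).1 hz)])
    (hext (by fun_prop) (by fun_prop) fun z hz => by
      have h3 := hshift z hz 1
      rw [Int.cast_one, one_mul] at h3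
      rw [hFf z hz, hFf _ h3, h2 z ((hmem z).1 hz)]) z
  rwa [hFf z ((hmem z).2 hz)] at hz0

/-! ### Theta functions -/

lemma tau_div_im_pos {τ : ℂ} (hτ : 0 < τ.im) {k : ℕ} (hk : 0 < k) : 0 < (τ / (2 * k)).im := by
  rw [show (2 * k : ℂ) = ((2 * k : ℝ) : ℂ) by push_cast; ring, div_ofReal_im]
  positivity

lemma mul_im_pos {τ : ℂ} (hτ : 0 < τ.im) {k : ℕ} (hk : 0 < k) : 0 < (k * τ).im := by
  rw [show (k : ℂ) = ((k : ℝ) : ℂ) by push_cast; ring, im_ofReal_mul]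
  positivity

lemma neg_inv_im_pos {τ : ℂ} (hτ : 0 < τ.im) : 0 < (-1 / τ).im := by
  have h0 : τ ≠ 0 := by rintro rfl; simp at hτ
  rw [neg_div, neg_im, one_div, inv_im, neg_div, neg_neg]
  exact div_pos hτ (normSq_pos.2 h0)

/-- Θ_{j,k} as the part of a Jacobi series with index in one residue class mod 2k. Shifts of j, z
and τ then become reindexings or changes of phase. -/
lemma bigTheta_eq_tsum (j : ℤ) {k : ℕ} (hk : 0 < k) (τ z : ℂ) :
    bigTheta j k τ z = ∑' n : ℤ, jacobiTheta₂_term (j + 2 * k * n) (z / 2) (τ / (2 * k)) := by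
  have hk' : (k : ℂ) ≠ 0 := by exact_mod_cast hk.ne'
  refine tsum_congr fun n => ?_
  rw [jacobiTheta₂_term]
  congr 1
  push_cast
  field_simp
  ring

lemma bigTheta_eq_jacobiTheta₂ (j : ℤ) {k : ℕ} (hk : 0 < k) (τ z : ℂ) :
    bigTheta j k τ z = cexp (2 * Real.pi * I * (j ^ 2 * τ / (4 * k) + j * z / 2)) *
      jacobiTheta₂ (k * z + j * τ) (2 * k * τ) := by
  have hk' : (k : ℂ) ≠ 0 := by exact_mod_cast hk.ne'
  rw [jacobiTheta₂, ← tsum_mul_left]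
  refine tsum_congr fun n => ?_
  rw [jacobiTheta₂_term, ← Complex.exp_add]
  congr 1
  field_simp
  ring

lemma two_mul_im_pos {τ : ℂ} (hτ : 0 < τ.im) {k : ℕ} (hk : 0 < k) : 0 < (2 * k * τ).im := by
  have := mul_im_pos hτ (k := 2 * k) (by positivity)
  simpa using this

lemma differentiable_bigTheta (j : ℤ) {k : ℕ} (hk : 0 < k) {τ : ℂ} (hτ : 0 < τ.im) :
    Differentiable ℂ (bigTheta j k τ) := by
  rw [show bigTheta j k τ = _ from funext (bigTheta_eq_jacobiTheta₂ j hk τ)]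
  intro z
  have h : DifferentiableAt ℂ (fun z => jacobiTheta₂ (k * z + j * τ) (2 * k * τ)) z :=
    (differentiableAt_jacobiTheta₂_fst _ (two_mul_im_pos hτ hk)).comp z
      (f := fun z => k * z + j * τ) (by fun_prop)
  fun_prop

lemma bigTheta_add_two_mul (j : ℤ) {k : ℕ} (hk : 0 < k) (τ z : ℂ) :
    bigTheta (j + 2 * k) k τ z = bigTheta j k τ z := by
  rw [bigTheta_eq_tsum _ hk, bigTheta_eq_tsum _ hk, ← (Equiv.addRight (1 : ℤ)).tsum_eq
    fun n => jacobiTheta₂_term (j + 2 * k * n) (z / 2) (τ / (2 * k))]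
  refine tsum_congr fun n => ?_
  simp only [Equiv.coe_addRight]
  congr 1; ring

lemma bigTheta_add_two_mul_mul (j l : ℤ) {k : ℕ} (hk : 0 < k) (τ z : ℂ) :
    bigTheta (j + 2 * k * l) k τ z = bigTheta j k τ z := by
  have hp : Function.Periodic (fun j : ℤ => bigTheta j k τ z) (2 * k) :=
    fun j => bigTheta_add_two_mul j hk τ z
  have := hp.int_mul l j
  rwa [Int.cast_id, mul_comm l] at this

lemma bigTheta_neg (j : ℤ) {k : ℕ} (hk : 0 < k) (τ z : ℂ) :
    bigTheta j k τ (-z) = bigTheta (-j) k τ z := by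
  rw [bigTheta_eq_tsum _ hk, bigTheta_eq_tsum _ hk, ← (Equiv.neg ℤ).tsum_eq]
  refine tsum_congr fun n => ?_
  rw [jacobiTheta₂_term, jacobiTheta₂_term]
  simp only [Equiv.neg_apply]
  push_cast
  ring_nf

lemma bigTheta_add_one (j : ℤ) {k : ℕ} (hk : 0 < k) (τ z : ℂ) :
    bigTheta j k τ (z + 1) = cexp (Real.pi * I * j) * bigTheta j k τ z := by
  rw [bigTheta_eq_tsum _ hk, bigTheta_eq_tsum _ hk, ← tsum_mul_left]
  refine tsum_congr fun n => ?_
  rw [jacobiTheta₂_term, jacobiTheta₂_term, ← Complex.exp_add, Complex.exp_eq_exp_iff_exists_int]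
  exact ⟨k * n, by push_cast; ring⟩

lemma bigTheta_add_two (j : ℤ) {k : ℕ} (hk : 0 < k) (τ z : ℂ) :
    bigTheta j k τ (z + 2) = bigTheta j k τ z := by
  rw [show z + 2 = z + 1 + 1 by ring, bigTheta_add_one _ hk, bigTheta_add_one _ hk, ← mul_assoc,
    ← Complex.exp_add, show (Real.pi * I * j + Real.pi * I * j : ℂ) = j * (2 * Real.pi * I) by ring,
    Complex.exp_int_mul_two_pi_mul_I, one_mul]

lemma bigTheta_add_tau (j : ℤ) {k : ℕ} (hk : 0 < k) (τ z : ℂ) :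
    bigTheta j k τ (z + τ) =
      cexp (-(Real.pi * I * k * τ / 2) - Real.pi * I * k * z) * bigTheta (j + k) k τ z := by
  have hk' : (k : ℂ) ≠ 0 := by exact_mod_cast hk.ne'
  rw [bigTheta_eq_tsum _ hk, bigTheta_eq_tsum _ hk, ← tsum_mul_left]
  refine tsum_congr fun n => ?_
  rw [jacobiTheta₂_term, jacobiTheta₂_term, ← Complex.exp_add]
  congr 1
  push_cast
  field_simp
  ring

lemma bigTheta_tau_add (j c : ℤ) {k : ℕ} (hk : 0 < k) (τ z : ℂ) :
    bigTheta j k (τ + 4 * k * c) z = bigTheta j k τ z := by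
  have hk' : (k : ℂ) ≠ 0 := by exact_mod_cast hk.ne'
  rw [bigTheta_eq_tsum _ hk, bigTheta_eq_tsum _ hk]
  refine tsum_congr fun n => ?_
  rw [jacobiTheta₂_term, jacobiTheta₂_term, Complex.exp_eq_exp_iff_exists_int]
  refine ⟨c * (j + 2 * k * n) ^ 2, ?_⟩
  push_cast
  field_simp
  ring

lemma summable_jacobiTheta₂_term (z : ℂ) {τ : ℂ} (hτ : 0 < τ.im) :
    Summable fun n => jacobiTheta₂_term n z τ :=
  (summable_jacobiTheta₂_term_iff z τ).2 hτ

/-- Jacobi's functional equation is applied at (-z/2 + j/(2k), τ/(2k)). The resulting series over ℤ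
breaks up by residues l mod 2k, and the shift j/(2k) produces the character e^{-πijl/k}. -/
lemma bigTheta_S (j : ℤ) {k : ℕ} (hk : 0 < k) {τ : ℂ} (hτ : 0 < τ.im) (z : ℂ) :
    bigTheta j k (-1 / τ) (z / τ) =
      (-I * (τ / (2 * k))) ^ (1 / 2 : ℂ) * cexp (Real.pi * I * k * z ^ 2 / (2 * τ)) *
        ∑ l ∈ Finset.range (2 * k), cexp (-(Real.pi * I * j * l / k)) * bigTheta l k τ z := by
  have hk' : (k : ℂ) ≠ 0 := by exact_mod_cast hk.ne'
  have h0 : τ ≠ 0 := by rintro rfl; simp at hτ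
  have hsum : jacobiTheta₂ (-z / 2 + j / (2 * k)) (τ / (2 * k)) =
      ∑ l ∈ Finset.range (2 * k), cexp (-(Real.pi * I * j * l / k)) * bigTheta l k τ z := by
    rw [jacobiTheta₂, ← (Equiv.neg ℤ).tsum_eq, tsum_int_eq_sum_range (M := 2 * k) (by positivity)]
    · refine Finset.sum_congr rfl fun l _ => ?_
      rw [bigTheta_eq_tsum _ hk, ← tsum_mul_left]
      refine tsum_congr fun n => ?_
      rw [jacobiTheta₂_term, jacobiTheta₂_term, ← Complex.exp_add,
        Complex.exp_eq_exp_iff_exists_int]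
      refine ⟨- j * n, ?_⟩
      simp only [Equiv.neg_apply]
      push_cast
      field_simp
      ring
    · exact ((Equiv.neg ℤ).summable_iff (f := fun n => jacobiTheta₂_term n _ _)).2
        (summable_jacobiTheta₂_term _ (tau_div_im_pos hτ hk))
  have hc : (-I * (τ / (2 * k))) ^ (1 / 2 : ℂ) ≠ 0 := by
    rw [cpow_ne_zero_iff_of_exponent_ne_zero (by norm_num)]
    simp [h0, hk.ne']
  rw [← hsum, jacobiTheta₂_functional_equation, bigTheta_eq_jacobiTheta₂ _ hk,
    ← jacobiTheta₂_neg_left (k * (z / τ) + j * (-1 / τ))]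
  rw [show -(k * (z / τ) + j * (-1 / τ)) = (-z / 2 + j / (2 * k)) / (τ / (2 * k)) by
    field_simp; ring, show (2 * k * (-1 / τ) : ℂ) = -1 / (τ / (2 * k)) by field_simp]
  have hexp : cexp (2 * Real.pi * I * (j ^ 2 * (-1 / τ) / (4 * k) + j * (z / τ) / 2)) =
      cexp (Real.pi * I * k * z ^ 2 / (2 * τ)) *
      cexp (-Real.pi * I * (-z / 2 + j / (2 * k)) ^ 2 / (τ / (2 * k))) := by
    rw [← Complex.exp_add]; congr 1; field_simp; ring
  rw [hexp]
  field_simp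

/-! ### Jacobi's four theta functions -/

/-- Separating a Jacobi series by the parity of its index gives two functions Θ_{·,2}. This form
makes zeros and S-transformations accessible. -/
lemma vartheta_eq {τ : ℂ} (hτ : 0 < τ.im) (a b : Fin 2) (z : ℂ) :
    vartheta a b τ z = cexp (Real.pi * I * (a : ℕ) ^ 2 * τ / 4 + Real.pi * I * (a : ℕ) *
      (z + (b : ℕ) / 2)) * jacobiTheta₂ (z + (b : ℕ) / 2 + (a : ℕ) * τ / 2) τ := by
  have h2 : (0 : ℕ) < 2 := by norm_num
  have hm : bigTheta (-1) 2 τ z = bigTheta 3 2 τ z := (bigTheta_add_two_mul (-1) h2 τ z).symm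
  rw [jacobiTheta₂, tsum_int_eq_sum_range h2 (summable_jacobiTheta₂_term _ hτ),
    Finset.sum_range_succ, Finset.sum_range_one, mul_add, ← tsum_mul_left, ← tsum_mul_left]
  have e1 : cexp (Real.pi * I) = -1 := Complex.exp_pi_mul_I
  -- The class s mod 2 reproduces Θ_{j,2} up to the constant e^c; the four cases below only supply
  -- j, s, c and the integer multiple of 2πi.
  have key : ∀ (j : ℤ) (s : ℕ) (c : ℂ), (∀ n : ℤ, ∃ m : ℤ,
      (Real.pi * I * (a : ℕ) ^ 2 * τ / 4 + Real.pi * I * (a : ℕ) * (z + (b : ℕ) / 2)) +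
      (2 * Real.pi * I * (s + 2 * n) * (z + (b : ℕ) / 2 + (a : ℕ) * τ / 2) +
        Real.pi * I * (s + 2 * n) ^ 2 * τ)
      = c + (2 * Real.pi * I * (j + 4 * n) * (z / 2) + Real.pi * I * (j + 4 * n) ^ 2 * (τ / 4))
        + m * (2 * Real.pi * I)) →
      ∑' n : ℤ, cexp (Real.pi * I * (a : ℕ) ^ 2 * τ / 4 + Real.pi * I * (a : ℕ) *
      (z + (b : ℕ) / 2)) * jacobiTheta₂_term (s + (2 : ℕ) * n)
        (z + (b : ℕ) / 2 + (a : ℕ) * τ / 2) τ = cexp c * bigTheta j 2 τ z := by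
    intro j s c h
    rw [bigTheta_eq_tsum _ h2, ← tsum_mul_left]
    refine tsum_congr fun n => ?_
    rw [jacobiTheta₂_term, jacobiTheta₂_term, ← Complex.exp_add, ← Complex.exp_add,
      Complex.exp_eq_exp_iff_exists_int]
    obtain ⟨m, hm⟩ := h n
    refine ⟨m, ?_⟩
    push_cast
    norm_num
    exact hm
  have eI : cexp (Real.pi * I / 2) = I := by
    rw [show (Real.pi * I / 2 : ℂ) = (Real.pi / 2 : ℂ) * I by ring, Complex.exp_pi_div_two_mul_I]
  have eI3 : cexp (Real.pi * I / 2 + Real.pi * I) = -I := by rw [Complex.exp_add, eI, e1]; ring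
  fin_cases a <;> fin_cases b
  · rw [key 0 0 0 fun n => ⟨0, by push_cast; simp; ring⟩,
      key 2 1 0 fun n => ⟨0, by push_cast; simp; ring⟩]
    simp [vartheta]; ring
  · rw [key 0 0 0 fun n => ⟨n, by push_cast; simp; ring⟩,
      key 2 1 (Real.pi * I) fun n => ⟨n, by push_cast; simp; ring⟩, e1]
    simp [vartheta]; ring
  · rw [key 1 0 0 fun n => ⟨0, by push_cast; simp; ring⟩,
      key 3 1 0 fun n => ⟨0, by push_cast; simp; ring⟩, ← hm]
    simp [vartheta]
  · rw [key 1 0 (Real.pi * I / 2) fun n => ⟨n, by push_cast; simp; ring⟩,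
      key 3 1 (Real.pi * I / 2 + Real.pi * I) fun n => ⟨n, by push_cast; simp; ring⟩, ← hm,
      eI, eI3]
    simp [vartheta]; ring

lemma vartheta_S {τ : ℂ} (hτ : 0 < τ.im) (a b : Fin 2) (z : ℂ) :
    vartheta a b (-1 / τ) (z / τ) = (-I) ^ ((a : ℕ) * (b : ℕ)) * (-I * τ) ^ (1 / 2 : ℂ) *
      cexp (Real.pi * I * z ^ 2 / τ) * vartheta b a τ z := by
  have h0 : τ ≠ 0 := by rintro rfl; simp at hτ
  rw [vartheta_eq (neg_inv_im_pos hτ), vartheta_eq hτ]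
  have hper : Function.Periodic (fun z => jacobiTheta₂ z τ) 1 := fun z => jacobiTheta₂_add_left z τ
  have hJ : jacobiTheta₂ (z + (a : ℕ) / 2 + (b : ℕ) * τ / 2) τ =
      jacobiTheta₂ (z + (b : ℕ) * τ / 2 - (a : ℕ) / 2) τ := by
    have := hper.nat_mul (a : ℕ) (z + (b : ℕ) * τ / 2 - (a : ℕ) / 2)
    rw [← this]
    congr 1; ring
  have hc : (-I * τ) ^ (1 / 2 : ℂ) ≠ 0 := by
    rw [cpow_ne_zero_iff_of_exponent_ne_zero (by norm_num)]
    simp [h0]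
  have eI : (-I) ^ ((a : ℕ) * (b : ℕ)) = cexp (-(Real.pi * I / 2) * (a : ℕ) * (b : ℕ)) := by
    rw [show -I = cexp (-(Real.pi * I / 2)) by
      rw [show -(Real.pi * I / 2 : ℂ) = -(Real.pi / 2 : ℂ) * I by ring,
        ← Complex.exp_neg_pi_div_two_mul_I]; ring_nf, ← Complex.exp_nat_mul]
    congr 1; push_cast; ring
  rw [hJ, jacobiTheta₂_functional_equation _ τ, eI,
    show z / τ + (b : ℕ) / 2 + (a : ℕ) * (-1 / τ) / 2 =
      (z + (b : ℕ) * τ / 2 - (a : ℕ) / 2) / τ by field_simp; ring]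
  have hexp : cexp (Real.pi * I * (a : ℕ) ^ 2 * (-1 / τ) / 4 + Real.pi * I * (a : ℕ) *
      (z / τ + (b : ℕ) / 2)) = cexp (-(Real.pi * I / 2) * (a : ℕ) * (b : ℕ)) *
      cexp (Real.pi * I * z ^ 2 / τ) * cexp (Real.pi * I * (b : ℕ) ^ 2 * τ / 4 +
        Real.pi * I * (b : ℕ) * (z + (a : ℕ) / 2)) *
      cexp (-Real.pi * I * (z + (b : ℕ) * τ / 2 - (a : ℕ) / 2) ^ 2 / τ) := by
    rw [← Complex.exp_add, ← Complex.exp_add, ← Complex.exp_add]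
    congr 1; field_simp; ring
  rw [hexp]
  field_simp

/-- At such a point the reflection r ↦ -2n - 1 - r changes the sign of every term, so the sum is its
own negative. -/
lemma vartheta_eq_zero {τ : ℂ} (hτ : 0 < τ.im) (a b : Fin 2) (m n : ℤ) (z : ℂ)
    (hz : z + (b : ℕ) / 2 + (a : ℕ) * τ / 2 = 1 / 2 + m + (1 / 2 + n) * τ) :
    vartheta a b τ z = 0 := by
  rw [vartheta_eq hτ, hz]
  refine mul_eq_zero_of_right _ ?_
  rw [jacobiTheta₂]
  have key := (((Equiv.subLeft (-2 * n - 1)).tsum_eq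
    fun r => jacobiTheta₂_term r (1 / 2 + m + (1 / 2 + n) * τ) τ))
  have h2 : ∀ r : ℤ, jacobiTheta₂_term ((Equiv.subLeft (-2 * n - 1)) r)
      (1 / 2 + m + (1 / 2 + n) * τ) τ =
      -jacobiTheta₂_term r (1 / 2 + m + (1 / 2 + n) * τ) τ := by
    intro r
    have hneg : ∀ x : ℂ, -x = cexp (Real.pi * I) * x := by
      intro x; rw [Complex.exp_pi_mul_I]; ring
    rw [hneg, jacobiTheta₂_term, jacobiTheta₂_term, ← Complex.exp_add, Complex.exp_eq_exp_iff_exists_int]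
    simp only [Equiv.subLeft_apply]
    refine ⟨-(2 * n + 1) * m - 2 * r * m - r - n - 1, ?_⟩
    push_cast
    ring
  rw [tsum_congr h2, tsum_neg] at key
  exact CharZero.eq_neg_self_iff.1 key.symm

lemma differentiable_jacobiTheta₂ {τ : ℂ} (hτ : 0 < τ.im) :
    Differentiable ℂ fun z => jacobiTheta₂ z τ :=
  fun z => differentiableAt_jacobiTheta₂_fst z hτ

/-- The zeroth Fourier coefficient over [0,1] is 1, so the function cannot vanish identically. -/
lemma exists_jacobiTheta₂_ne_zero {τ : ℂ} (hτ : 0 < τ.im) : ∃ z, jacobiTheta₂ z τ ≠ 0 := by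
  by_contra! h
  have hb := summable_pow_mul_jacobiTheta₂_term_bound 0 hτ 0
  have hs := intervalIntegral.hasSum_integral_of_dominated_convergence (a := 0) (b := 1)
    (μ := MeasureTheory.volume) (F := fun (n : ℤ) (x : ℝ) => jacobiTheta₂_term n x τ)
    (f := fun x : ℝ => jacobiTheta₂ x τ)
    (fun n _ => (|n| ^ 0 : ℝ) * Real.exp (-Real.pi * (τ.im * n ^ 2 - 2 * 0 * |n|)))
    (fun n => by
      have : Continuous fun x : ℝ => jacobiTheta₂_term n x τ := by
        unfold jacobiTheta₂_term; fun_prop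
      exact this.aestronglyMeasurable)
    (fun n => by
      filter_upwards with x _
      simpa using norm_jacobiTheta₂_term_le hτ (S := 0) (z := x) (by simp) le_rfl n)
    (by filter_upwards with x _; exact hb)
    (by simp)
    (by filter_upwards with x _; exact hasSum_jacobiTheta₂_term _ hτ)
  simp only [h, intervalIntegral.integral_zero] at hs
  have hterm : ∀ n : ℤ, ∫ x in (0 : ℝ)..1, jacobiTheta₂_term n x τ = if n = 0 then 1 else 0 := by
    intro n
    split_ifs with hn
    · simp [hn, jacobiTheta₂_term]
    · have hc : (2 * Real.pi * I * n : ℂ) ≠ 0 :=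
        mul_ne_zero Complex.two_pi_I_ne_zero (by exact_mod_cast hn)
      simp only [jacobiTheta₂_term, Complex.exp_add, intervalIntegral.integral_mul_const]
      rw [integral_exp_mul_complex hc]
      have : cexp (2 * Real.pi * I * n * (1 : ℝ)) = 1 := by
        rw [Complex.exp_eq_one_iff]; exact ⟨n, by push_cast; ring⟩
      rw [this]; simp
  simp only [hterm] at hs
  have := hs.unique (hasSum_ite_eq (0 : ℤ) (1 : ℂ))
  exact zero_ne_one this

lemma differentiable_vartheta {τ : ℂ} (hτ : 0 < τ.im) (a b : Fin 2) :
    Differentiable ℂ (vartheta a b τ) := by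
  rw [show vartheta a b τ = _ from funext (vartheta_eq hτ a b)]
  intro z
  have := (differentiable_jacobiTheta₂ hτ (z + (b : ℕ) / 2 + (a : ℕ) * τ / 2)).comp z
    (f := fun z : ℂ => z + (b : ℕ) / 2 + (a : ℕ) * τ / 2) (by fun_prop)
  simp only [Function.comp_def] at this
  fun_prop

lemma exists_vartheta_ne_zero {τ : ℂ} (hτ : 0 < τ.im) (a b : Fin 2) : ∃ z, vartheta a b τ z ≠ 0 := by
  obtain ⟨z, hz⟩ := exists_jacobiTheta₂_ne_zero hτ
  refine ⟨z - ((b : ℕ) / 2 + (a : ℕ) * τ / 2), ?_⟩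
  rw [vartheta_eq hτ]
  refine mul_ne_zero (Complex.exp_ne_zero _) ?_
  convert hz using 2; ring

lemma eventually_vartheta_ne_zero {τ : ℂ} (hτ : 0 < τ.im) (a b : Fin 2) (p : ℂ) :
    ∀ᶠ z in 𝓝[≠] p, vartheta a b τ z ≠ 0 := by
  have han : AnalyticOnNhd ℂ (vartheta a b τ) Set.univ :=
    (differentiable_vartheta hτ a b).differentiableOn.analyticOnNhd isOpen_univ
  refine (han p trivial).eventually_eq_zero_or_eventually_ne_zero.resolve_left fun h => ?_
  obtain ⟨z, hz⟩ := exists_vartheta_ne_zero hτ a b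
  exact hz (han.eqOn_zero_of_preconnected_of_eventuallyEq_zero isPreconnected_univ trivial h trivial)

lemma vartheta_add_two (a b : Fin 2) (τ z : ℂ) : vartheta a b τ (z + 2) = vartheta a b τ z := by
  have h2 : (0 : ℕ) < 2 := by norm_num
  fin_cases a <;> fin_cases b <;> simp [vartheta, bigTheta_add_two _ h2]

lemma vartheta_add_two_mul (a b : Fin 2) (τ z : ℂ) (n : ℤ) :
    vartheta a b τ (z + n * 2) = vartheta a b τ z :=
  (show Function.Periodic (vartheta a b τ) 2 from vartheta_add_two a b τ).int_mul n z

lemma vartheta_tau_add (a b : Fin 2) (τ z : ℂ) (n : ℤ) :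
    vartheta a b (τ + 8 * n) z = vartheta a b τ z := by
  have h2 : (0 : ℕ) < 2 := by norm_num
  have h : ∀ j : ℤ, bigTheta j 2 (τ + 8 * n) z = bigTheta j 2 τ z := by
    intro j
    rw [← bigTheta_tau_add j n h2 τ z]; push_cast; norm_num
  fin_cases a <;> fin_cases b <;> simp [vartheta, h]

/-! ### The Dedekind eta function -/

lemma eta_S_pow_four {τ : ℂ} (hτ : 0 < τ.im) :
    ModularForm.eta (-1 / τ) ^ 4 = -τ ^ 2 * ModularForm.eta τ ^ 4 := by
  have h := ModularForm.eta_comp_eq_csqrt_I_inv hτ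
  simp only [Function.comp_apply, Pi.smul_apply, Pi.mul_apply, smul_eq_mul] at h
  have h0 : τ ≠ 0 := by rintro rfl; simp at hτ
  have hs : ∀ z : ℂ, Complex.sqrt z ^ 4 = z ^ 2 := by
    intro z
    rw [show (4 : ℕ) = 2 * 2 by norm_num, pow_mul, Complex.sqrt, ← Complex.cpow_nat_mul]; simp
  rw [h, mul_pow, mul_pow, inv_pow, hs, hs, I_sq]
  ring

/-- The period is 24 because of the factor q^{1/24}. -/
lemma eta_add (τ : ℂ) (n : ℤ) : ModularForm.eta (τ + 24 * n) = ModularForm.eta τ := by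
  have h : ∀ h : ℝ, ∀ c : ℤ, (24 : ℂ) = c * h → h ≠ 0 → Function.Periodic.qParam h (τ + 24 * n) =
      Function.Periodic.qParam h τ := by
    intro h c hc hh
    have hh' : (h : ℂ) ≠ 0 := by exact_mod_cast hh
    rw [Function.Periodic.qParam, Function.Periodic.qParam, Complex.exp_eq_exp_iff_exists_int]
    refine ⟨c * n, ?_⟩
    rw [hc]; push_cast; field_simp
  simp only [ModularForm.eta, ModularForm.eta_q, h 24 1 (by push_cast; norm_num) (by norm_num),
    h 1 24 (by push_cast; norm_num) (by norm_num)]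

lemma eta_ne_zero {τ : ℂ} (hτ : 0 < τ.im) : ModularForm.eta τ ≠ 0 :=
  ModularForm.eta_ne_zero hτ

/-! ### The error function -/

lemma continuous_gauss : Continuous fun u : ℝ => Real.exp (-Real.pi * u ^ 2) := by fun_prop

lemma hasDerivAt_errE (x : ℝ) : HasDerivAt errE (2 * Real.exp (-Real.pi * x ^ 2)) x :=
  (intervalIntegral.integral_hasDerivAt_right (continuous_gauss.intervalIntegrable _ _)
    (continuous_gauss.stronglyMeasurableAtFilter _ _) continuous_gauss.continuousAt).const_mul 2

lemma errE_neg (x : ℝ) : errE (-x) = -errE x := by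
  have h := intervalIntegral.integral_comp_neg (a := 0) (b := x)
    fun u : ℝ => Real.exp (-Real.pi * u ^ 2)
  simp only [neg_sq, neg_zero] at h
  rw [errE, errE, h, intervalIntegral.integral_symm (-x) 0]
  ring

lemma errE_mono : Monotone errE :=
  monotone_of_deriv_nonneg (fun x => (hasDerivAt_errE x).differentiableAt)
    fun x => by rw [(hasDerivAt_errE x).deriv]; positivity

lemma tendsto_errE : Tendsto errE atTop (𝓝 1) := by
  have hi : MeasureTheory.IntegrableOn (fun u : ℝ => Real.exp (-Real.pi * u ^ 2)) (Set.Ioi 0) :=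
    (integrable_exp_neg_mul_sq Real.pi_pos).integrableOn
  have h := (MeasureTheory.intervalIntegral_tendsto_integral_Ioi 0 hi tendsto_id).const_mul 2
  rw [integral_gaussian_Ioi, div_self Real.pi_ne_zero, Real.sqrt_one] at h
  rw [mul_one_div_cancel two_ne_zero] at h
  exact h

lemma errE_le_one (x : ℝ) : errE x ≤ 1 := errE_mono.ge_of_tendsto tendsto_errE x

lemma neg_one_le_errE (x : ℝ) : -1 ≤ errE x := by
  have := errE_le_one (-x)
  rw [errE_neg] at this; linarith

/-- Substitute u ↦ u + x in the tail integral and use (u + x)² ≥ u² + x² for u, x ≥ 0. -/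
lemma one_sub_errE_le {x : ℝ} (hx : 0 ≤ x) : 1 - errE x ≤ Real.exp (-Real.pi * x ^ 2) := by
  have h1 : Tendsto (fun b => errE b - errE x) atTop (𝓝 (1 - errE x)) :=
    tendsto_errE.sub_const _
  refine le_of_tendsto h1 ?_
  filter_upwards [eventually_ge_atTop x] with b hb
  have hint : ∀ a b : ℝ, IntervalIntegrable (fun u : ℝ => Real.exp (-Real.pi * u ^ 2))
      MeasureTheory.volume a b := fun a b => continuous_gauss.intervalIntegrable _ _
  have e1 : errE b - errE x = 2 * ∫ u in (0 : ℝ)..(b - x), Real.exp (-Real.pi * (u + x) ^ 2) := by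
    rw [intervalIntegral.integral_comp_add_right fun u : ℝ => Real.exp (-Real.pi * u ^ 2)]
    rw [errE, errE, ← mul_sub, intervalIntegral.integral_interval_sub_left (hint _ _) (hint _ _)]
    simp
  have e2 : ∫ u in (0 : ℝ)..(b - x), Real.exp (-Real.pi * (u + x) ^ 2) ≤
      ∫ u in (0 : ℝ)..(b - x), Real.exp (-Real.pi * x ^ 2) * Real.exp (-Real.pi * u ^ 2) := by
    refine intervalIntegral.integral_mono_on (by linarith) ?_ ?_ fun u hu => ?_
    · exact Continuous.intervalIntegrable (by fun_prop) _ _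
    · exact Continuous.intervalIntegrable (by fun_prop) _ _
    · rw [← Real.exp_add]
      refine Real.exp_le_exp.2 ?_
      nlinarith [mul_nonneg (mul_nonneg Real.pi_pos.le hu.1) hx]
  rw [intervalIntegral.integral_const_mul] at e2
  have e3 : 2 * ∫ u in (0 : ℝ)..(b - x), Real.exp (-Real.pi * u ^ 2) ≤ 1 := errE_le_one (b - x)
  rw [e1]
  have := Real.exp_pos (-Real.pi * x ^ 2)
  nlinarith

/-- Since x is within B of nc, it can have the wrong sign only for |x| ≤ B; there the difference is
at most 2 and the factor e^{πB²} absorbs it. -/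
lemma abs_sign_sub_errE_le {B c x : ℝ} (hc : 0 ≤ c) {n : ℤ} (h : |x - n * c| ≤ B) :
    |Real.sign ((n : ℝ) + 1 / 2) - errE x| ≤
      2 * Real.exp (Real.pi * B ^ 2) * Real.exp (-Real.pi * x ^ 2) := by
  have main : ∀ x : ℝ, -B ≤ x → |1 - errE x| ≤
      2 * Real.exp (Real.pi * B ^ 2) * Real.exp (-Real.pi * x ^ 2) := by
    intro x hx
    rw [abs_of_nonneg (by linarith [errE_le_one x])]
    rcases le_or_gt 0 x with h0 | h0
    · refine (one_sub_errE_le h0).trans (le_mul_of_one_le_left (Real.exp_pos _).le ?_)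
      have := Real.one_le_exp (x := Real.pi * B ^ 2) (by positivity)
      linarith
    · rw [mul_assoc, ← Real.exp_add]
      have h2 : x ^ 2 ≤ B ^ 2 := by nlinarith
      have := Real.one_le_exp (x := Real.pi * B ^ 2 + -Real.pi * x ^ 2)
        (by nlinarith [Real.pi_pos])
      linarith [neg_one_le_errE x]
  obtain ⟨h1, h2⟩ := abs_le.1 h
  rcases le_or_gt 0 n with hn | hn
  · have hn' : (0 : ℝ) ≤ n := by exact_mod_cast hn
    rw [Real.sign_of_pos (by linarith)]
    exact main x (by nlinarith)
  · have hn' : (n : ℝ) ≤ -1 := by exact_mod_cast Int.le_sub_one_of_lt hn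
    rw [Real.sign_of_neg (by linarith)]
    have := main (-x) (by nlinarith)
    rwa [errE_neg, neg_sq, sub_neg_eq_add, ← abs_neg, neg_add, ← sub_eq_add_neg] at this

/-! ### Zwegers' function -/

/-- The argument of the error function in `zwegersTerm`. -/
noncomputable def zwegersArg (m : ℕ) (τ v : ℂ) (n : ℤ) : ℝ :=
  ((n : ℝ) + 2 * m * (v.im / τ.im)) * Real.sqrt (τ.im / m)

/-- The Gaussian summand occurring in `∂R/∂v̄`. -/
noncomputable def gaussTerm (m : ℕ) (τ v : ℂ) (n : ℤ) : ℂ :=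
  Real.exp (-Real.pi * zwegersArg m τ v n ^ 2) *
    cexp (-(Real.pi * I * (n : ℂ) ^ 2 / (2 * m)) * τ - 2 * Real.pi * I * n * v)

/-- The series `∑ gaussTerm` over a residue class. -/
noncomputable def gaussR (m : ℕ) (j : ℤ) (τ v : ℂ) : ℂ :=
  ∑' l : ℤ, gaussTerm m τ v (j + 2 * m * l)

/-- Complete the square in n: apart from a factor independent of n, the Gaussian replaces v and τ in
the exponential by their conjugates. Hence ∂R/∂v̄ is a conjugate theta function (`gaussR_eq`). -/
lemma gaussTerm_eq {m : ℕ} (hm : 0 < m) {τ : ℂ} (hτ : 0 < τ.im) (v : ℂ) (n : ℤ) :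
    gaussTerm m τ v n = Real.exp (-4 * Real.pi * m * v.im ^ 2 / τ.im) *
      (starRingEnd ℂ) (jacobiTheta₂_term n v (τ / (2 * m))) := by
  have hm' : (0 : ℝ) < m := by exact_mod_cast hm
  have hmc : (m : ℂ) ≠ 0 := by exact_mod_cast hm.ne'
  rw [gaussTerm, jacobiTheta₂_term, ← Complex.exp_conj, ofReal_exp, ofReal_exp, ← Complex.exp_add,
    ← Complex.exp_add]
  congr 1
  have hsq : zwegersArg m τ v n ^ 2 = ((n : ℝ) + 2 * m * (v.im / τ.im)) ^ 2 * (τ.im / m) := by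
    rw [zwegersArg, mul_pow, Real.sq_sqrt (by positivity)]
  have e1 : -Real.pi * zwegersArg m τ v n ^ 2 = -4 * Real.pi * m * v.im ^ 2 / τ.im
      - Real.pi * n ^ 2 * τ.im / m - 4 * Real.pi * n * v.im := by
    rw [hsq]; field_simp; ring
  rw [e1]
  simp only [map_add, map_mul, map_pow, map_div₀, conj_I, conj_ofReal, map_ofNat, map_natCast,
    map_intCast]
  have hv : (v.im : ℂ) = (v - (starRingEnd ℂ) v) / (2 * I) := im_eq_sub_conj v
  have ht : (τ.im : ℂ) = (τ - (starRingEnd ℂ) τ) / (2 * I) := im_eq_sub_conj τ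
  push_cast
  have h1 : (2 * I * v.im : ℂ) = v - (starRingEnd ℂ) v := by
    rw [hv]; field_simp
  have h2 : (2 * I * τ.im : ℂ) = τ - (starRingEnd ℂ) τ := by
    rw [ht]; field_simp
  have h3 : (starRingEnd ℂ) v = v - 2 * I * v.im := by rw [h1]; ring
  have h4 : (starRingEnd ℂ) τ = τ - 2 * I * τ.im := by rw [h2]; ring
  rw [h3, h4]
  have hτ' : (τ.im : ℂ) ≠ 0 := by exact_mod_cast hτ.ne'
  field_simp
  ring_nf
  simp only [I_sq]
  ring

lemma gaussR_eq {m : ℕ} (hm : 0 < m) {τ : ℂ} (hτ : 0 < τ.im) (j : ℤ) (v : ℂ) :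
    gaussR m j τ v = Real.exp (-4 * Real.pi * m * v.im ^ 2 / τ.im) *
      (starRingEnd ℂ) (bigTheta j m τ (2 * v)) := by
  rw [gaussR, bigTheta_eq_tsum _ hm, Complex.conj_tsum, ← tsum_mul_left]
  refine tsum_congr fun l => ?_
  rw [gaussTerm_eq hm hτ, mul_div_cancel_left₀ _ (two_ne_zero)]

lemma norm_gaussTerm_le {m : ℕ} (hm : 0 < m) {τ : ℂ} (hτ : 0 < τ.im) (v : ℂ) (n : ℤ) :
    ‖gaussTerm m τ v n‖ ≤ ‖jacobiTheta₂_term n v (τ / (2 * m))‖ := by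
  rw [gaussTerm_eq hm hτ, norm_mul, RCLike.norm_conj, Complex.norm_real, Real.norm_eq_abs,
    Real.abs_exp]
  refine mul_le_of_le_one_left (norm_nonneg _) (Real.exp_le_one_iff.2 ?_)
  have : 0 ≤ 4 * Real.pi * m * v.im ^ 2 / τ.im := by positivity
  linarith [show -4 * Real.pi * m * v.im ^ 2 / τ.im = -(4 * Real.pi * m * v.im ^ 2 / τ.im) by ring]

lemma summable_gaussTerm {m : ℕ} (hm : 0 < m) {τ : ℂ} (hτ : 0 < τ.im) (v : ℂ) :
    Summable (gaussTerm m τ v) :=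
  .of_norm_bounded (summable_jacobiTheta₂_term v (tau_div_im_pos hτ hm)).norm
    (norm_gaussTerm_le hm hτ v)

/-- The real derivative of `zwegersTerm` in `v`. -/
noncomputable def zwegersTermDeriv (m : ℕ) (τ v : ℂ) (n : ℤ) : ℂ →L[ℝ] ℂ :=
  ((Real.sign ((n : ℝ) + 1 / 2) - errE (zwegersArg m τ v n) : ℝ) : ℂ) •
      ((cexp (-(Real.pi * I * (n : ℂ) ^ 2 / (2 * m)) * τ - 2 * Real.pi * I * n * v) *
        (-(2 * Real.pi * I * n))) • ContinuousLinearMap.id ℝ ℂ) +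
    cexp (-(Real.pi * I * (n : ℂ) ^ 2 / (2 * m)) * τ - 2 * Real.pi * I * n * v) •
      (ofRealCLM.comp (-((2 * Real.exp (-Real.pi * zwegersArg m τ v n ^ 2)) •
        ((2 * m / τ.im * Real.sqrt (τ.im / m)) • imCLM))))

lemma hasFDerivAt_zwegersTerm (m : ℕ) (τ v : ℂ) (n : ℤ) :
    HasFDerivAt (fun v => zwegersTerm m τ v n) (zwegersTermDeriv m τ v n) v := by
  have hx : HasFDerivAt (fun v => zwegersArg m τ v n)
      ((2 * m / τ.im * Real.sqrt (τ.im / m)) • imCLM : ℂ →L[ℝ] ℝ) v := by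
    have h := ((imCLM.hasFDerivAt (x := v)).const_mul (2 * m / τ.im * Real.sqrt (τ.im / m))).add_const
      (n * Real.sqrt (τ.im / m))
    refine h.congr_of_eventuallyEq (Eventually.of_forall fun w => ?_)
    simp only [zwegersArg, imCLM_apply]; ring
  have hE := ((hasDerivAt_errE (zwegersArg m τ v n)).comp_hasFDerivAt v hx).const_sub
    (Real.sign ((n : ℝ) + 1 / 2))
  have hE' := ofRealCLM.hasFDerivAt.comp v hE
  have hexp : HasDerivAt (fun v : ℂ => cexp (-(Real.pi * I * (n : ℂ) ^ 2 / (2 * m)) * τ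
      - 2 * Real.pi * I * n * v))
      (cexp (-(Real.pi * I * (n : ℂ) ^ 2 / (2 * m)) * τ - 2 * Real.pi * I * n * v) *
        (-(2 * Real.pi * I * n))) v := by
    refine HasDerivAt.cexp ?_
    have h := ((hasDerivAt_id v).const_mul (2 * Real.pi * I * n)).const_sub
      (-(Real.pi * I * (n : ℂ) ^ 2 / (2 * m)) * τ)
    rwa [mul_one] at h
  have hexp' := hexp.hasFDerivAt.restrictScalars ℝ
  refine (hE'.mul hexp').congr_fderiv ?_
  ext w
  simp [zwegersTermDeriv, mul_comm w]

/-- The exponential is holomorphic and the sign is constant, so only the error function contributes.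
-/
lemma zwegersTermDeriv_dbar (m : ℕ) (τ v : ℂ) (n : ℤ) :
    zwegersTermDeriv m τ v n 1 + I * zwegersTermDeriv m τ v n I =
      -(2 * I * (2 * m / τ.im * Real.sqrt (τ.im / m) : ℝ)) * gaussTerm m τ v n := by
  simp only [zwegersTermDeriv, gaussTerm, add_apply, smul_apply, ContinuousLinearMap.comp_apply,
    neg_apply, ContinuousLinearMap.id_apply, imCLM_apply, ofRealCLM_apply,
    one_im, I_im, smul_eq_mul]
  push_cast
  linear_combination (((Real.sign ((n : ℝ) + 1 / 2) : ℝ) - (errE (zwegersArg m τ v n) : ℝ) : ℂ) *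
    (cexp (-(Real.pi * I * (n : ℂ) ^ 2 / (2 * m)) * τ - 2 * Real.pi * I * n * v) *
        (-(2 * Real.pi * I * n)))) * I_mul_I

/-- A locally uniform summable bound for the derivatives of the terms of Zwegers' function. -/
noncomputable def zwegersBound (m : ℕ) (τ : ℂ) (S : ℝ) (n : ℤ) : ℝ :=
  (2 * (2 * m / τ.im * Real.sqrt (τ.im / m))) * ((|n| ^ 0 : ℝ) * Real.exp (-Real.pi *
    ((τ / (2 * m)).im * n ^ 2 - 2 * S * |n|))) +
  (2 * Real.exp (Real.pi * (2 * m / τ.im * Real.sqrt (τ.im / m) * S) ^ 2) * (2 * Real.pi)) *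
    ((|n| ^ 1 : ℝ) * Real.exp (-Real.pi * ((τ / (2 * m)).im * n ^ 2 - 2 * S * |n|)))

lemma summable_zwegersBound {m : ℕ} (hm : 0 < m) {τ : ℂ} (hτ : 0 < τ.im) (S : ℝ) :
    Summable (zwegersBound m τ S) :=
  ((summable_pow_mul_jacobiTheta₂_term_bound S (tau_div_im_pos hτ hm) 0).mul_left _).add
    ((summable_pow_mul_jacobiTheta₂_term_bound S (tau_div_im_pos hτ hm) 1).mul_left _)

lemma abs_sign_sub_errE_zwegersArg_le {m : ℕ} {τ : ℂ} (hτ : 0 < τ.im) {S : ℝ}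
    {v : ℂ} (hv : |v.im| ≤ S) (n : ℤ) :
    |Real.sign ((n : ℝ) + 1 / 2) - errE (zwegersArg m τ v n)| ≤
      2 * Real.exp (Real.pi * (2 * m / τ.im * Real.sqrt (τ.im / m) * S) ^ 2) *
        Real.exp (-Real.pi * zwegersArg m τ v n ^ 2) := by
  refine abs_sign_sub_errE_le (Real.sqrt_nonneg (τ.im / m)) ?_
  rw [show zwegersArg m τ v n - n * Real.sqrt (τ.im / m) =
    2 * m / τ.im * Real.sqrt (τ.im / m) * v.im by rw [zwegersArg]; ring, abs_mul,
    abs_of_nonneg (a := 2 * m / τ.im * Real.sqrt (τ.im / m)) (by positivity)]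
  gcongr

lemma norm_zwegersTermDeriv_le {m : ℕ} (hm : 0 < m) {τ : ℂ} (hτ : 0 < τ.im) {S : ℝ}
    {v : ℂ} (hv : |v.im| ≤ S) (n : ℤ) :
    ‖zwegersTermDeriv m τ v n‖ ≤ zwegersBound m τ S n := by
  set ex := cexp (-(Real.pi * I * (n : ℂ) ^ 2 / (2 * m)) * τ - 2 * Real.pi * I * n * v) with hex
  have hg : Real.exp (-Real.pi * zwegersArg m τ v n ^ 2) * ‖ex‖ ≤
      Real.exp (-Real.pi * ((τ / (2 * m)).im * n ^ 2 - 2 * S * |n|)) := by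
    have h1 := (norm_gaussTerm_le hm hτ v n).trans
      (norm_jacobiTheta₂_term_le (tau_div_im_pos hτ hm) hv le_rfl n)
    rwa [gaussTerm, norm_mul, Complex.norm_real, Real.norm_eq_abs, Real.abs_exp] at h1
  have hs := abs_sign_sub_errE_zwegersArg_le (m := m) hτ hv n
  set κ := 2 * m / τ.im * Real.sqrt (τ.im / m) with hκ
  have hκ0 : 0 ≤ κ := by positivity
  refine ContinuousLinearMap.opNorm_le_bound _ (by unfold zwegersBound; positivity) fun w => ?_
  rw [zwegersTermDeriv, add_apply]
  refine (norm_add_le _ _).trans ?_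
  rw [zwegersBound, ← hκ, add_comm, add_mul]
  set X := Real.exp (-Real.pi * ((τ / (2 * m)).im * n ^ 2 - 2 * S * |n|)) with hX
  refine add_le_add ?_ ?_
  · simp only [smul_apply, ContinuousLinearMap.comp_apply, neg_apply,
      imCLM_apply, ofRealCLM_apply, smul_eq_mul, norm_mul, Complex.norm_real, norm_neg,
      Real.norm_eq_abs, Real.abs_exp, ← hex, abs_two, abs_of_nonneg hκ0]
    calc ‖ex‖ * (2 * Real.exp (-Real.pi * zwegersArg m τ v n ^ 2) * (κ * |w.im|))
        = 2 * κ * (Real.exp (-Real.pi * zwegersArg m τ v n ^ 2) * ‖ex‖) * |w.im| := by ring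
      _ ≤ 2 * κ * X * ‖w‖ := by
        gcongr
        exact abs_im_le_norm w
      _ = _ := by rw [pow_zero, one_mul]
  · simp only [smul_apply, ContinuousLinearMap.id_apply, smul_eq_mul, norm_mul, Complex.norm_real,
      norm_neg, Real.norm_eq_abs, ← hex, Complex.norm_I, Complex.norm_intCast, Complex.norm_ofNat,
      abs_of_pos Real.pi_pos]
    set D := 2 * Real.exp (Real.pi * (κ * S) ^ 2) with hD
    have hD0 : 0 ≤ D := by positivity
    calc _ ≤ (D * Real.exp (-Real.pi * zwegersArg m τ v n ^ 2)) *
          (‖ex‖ * (2 * Real.pi * 1 * |(n : ℝ)|) * ‖w‖) := by gcongr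
      _ = D * (2 * Real.pi) * (|(n : ℝ)| *
          (Real.exp (-Real.pi * zwegersArg m τ v n ^ 2) * ‖ex‖)) * ‖w‖ := by ring
      _ ≤ D * (2 * Real.pi) * (|(n : ℝ)| * X) * ‖w‖ := by gcongr
      _ = _ := by rw [pow_one, Int.cast_abs]

lemma summable_zwegersTerm {m : ℕ} (hm : 0 < m) {τ : ℂ} (hτ : 0 < τ.im) (v : ℂ) :
    Summable (zwegersTerm m τ v) := by
  refine .of_norm_bounded ((summable_jacobiTheta₂_term v (tau_div_im_pos hτ hm)).norm.mul_left
    (2 * Real.exp (Real.pi * (2 * m / τ.im * Real.sqrt (τ.im / m) * |v.im|) ^ 2))) fun n => ?_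
  have hs := abs_sign_sub_errE_zwegersArg_le (m := m) hτ (le_refl |v.im|) n
  refine le_trans ?_ (mul_le_mul_of_nonneg_left (norm_gaussTerm_le hm hτ v n) (by positivity))
  rw [gaussTerm, norm_mul, Complex.norm_real, Real.norm_eq_abs, Real.abs_exp, ← mul_assoc]
  refine (norm_mul_le _ _).trans ?_
  rw [Complex.norm_real, Real.norm_eq_abs]
  exact mul_le_mul_of_nonneg_right hs (norm_nonneg _)

lemma residue_injective {m : ℕ} (hm : 0 < m) (j : ℤ) :
    Function.Injective fun l : ℤ => j + 2 * m * l := fun x y h => by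
  simpa [hm.ne'] using h

/-- `2 ∂R/∂v̄` for Zwegers' function `R`. -/
lemma hasDbar_zwegersR {m : ℕ} (hm : 0 < m) {τ : ℂ} (hτ : 0 < τ.im) (j : ℤ) (v : ℂ) :
    HasDbar (zwegersR m j τ)
      (-(2 * I * (2 * m / τ.im * Real.sqrt (τ.im / m) : ℝ)) * gaussR m j τ v) v := by
  -- On the strip |Im w| < S the derivatives of all terms share one summable bound.
  set S := |v.im| + 1 with hS
  have hopen : IsOpen {w : ℂ | |w.im| < S} := isOpen_lt (by fun_prop) continuous_const
  have hconv : Convex ℝ {w : ℂ | |w.im| < S} := by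
    have : {w : ℂ | |w.im| < S} = imLm ⁻¹' (Set.Ioo (-S) S) := by
      ext w; simp [abs_lt]
    rw [this]
    exact (convex_Ioo _ _).linear_preimage _
  have hv : v ∈ {w : ℂ | |w.im| < S} := by simp [hS]
  have hb : Summable fun l : ℤ => zwegersBound m τ S (j + 2 * m * l) :=
    (summable_zwegersBound hm hτ S).comp_injective (residue_injective hm j)
  have h0 : Summable fun l : ℤ => zwegersTerm m τ v (j + 2 * m * l) :=
    (summable_zwegersTerm hm hτ v).comp_injective (residue_injective hm j)
  have hder : HasFDerivAt (fun w => ∑' l : ℤ, zwegersTerm m τ w (j + 2 * m * l))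
      (∑' l : ℤ, zwegersTermDeriv m τ v (j + 2 * m * l)) v :=
    hasFDerivAt_tsum_of_isPreconnected (f := fun (l : ℤ) w => zwegersTerm m τ w (j + 2 * m * l))
      (f' := fun (l : ℤ) w => zwegersTermDeriv m τ w (j + 2 * m * l)) hb hopen hconv.isPreconnected
      (fun l w _ => hasFDerivAt_zwegersTerm m τ w (j + 2 * m * l))
      (fun l w hw => norm_zwegersTermDeriv_le hm hτ (le_of_lt hw) _) hv h0 hv
  refine ⟨_, hder, ?_⟩
  have hsum : Summable fun l : ℤ => zwegersTermDeriv m τ v (j + 2 * m * l) :=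
    .of_norm_bounded hb fun l => norm_zwegersTermDeriv_le hm hτ (le_of_lt hv) _
  have h1 : ∀ w : ℂ, HasSum (fun l : ℤ => zwegersTermDeriv m τ v (j + 2 * m * l) w)
      ((∑' l : ℤ, zwegersTermDeriv m τ v (j + 2 * m * l)) w) := fun w =>
    hsum.hasSum.mapL (ContinuousLinearMap.apply ℝ ℂ w)
  have h2 := ((h1 1).add ((h1 I).mul_left I)).tsum_eq
  simp only [zwegersTermDeriv_dbar] at h2
  rw [← h2, gaussR, tsum_mul_left]

/-! ### Shifts of Zwegers' function -/

lemma zwegersR_add_half {m : ℕ} (j : ℤ) (τ v : ℂ) :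
    zwegersR m j τ (v + 1 / 2) = cexp (-(Real.pi * I * j)) * zwegersR m j τ v := by
  rw [zwegersR, zwegersR, ← tsum_mul_left]
  refine tsum_congr fun n => ?_
  rw [zwegersTerm, zwegersTerm, mul_left_comm, ← Complex.exp_add]
  congr 1
  · simp
  · rw [Complex.exp_eq_exp_iff_exists_int]
    exact ⟨-(m * n), by push_cast; ring⟩

lemma zwegersR_tau_add {m : ℕ} (hm : 0 < m) (j c : ℤ) (τ v : ℂ) :
    zwegersR m j (τ + 4 * m * c) v = zwegersR m j τ v := by
  have hmc : (m : ℂ) ≠ 0 := by exact_mod_cast hm.ne'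
  have him : (τ + 4 * m * c).im = τ.im := by simp
  refine tsum_congr fun n => ?_
  rw [zwegersTerm, zwegersTerm, him]
  congr 1
  rw [Complex.exp_eq_exp_iff_exists_int]
  refine ⟨-(c * (j + 2 * m * n) ^ 2), ?_⟩
  push_cast
  field_simp
  ring

/-- The exponential factor of `zwegersTerm`. -/
noncomputable def zwegersExp (m : ℕ) (τ v : ℂ) (n : ℤ) : ℂ :=
  cexp (-(Real.pi * I * (n : ℂ) ^ 2 / (2 * m)) * τ - 2 * Real.pi * I * n * v)

/-- The correction `sign (n - m + ½) - sign (n + ½)`, times the exponential factor. -/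
noncomputable def zwegersCorr (m : ℕ) (τ v : ℂ) (n : ℤ) : ℂ :=
  if n ∈ Finset.Ico (0 : ℤ) m then -2 * zwegersExp m τ v n else 0

lemma sign_sub_sign (m : ℕ) (n : ℤ) :
    Real.sign (((n - m : ℤ) : ℝ) + 1 / 2) - Real.sign ((n : ℝ) + 1 / 2) =
      if n ∈ Finset.Ico (0 : ℤ) m then -2 else 0 := by
  have hpos : ∀ k : ℤ, 0 ≤ k → Real.sign ((k : ℝ) + 1 / 2) = 1 := fun k hk => by
    have : (0 : ℝ) ≤ k := by exact_mod_cast hk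
    exact Real.sign_of_pos (by linarith)
  have hneg : ∀ k : ℤ, k < 0 → Real.sign ((k : ℝ) + 1 / 2) = -1 := fun k hk => by
    have : (k : ℝ) ≤ -1 := by exact_mod_cast Int.le_sub_one_of_lt hk
    exact Real.sign_of_neg (by linarith)
  split_ifs with h
  · rw [Finset.mem_Ico] at h
    rw [hpos n h.1, hneg (n - m) (by omega)]; norm_num
  · rw [Finset.mem_Ico, not_and_or, not_le, not_lt] at h
    rcases h with h | h
    · rw [hneg n h, hneg (n - m) (by omega)]; norm_num
    · rw [hpos n (by omega), hpos (n - m) (by omega)]; norm_num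

/-- Replacing v by v + τ/2 and n by n - m leaves the argument of the error function unchanged. Only
the sign can jump, and it does so just for 0 ≤ n < m. -/
lemma zwegersTerm_add_tau_half {m : ℕ} (hm : 0 < m) {τ : ℂ} (hτ : 0 < τ.im) (v : ℂ) (n : ℤ) :
    zwegersTerm m τ (v + τ / 2) (n - m) = cexp (Real.pi * I * m * τ / 2 + 2 * Real.pi * I * m * v) *
      (zwegersTerm m τ v n + zwegersCorr m τ v n) := by
  have hmc : (m : ℂ) ≠ 0 := by exact_mod_cast hm.ne'
  have harg : (((n - m : ℤ) : ℝ) + 2 * m * ((v + τ / 2).im / τ.im)) =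
      (n : ℝ) + 2 * m * (v.im / τ.im) := by
    rw [add_im, show (τ / 2).im = τ.im / 2 by simp]
    push_cast
    field_simp; ring
  have hexp : cexp (-(Real.pi * I * ((n - m : ℤ) : ℂ) ^ 2 / (2 * m)) * τ -
      2 * Real.pi * I * ((n - m : ℤ) : ℂ) * (v + τ / 2)) =
      cexp (Real.pi * I * m * τ / 2 + 2 * Real.pi * I * m * v) * zwegersExp m τ v n := by
    rw [zwegersExp, ← Complex.exp_add]
    congr 1
    push_cast
    field_simp
    ring
  have hcorr : zwegersCorr m τ v n = ((Real.sign (((n - m : ℤ) : ℝ) + 1 / 2) -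
      Real.sign ((n : ℝ) + 1 / 2) : ℝ) : ℂ) * zwegersExp m τ v n := by
    rw [sign_sub_sign, zwegersCorr]; split_ifs <;> simp
  rw [zwegersTerm, zwegersTerm, harg, hexp, hcorr, zwegersExp]
  push_cast
  ring

/-! ### The sum over `j` in `Φ_add` -/

lemma norm_bigTheta_sub_le {m : ℕ} (hm : 0 < m) (τ u : ℂ) :
    ∃ C, ∀ r : ℤ, ‖bigTheta r m τ u‖ ≤ C := by
  refine ⟨∑ j ∈ Finset.range (2 * m), ‖bigTheta j m τ u‖, fun r => ?_⟩
  have h2m : (0 : ℤ) < 2 * m := by exact_mod_cast (by omega : 0 < 2 * m)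
  have hr : bigTheta r m τ u = bigTheta ((r % (2 * m)).toNat : ℤ) m τ u := by
    rw [Int.toNat_of_nonneg (Int.emod_nonneg _ h2m.ne')]
    conv_lhs => rw [← Int.emod_add_mul_ediv r (2 * m)]
    exact bigTheta_add_two_mul_mul _ _ hm _ _
  rw [hr]
  refine Finset.single_le_sum (f := fun j : ℕ => ‖bigTheta j m τ u‖) (fun _ _ => norm_nonneg _) ?_
  rw [Finset.mem_range]
  have := Int.emod_lt_of_pos r h2m
  omega

/-- The odd theta function `Θ_{j,m} - Θ_{-j,m}`. -/
noncomputable def oddTheta (m : ℕ) (τ u : ℂ) (j : ℤ) : ℂ := bigTheta j m τ u - bigTheta (-j) m τ u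

/-- The sum over `j` in `Φ_add`. -/
noncomputable def addSum (m : ℕ) (τ v u : ℂ) : ℂ :=
  ∑ j ∈ Finset.range (2 * m), zwegersR m j τ v * oddTheta m τ u j

/-- The sum over `j` in `∂Φ_add/∂v̄`. -/
noncomputable def gaussSum (m : ℕ) (τ v u : ℂ) : ℂ :=
  ∑ j ∈ Finset.range (2 * m), gaussR m j τ v * oddTheta m τ u j

lemma oddTheta_add_two_mul_mul {m : ℕ} (hm : 0 < m) (τ u : ℂ) (j l : ℤ) :
    oddTheta m τ u (j + 2 * m * l) = oddTheta m τ u j := by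
  rw [oddTheta, oddTheta, bigTheta_add_two_mul_mul _ _ hm,
    show -(j + 2 * m * l) = -j + 2 * m * (-l) by ring, bigTheta_add_two_mul_mul _ _ hm]

lemma oddTheta_neg {m : ℕ} (hm : 0 < m) (τ u : ℂ) (j : ℤ) :
    oddTheta m τ (-u) j = -oddTheta m τ u j := by
  rw [oddTheta, oddTheta, bigTheta_neg _ hm, bigTheta_neg _ hm, neg_neg]; ring

lemma addSum_neg {m : ℕ} (hm : 0 < m) (τ v u : ℂ) : addSum m τ v (-u) = -addSum m τ v u := by
  simp only [addSum, oddTheta_neg hm, mul_neg, Finset.sum_neg_distrib]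

lemma Summable.mul_oddTheta {m : ℕ} (hm : 0 < m) {f : ℤ → ℂ} (hf : Summable f) (τ u : ℂ) :
    Summable fun r => f r * oddTheta m τ u r := by
  obtain ⟨C, hC⟩ := norm_bigTheta_sub_le hm τ u
  refine .of_norm_bounded (hf.norm.mul_right (C + C)) fun r => ?_
  rw [norm_mul, oddTheta]
  gcongr
  exact (norm_sub_le _ _).trans (add_le_add (hC _) (hC _))

lemma tsum_mul_oddTheta {m : ℕ} (hm : 0 < m) {f : ℤ → ℂ} (hf : Summable f) (τ u : ℂ) :
    ∑' r, f r * oddTheta m τ u r =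
      ∑ j ∈ Finset.range (2 * m), (∑' l : ℤ, f (j + 2 * m * l)) * oddTheta m τ u j := by
  rw [tsum_int_eq_sum_range (M := 2 * m) (by positivity) (Summable.mul_oddTheta hm hf τ u)]
  refine Finset.sum_congr rfl fun j _ => ?_
  rw [← tsum_mul_right]
  refine tsum_congr fun l => ?_
  push_cast
  rw [oddTheta_add_two_mul_mul hm]

/-- The odd theta function depends only on the residue of its index, so the finite sum of series is
one series over ℤ, in which the index may be shifted by m. -/
lemma addSum_eq_tsum {m : ℕ} (hm : 0 < m) {τ : ℂ} (hτ : 0 < τ.im) (v u : ℂ) :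
    addSum m τ v u = ∑' r, zwegersTerm m τ v r * oddTheta m τ u r :=
  (tsum_mul_oddTheta hm (summable_zwegersTerm hm hτ v) τ u).symm

lemma gaussSum_eq_tsum {m : ℕ} (hm : 0 < m) {τ : ℂ} (hτ : 0 < τ.im) (v u : ℂ) :
    gaussSum m τ v u = ∑' r, gaussTerm m τ v r * oddTheta m τ u r :=
  (tsum_mul_oddTheta hm (summable_gaussTerm hm hτ v) τ u).symm

lemma oddTheta_add_one {m : ℕ} (hm : 0 < m) (τ u : ℂ) (j : ℤ) :
    oddTheta m τ (u + 1) j = cexp (Real.pi * I * j) * oddTheta m τ u j := by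
  rw [oddTheta, oddTheta, bigTheta_add_one _ hm, bigTheta_add_one _ hm,
    show cexp (Real.pi * I * (-j : ℤ)) = cexp (Real.pi * I * j) by
      rw [Complex.exp_eq_exp_iff_exists_int]; exact ⟨-j, by push_cast; ring⟩]
  ring

lemma addSum_add_one {m : ℕ} (hm : 0 < m) (τ v u : ℂ) :
    addSum m τ (v + 1 / 2) (u + 1) = addSum m τ v u := by
  refine Finset.sum_congr rfl fun j _ => ?_
  rw [zwegersR_add_half, oddTheta_add_one hm]
  push_cast
  rw [mul_mul_mul_comm, ← Complex.exp_add, neg_add_cancel, Complex.exp_zero, one_mul]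

lemma addSum_tau_add {m : ℕ} (hm : 0 < m) (c : ℤ) (τ v u : ℂ) :
    addSum m (τ + 4 * m * c) v u = addSum m τ v u := by
  refine Finset.sum_congr rfl fun j _ => ?_
  rw [zwegersR_tau_add hm, oddTheta, oddTheta, bigTheta_tau_add _ _ hm, bigTheta_tau_add _ _ hm]

lemma oddTheta_add_tau {m : ℕ} (hm : 0 < m) (τ u : ℂ) (j : ℤ) :
    oddTheta m τ (u + τ) (j - m) =
      cexp (-(Real.pi * I * m * τ / 2) - Real.pi * I * m * u) * oddTheta m τ u j := by
  rw [oddTheta, oddTheta, bigTheta_add_tau _ hm, bigTheta_add_tau _ hm, sub_add_cancel,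
    show -(j - m) + m = -j + 2 * m by ring, bigTheta_add_two_mul _ hm]
  ring

/-- The defect from quasi-periodicity consists of the m sign jumps; `phiMod_add_tau` cancels it
against the defect of the Appell sums. -/
lemma addSum_add_tau {m : ℕ} (hm : 0 < m) {τ : ℂ} (hτ : 0 < τ.im) (v u : ℂ) :
    addSum m τ (v + τ / 2) (u + τ) = cexp (2 * Real.pi * I * m * (v - u / 2)) *
      (addSum m τ v u - 2 * ∑ r ∈ Finset.range m, zwegersExp m τ v r * oddTheta m τ u r) := by
  have hcorr : HasSum (fun r => zwegersCorr m τ v r * oddTheta m τ u r)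
      (-2 * ∑ r ∈ Finset.range m, zwegersExp m τ v r * oddTheta m τ u r) := by
    have h1 : ∀ r ∉ Finset.Ico (0 : ℤ) m, zwegersCorr m τ v r * oddTheta m τ u r = 0 := by
      intro r hr; rw [zwegersCorr, if_neg hr, zero_mul]
    have h2 := hasSum_sum_of_ne_finset_zero (L := .unconditional ℤ) h1
    convert! h2 using 1
    rw [Finset.mul_sum]
    refine Finset.sum_bij (fun r _ => (r : ℤ)) (fun r hr => ?_) (by simp) (fun r hr => ?_)
      (fun r hr => ?_)
    · simpa using hr
    · rw [Finset.mem_Ico] at hr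
      exact ⟨r.toNat, by simpa using by omega, by omega⟩
    · rw [zwegersCorr, if_pos (by simpa using hr), mul_assoc]
  have hz := (Summable.mul_oddTheta hm (summable_zwegersTerm hm hτ v) τ u).hasSum
  rw [addSum_eq_tsum hm hτ, addSum_eq_tsum hm hτ, ← (Equiv.subRight (m : ℤ)).tsum_eq]
  have hs := ((hz.add hcorr).mul_left (cexp (2 * Real.pi * I * m * (v - u / 2)))).tsum_eq
  rw [neg_mul, ← sub_eq_add_neg] at hs
  rw [← hs]
  refine tsum_congr fun r => ?_
  rw [Equiv.subRight_apply, zwegersTerm_add_tau_half hm hτ, oddTheta_add_tau hm, ← add_mul,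
    mul_mul_mul_comm, ← Complex.exp_add]
  congr 2
  ring

lemma differentiable_oddTheta {m : ℕ} (hm : 0 < m) {τ : ℂ} (hτ : 0 < τ.im) (j : ℤ) :
    Differentiable ℂ fun u => oddTheta m τ u j :=
  (differentiable_bigTheta j hm hτ).sub (differentiable_bigTheta (-j) hm hτ)

lemma differentiable_zwegersR {m : ℕ} (hm : 0 < m) {τ : ℂ} (hτ : 0 < τ.im) (j : ℤ) :
    Differentiable ℝ (zwegersR m j τ) := fun v => (hasDbar_zwegersR hm hτ j v).differentiableAt_real

lemma differentiable_addSum {m : ℕ} (hm : 0 < m) {τ : ℂ} (hτ : 0 < τ.im) :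
    Differentiable ℝ fun p : ℂ × ℂ => addSum m τ p.1 p.2 := by
  unfold addSum
  have h1 := differentiable_zwegersR hm hτ
  have h2 := fun j => (differentiable_oddTheta hm hτ j).restrictScalars ℝ
  have h3 : ∀ j, Differentiable ℝ fun p : ℂ × ℂ => zwegersR m j τ p.1 :=
    fun j => (h1 j).comp differentiable_fst
  have h4 : ∀ j, Differentiable ℝ fun p : ℂ × ℂ => oddTheta m τ p.2 j :=
    fun j => (h2 j).comp differentiable_snd
  exact Differentiable.fun_sum fun j _ => (h3 j).mul (h4 j)

lemma hasDbar_addSum {m : ℕ} (hm : 0 < m) {τ : ℂ} (hτ : 0 < τ.im) (z₁ z₂ : ℂ) :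
    HasDbar (fun z => addSum m τ ((z - z₂) / 2) (z + z₂))
      (-(I * (2 * m / τ.im * Real.sqrt (τ.im / m) : ℝ)) *
        gaussSum m τ ((z₁ - z₂) / 2) (z₁ + z₂)) z₁ := by
  have h : ∀ j ∈ Finset.range (2 * m), HasDbar
      (fun z => oddTheta m τ (z + z₂) j * zwegersR m j τ ((z - z₂) / 2))
      (oddTheta m τ (z₁ + z₂) j * ((starRingEnd ℂ) (1 / 2) *
        (-(2 * I * (2 * m / τ.im * Real.sqrt (τ.im / m) : ℝ)) *
          gaussR m j τ ((z₁ - z₂) / 2)))) z₁ := by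
    intro j _
    refine HasDbar.mul_left ?_ ?_
    · exact (hasDbar_zwegersR hm hτ j _).comp (((hasDerivAt_id z₁).sub_const z₂).div_const 2)
    · exact (differentiable_oddTheta hm hτ j _).comp z₁ (f := fun z => z + z₂) (by fun_prop)
  have := HasDbar.sum h
  convert! this using 1
  · ext z; simp only [addSum, mul_comm]
  · rw [gaussSum, Finset.mul_sum]
    refine Finset.sum_congr rfl fun j _ => ?_
    rw [map_div₀, map_one, map_ofNat]
    ring

/-! ### Modular behaviour of `gaussSum` -/

lemma sum_exp_range {M : ℕ} (hM : 0 < M) (d : ℤ) :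
    ∑ j ∈ Finset.range M, cexp (2 * Real.pi * I * j * d / M) = if (M : ℤ) ∣ d then (M : ℂ) else 0 := by
  have hMc : (M : ℂ) ≠ 0 := by exact_mod_cast hM.ne'
  have hpow : ∀ j : ℕ, cexp (2 * Real.pi * I * j * d / M) = cexp (2 * Real.pi * I * d / M) ^ j := by
    intro j; rw [← Complex.exp_nat_mul]; congr 1; ring
  simp only [hpow]
  split_ifs with h
  · obtain ⟨k, rfl⟩ := h
    have : cexp (2 * Real.pi * I * (M * k : ℤ) / M) = 1 := by
      rw [Complex.exp_eq_one_iff]; exact ⟨k, by push_cast; field_simp⟩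
    simp only [this, one_pow]; simp
  · have hne : cexp (2 * Real.pi * I * d / M) ≠ 1 := by
      rw [Ne, Complex.exp_eq_one_iff]
      rintro ⟨k, hk⟩
      refine h ⟨k, ?_⟩
      have : (d : ℂ) = M * k := by
        have h0 := Complex.two_pi_I_ne_zero
        apply mul_left_cancel₀ h0
        field_simp at hk
        linear_combination (2 * Real.pi * I) * hk
      exact_mod_cast this
    have h1 := geom_sum_mul (cexp (2 * Real.pi * I * d / M)) M
    have h2 : cexp (2 * Real.pi * I * d / M) ^ M = 1 := by
      rw [← Complex.exp_nat_mul, Complex.exp_eq_one_iff]; exact ⟨d, by field_simp⟩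
    rw [h2, sub_self] at h1
    exact (mul_eq_zero.1 h1).resolve_right (sub_ne_zero.2 hne)

lemma oddTheta_S {m : ℕ} (hm : 0 < m) {τ : ℂ} (hτ : 0 < τ.im) (u : ℂ) (j : ℤ) :
    oddTheta m (-1 / τ) (u / τ) j = (-I * (τ / (2 * m))) ^ (1 / 2 : ℂ) *
      cexp (Real.pi * I * m * u ^ 2 / (2 * τ)) *
        ∑ l ∈ Finset.range (2 * m), cexp (-(Real.pi * I * j * l / m)) * oddTheta m τ u l := by
  rw [oddTheta, ← bigTheta_neg _ hm, ← neg_div, bigTheta_S _ hm hτ, bigTheta_S _ hm hτ, neg_sq,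
    ← mul_sub, ← Finset.sum_sub_distrib]
  congr 1
  refine Finset.sum_congr rfl fun l _ => ?_
  rw [oddTheta, bigTheta_neg _ hm]; ring

/-- Compares the prefactors e^{-4πm(Im v)²/Im τ} at τ and at -1/τ: their discrepancy turns the
conjugate exponential from the theta transformation into a holomorphic one. -/
lemma im_sq_div {τ : ℂ} (hτ : 0 < τ.im) (v : ℂ) :
    (v ^ 2 / τ).im = v.im ^ 2 / τ.im - (v / τ).im ^ 2 / (-1 / τ).im := by
  have h0 : τ ≠ 0 := by rintro rfl; simp at hτ
  have hn : 0 < normSq τ := normSq_pos.2 h0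
  have e1 : (-1 / τ).im = τ.im / normSq τ := by simp [neg_div]
  rw [e1, div_im, div_im]
  have hns : normSq τ = τ.re ^ 2 + τ.im ^ 2 := by rw [normSq_apply]; ring
  simp only [sq, mul_re, mul_im]
  field_simp
  rw [hns]
  ring

/-- `gaussSum` transforms like `|τ|` times a Jacobi form of weight `0`. -/
lemma gaussSum_S {m : ℕ} (hm : 0 < m) {τ : ℂ} (hτ : 0 < τ.im) (v u : ℂ) :
    gaussSum m (-1 / τ) (v / τ) (u / τ) =
      ‖τ‖ * cexp (2 * Real.pi * I * m * (u ^ 2 / 4 - v ^ 2) / τ) * gaussSum m τ v u := by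
  have h0 : τ ≠ 0 := by rintro rfl; simp at hτ
  have hmc : (m : ℂ) ≠ 0 := by exact_mod_cast hm.ne'
  set c : ℂ := (-I * (τ / (2 * m))) ^ (1 / 2 : ℂ) with hc
  -- The square root from the theta function meets its conjugate from `gaussR`, so no choice of
  -- branch survives.
  have hcc : (starRingEnd ℂ) c * c = (‖τ‖ / (2 * m) : ℝ) := by
    rw [← Complex.normSq_eq_conj_mul_self, Complex.normSq_eq_norm_sq, ← norm_pow, hc,
      ← Complex.cpow_nat_mul]
    simp
  set X : ℂ := Real.exp (-4 * Real.pi * m * (v / τ).im ^ 2 / (-1 / τ).im) *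
    (starRingEnd ℂ) (cexp (Real.pi * I * m * (2 * v) ^ 2 / (2 * τ))) with hX
  have hXe : X = cexp (-(2 * Real.pi * I * m * v ^ 2 / τ)) *
      Real.exp (-4 * Real.pi * m * v.im ^ 2 / τ.im) := by
    have hi := im_sq_div hτ v
    have e1 : (starRingEnd ℂ) (cexp (Real.pi * I * m * (2 * v) ^ 2 / (2 * τ))) =
        cexp (-(2 * Real.pi * I * m * (starRingEnd ℂ) (v ^ 2 / τ))) := by
      rw [← Complex.exp_conj]
      congr 1
      rw [show Real.pi * I * m * (2 * v) ^ 2 / (2 * τ) = 2 * Real.pi * I * m * (v ^ 2 / τ) by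
        field_simp]
      simp only [map_mul, conj_I, conj_ofReal, map_ofNat, map_natCast]
      ring
    have e2 : (starRingEnd ℂ) (v ^ 2 / τ) = v ^ 2 / τ - 2 * I * (v ^ 2 / τ).im := by
      rw [im_eq_sub_conj]; field_simp; ring
    rw [hX, e1, e2, hi, ofReal_exp, ofReal_exp, ← Complex.exp_add, ← Complex.exp_add]
    congr 1
    push_cast
    ring_nf
    simp only [I_sq]
    ring
  have hR : ∀ j : ℤ, gaussR m j (-1 / τ) (v / τ) = X * (starRingEnd ℂ) c *
      ∑ k ∈ Finset.range (2 * m), cexp (Real.pi * I * j * k / m) *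
        (starRingEnd ℂ) (bigTheta k m τ (2 * v)) := by
    intro j
    rw [gaussR_eq hm (neg_inv_im_pos hτ), ← mul_div_assoc, bigTheta_S _ hm hτ, hX, map_mul, map_mul,
      map_sum]
    rw [show ∀ a b d e : ℂ, a * (b * d * e) = a * d * b * e by intros; ring]
    congr 1
    refine Finset.sum_congr rfl fun k _ => ?_
    rw [map_mul, ← Complex.exp_conj]
    congr 2
    simp only [map_mul, map_neg, map_div₀, conj_I, conj_ofReal, map_natCast, map_intCast]
    ring
  -- Orthogonality of the characters mod 2m leaves only the diagonal, and its factor 2m cancels the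
  -- 1/(2m) in `hcc`.
  have horth : ∀ k ∈ Finset.range (2 * m), ∀ l ∈ Finset.range (2 * m),
      ∑ j ∈ Finset.range (2 * m), cexp (Real.pi * I * (j : ℤ) * k / m) *
        cexp (-(Real.pi * I * (j : ℤ) * l / m)) = if k = l then (2 * m : ℂ) else 0 := by
    intro k hk l hl
    have := sum_exp_range (M := 2 * m) (by positivity) (k - l)
    rw [Finset.mem_range] at hk hl
    have hiff : ((2 * m : ℕ) : ℤ) ∣ (k : ℤ) - l ↔ k = l := by
      constructor
      · intro h
        have h3 := Int.eq_zero_of_abs_lt_dvd h (by rw [abs_lt]; omega)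
        omega
      · rintro rfl; simp
    rw [if_congr hiff rfl rfl] at this
    push_cast at this ⊢
    rw [← this]
    refine Finset.sum_congr rfl fun j _ => ?_
    rw [← Complex.exp_add]
    congr 1
    field_simp
    ring
  have hmain : gaussSum m (-1 / τ) (v / τ) (u / τ) = X * cexp (Real.pi * I * m * u ^ 2 / (2 * τ)) *
      ((starRingEnd ℂ) c * c) * ∑ k ∈ Finset.range (2 * m), ∑ l ∈ Finset.range (2 * m),
        (starRingEnd ℂ) (bigTheta k m τ (2 * v)) * oddTheta m τ u l *
        ∑ j ∈ Finset.range (2 * m), cexp (Real.pi * I * (j : ℤ) * k / m) *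
        cexp (-(Real.pi * I * (j : ℤ) * l / m)) := by
    rw [gaussSum]
    simp only [hR, oddTheta_S hm hτ, ← hc]
    rw [Finset.sum_congr rfl fun j _ => mul_mul_mul_comm _ _ _ _, ← Finset.mul_sum]
    congr 1
    · ring
    simp only [Finset.sum_mul_sum]
    simp only [Finset.mul_sum]
    rw [Finset.sum_comm]
    refine Finset.sum_congr rfl fun k _ => ?_
    rw [Finset.sum_comm]
    refine Finset.sum_congr rfl fun l _ => Finset.sum_congr rfl fun j _ => ?_
    ring
  rw [hmain, Finset.sum_congr rfl fun k hk => Finset.sum_congr rfl fun l hl => by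
    rw [horth k hk l hl]]
  simp only [mul_ite, mul_zero, Finset.sum_ite_eq]
  rw [Finset.sum_congr rfl fun k hk => if_pos hk, hXe, hcc, gaussSum]
  simp only [gaussR_eq hm hτ]
  rw [← Finset.sum_mul]
  have e3 : cexp (2 * Real.pi * I * m * (u ^ 2 / 4 - v ^ 2) / τ) =
      cexp (-(2 * Real.pi * I * m * v ^ 2 / τ)) * cexp (Real.pi * I * m * u ^ 2 / (2 * τ)) := by
    rw [← Complex.exp_add]; congr 1; field_simp; ring
  rw [e3]
  simp only [mul_assoc, ← Finset.mul_sum]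
  push_cast
  field_simp

/-! ### Splitting `gaussSum` along `M`-torsion -/

/-- Scaling τ by M² and v by M amounts to sampling the terms at τ along the progression md + Mn. -/
lemma gaussTerm_split {m M : ℕ} (hm : 0 < m) (hM : 0 < M) {τ : ℂ} (hτ : 0 < τ.im) (v : ℂ) (d n : ℤ) :
    gaussTerm m (M ^ 2 * τ) (M * (v + d * τ / 2)) n =
      cexp (Real.pi * I * m * d ^ 2 * τ / 2 + 2 * Real.pi * I * m * d * v) *
        gaussTerm m τ v (m * d + M * n) := by
  have hmc : (m : ℂ) ≠ 0 := by exact_mod_cast hm.ne'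
  have hMr : (M : ℝ) ≠ 0 := by exact_mod_cast hM.ne'
  have harg : zwegersArg m (M ^ 2 * τ) (M * (v + d * τ / 2)) n = zwegersArg m τ v (m * d + M * n) := by
    have i1 : ((M : ℂ) ^ 2 * τ).im = M ^ 2 * τ.im := by
      rw [show (M : ℂ) ^ 2 = ((M ^ 2 : ℝ) : ℂ) by push_cast; ring, im_ofReal_mul]
    have i2 : ((M : ℂ) * (v + d * τ / 2)).im = M * (v.im + d * τ.im / 2) := by
      rw [show (M : ℂ) = ((M : ℝ) : ℂ) by push_cast; ring, im_ofReal_mul, add_im,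
        show (d * τ / 2 : ℂ) = ((d / 2 : ℝ) : ℂ) * τ by push_cast; ring, im_ofReal_mul]
      ring
    rw [zwegersArg, zwegersArg, i1, i2,
      show (M : ℝ) ^ 2 * τ.im / m = M ^ 2 * (τ.im / m) by ring, Real.sqrt_mul (by positivity),
      Real.sqrt_sq (by positivity)]
    push_cast
    field_simp
    ring
  rw [gaussTerm, gaussTerm, harg]
  refine (congrArg (_ * ·) ?_).trans (mul_left_comm _ _ _)
  rw [← Complex.exp_add]
  congr 1
  push_cast
  field_simp
  ring

lemma jacobiTheta₂_term_split {m M : ℕ} (hm : 0 < m) (τ u : ℂ) (d n : ℤ) :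
    jacobiTheta₂_term n (M * (u + d * τ) / 2) (M ^ 2 * τ / (2 * m)) =
      cexp (-(Real.pi * I * m * d ^ 2 * τ / 2) - Real.pi * I * m * d * u) *
        jacobiTheta₂_term (m * d + M * n) (u / 2) (τ / (2 * m)) := by
  have hmc : (m : ℂ) ≠ 0 := by exact_mod_cast hm.ne'
  rw [jacobiTheta₂_term, jacobiTheta₂_term, ← Complex.exp_add]
  congr 1
  push_cast
  field_simp
  ring

/-- The even analogue of `gaussSum`. -/
noncomputable def gaussTheta (m : ℕ) (τ v u : ℂ) : ℂ :=
  ∑' r, gaussTerm m τ v r * bigTheta r m τ u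

lemma summable_gaussTerm_mul {m : ℕ} (hm : 0 < m) {τ : ℂ} (hτ : 0 < τ.im) (v : ℂ) {f : ℤ → ℂ} {C : ℝ}
    (hf : ∀ r, ‖f r‖ ≤ C) : Summable fun r => gaussTerm m τ v r * f r :=
  .of_norm_bounded ((summable_gaussTerm hm hτ v).norm.mul_right C) fun r => by
    rw [norm_mul]; gcongr; exact hf r

/-- The two halves of the odd theta function need different orders of summation in the splitting, so
they are treated apart. -/
lemma gaussSum_eq_gaussTheta {m : ℕ} (hm : 0 < m) {τ : ℂ} (hτ : 0 < τ.im) (v u : ℂ) :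
    gaussSum m τ v u = gaussTheta m τ v u - gaussTheta m τ v (-u) := by
  obtain ⟨C, hC⟩ := norm_bigTheta_sub_le hm τ u
  obtain ⟨C', hC'⟩ := norm_bigTheta_sub_le hm τ (-u)
  rw [gaussSum_eq_tsum hm hτ, gaussTheta, gaussTheta,
    ← (summable_gaussTerm_mul hm hτ v hC).tsum_sub (summable_gaussTerm_mul hm hτ v hC')]
  refine tsum_congr fun r => ?_
  rw [oddTheta, bigTheta_neg _ hm]; ring

lemma norm_tsum_jacobiTheta₂_term_le {m M : ℕ} (hm : 0 < m) (hM : 0 < M) {τ : ℂ} (hτ : 0 < τ.im)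
    (u : ℂ) (a : ℤ) : ∀ r : ℤ,
      ‖∑' l : ℤ, jacobiTheta₂_term (r + 2 * m * (a + M * l)) u (τ / (2 * m))‖ ≤
      ∑' n : ℤ, ‖jacobiTheta₂_term n u (τ / (2 * m))‖ := by
  intro r
  have hs := (summable_jacobiTheta₂_term u (tau_div_im_pos hτ hm)).norm
  have hinj : Function.Injective fun l : ℤ => r + 2 * m * (a + M * l) := fun x y h => by
    simpa [hm.ne', hM.ne'] using h
  have hs' : Summable fun l : ℤ => ‖jacobiTheta₂_term (r + 2 * m * (a + M * l)) u (τ / (2 * m))‖ :=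
    hs.comp_injective hinj
  refine (norm_tsum_le_tsum_norm hs').trans ?_
  exact hs'.tsum_le_tsum_of_inj _ hinj (fun _ _ => norm_nonneg _) (fun _ => le_rfl) hs

lemma sum_range_const_sub {M N : ℕ} (hM : 0 < M) (hMN : Nat.Coprime M N) {φ : ℤ → ℂ}
    (hφ : ∀ x, φ (x + M) = φ x) (c : ℤ) :
    ∑ a ∈ Finset.range M, φ (N * (c - a)) = ∑ b ∈ Finset.range M, φ b := by
  have hφ' : ∀ x, φ (-(x + M)) = φ (-x) := fun x => by rw [← hφ (-(x + M))]; congr 1; ring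
  have h1 := sum_range_mul_sub hM hMN (φ := fun x => φ (-x)) hφ' c
  have h2 := sum_range_neg_int hM hφ
  rw [← h2, ← h1]
  exact Finset.sum_congr rfl fun a _ => congrArg φ (by ring)

lemma tsum_int_eq_sum_range_mul' {M N : ℕ} (hM : 0 < M) (hMN : Nat.Coprime M N) {f : ℤ → ℂ}
    (hf : Summable f) (c : ℤ) :
    ∑' n, f n = ∑ a ∈ Finset.range M, ∑' l : ℤ, f (N * (c - a) + M * l) := by
  rw [tsum_int_eq_sum_range hM hf]
  refine (sum_range_const_sub (φ := fun x => ∑' l : ℤ, f (x + M * l)) hM hMN (fun x => ?_) c).symm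
  rw [← (Equiv.addRight (1 : ℤ)).tsum_eq fun l => f (x + M * l)]
  refine tsum_congr fun l => congrArg f ?_
  simp; ring

/-- The summand in the splitting of `gaussTheta`, with both signs treated at once. -/
lemma gaussTheta_split_term {m M : ℕ} (hm : 0 < m) (hM : 0 < M) {τ : ℂ} (hτ : 0 < τ.im) (v u : ℂ)
    (d s x : ℤ) (hxy : s = d + 2 * x) :
    cexp (2 * Real.pi * I * m * ((s ^ 2 - d ^ 2) * τ / 4 + s * u / 2 - d * v)) *
      gaussTheta m (M ^ 2 * τ) (M * (v + d * τ / 2)) (M * (u + s * τ)) =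
    ∑' r : ℤ, gaussTerm m τ v (m * d + M * r) *
      ∑' l : ℤ, jacobiTheta₂_term (m * d + M * r + 2 * m * (x + M * l)) (u / 2) (τ / (2 * m)) := by
  subst hxy
  rw [gaussTheta, ← tsum_mul_left]
  refine tsum_congr fun r => ?_
  rw [gaussTerm_split hm hM hτ, bigTheta_eq_tsum _ hm]
  simp only [jacobiTheta₂_term_split hm]
  rw [tsum_mul_left]
  rw [show ∀ a b c d e : ℂ, a * (b * c * (d * e)) = (a * b * d) * (c * e) by intros; ring,
    ← Complex.exp_add, ← Complex.exp_add]
  refine (congrArg₂ (· * ·) (?_ : _ = (1 : ℂ)) ?_).trans (one_mul _)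
  · rw [Complex.exp_eq_one_iff]
    refine ⟨0, ?_⟩
    push_cast
    ring
  · congr 1
    refine tsum_congr fun l => ?_
    congr 1
    ring

/-- For fixed a the classes m(b - a) exhaust the residues mod M, so the sum over b reassembles the
series over r. The sum over a then reassembles the theta series, whose index was restricted to a mod
M. -/
lemma gaussTheta_split {m M : ℕ} (hm : 0 < m) (hM : 0 < M) (hMm : Nat.Coprime M m) {τ : ℂ}
    (hτ : 0 < τ.im) (v u : ℂ) :
    gaussTheta m τ v u = ∑ a ∈ Finset.range M, ∑ b ∈ Finset.range M,
      cexp (2 * Real.pi * I * m * (a * b * τ + a * (u / 2 + v) + b * (u / 2 - v))) *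
      gaussTheta m (M ^ 2 * τ) (M * (v + (b - a : ℤ) * τ / 2)) (M * (u + (a + b : ℤ) * τ)) := by
  have hterm : ∀ a b : ℕ,
      cexp (2 * Real.pi * I * m * (a * b * τ + a * (u / 2 + v) + b * (u / 2 - v))) *
      gaussTheta m (M ^ 2 * τ) (M * (v + (b - a : ℤ) * τ / 2)) (M * (u + (a + b : ℤ) * τ)) =
      ∑' r : ℤ, gaussTerm m τ v (m * (b - a) + M * r) *
      ∑' l : ℤ, jacobiTheta₂_term (m * (b - a) + M * r + 2 * m * (a + M * l))
        (u / 2) (τ / (2 * m)) := by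
    intro a b
    rw [← gaussTheta_split_term hm hM hτ v u (b - a) (a + b) a (by ring)]
    congr 2
    push_cast; ring
  have hC := norm_tsum_jacobiTheta₂_term_le hm hM hτ (u / 2)
  have hfold : ∀ a : ℕ, ∑ b ∈ Finset.range M, ∑' r : ℤ, gaussTerm m τ v (m * (b - a) + M * r) *
      ∑' l : ℤ, jacobiTheta₂_term (m * (b - a) + M * r + 2 * m * (a + M * l))
        (u / 2) (τ / (2 * m)) =
      ∑' r : ℤ, gaussTerm m τ v r *
        ∑' l : ℤ, jacobiTheta₂_term (r + 2 * m * (a + M * l)) (u / 2) (τ / (2 * m)) := fun a =>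
    (tsum_int_eq_sum_range_mul hM hMm (summable_gaussTerm_mul hm hτ v (hC a)) a).symm
  simp only [hterm, hfold]
  rw [← Summable.tsum_finsetSum fun (a : ℕ) _ => summable_gaussTerm_mul hm hτ v (hC a), gaussTheta]
  refine tsum_congr fun r => ?_
  have hs : Summable fun l : ℤ => jacobiTheta₂_term (r + 2 * m * l) (u / 2) (τ / (2 * m)) :=
    (summable_jacobiTheta₂_term _ (tau_div_im_pos hτ hm)).comp_injective (residue_injective hm r)
  rw [← Finset.mul_sum, bigTheta_eq_tsum _ hm, tsum_int_eq_sum_range hM hs]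

/-- Under u ↦ -u the indices exchange roles: the sum over a reassembles the series over r, and the
sum over b, entering as -b, reassembles the theta series. -/
lemma gaussTheta_split_neg {m M : ℕ} (hm : 0 < m) (hM : 0 < M) (hMm : Nat.Coprime M m) {τ : ℂ}
    (hτ : 0 < τ.im) (v u : ℂ) :
    gaussTheta m τ v (-u) = ∑ a ∈ Finset.range M, ∑ b ∈ Finset.range M,
      cexp (2 * Real.pi * I * m * (a * b * τ + a * (u / 2 + v) + b * (u / 2 - v))) *
      gaussTheta m (M ^ 2 * τ) (M * (v + (b - a : ℤ) * τ / 2)) (-(M * (u + (a + b : ℤ) * τ))) := by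
  have hterm : ∀ a b : ℕ,
      cexp (2 * Real.pi * I * m * (a * b * τ + a * (u / 2 + v) + b * (u / 2 - v))) *
      gaussTheta m (M ^ 2 * τ) (M * (v + (b - a : ℤ) * τ / 2)) (-(M * (u + (a + b : ℤ) * τ))) =
      ∑' r : ℤ, gaussTerm m τ v (m * (b - a) + M * r) *
      ∑' l : ℤ, jacobiTheta₂_term (m * (b - a) + M * r + 2 * m * (-b + M * l))
        (-u / 2) (τ / (2 * m)) := by
    intro a b
    rw [← gaussTheta_split_term hm hM hτ v (-u) (b - a) (-(a + b)) (-b) (by ring)]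
    congr 2
    · push_cast; ring
    · push_cast; ring
  have hC := norm_tsum_jacobiTheta₂_term_le hm hM hτ (-u / 2)
  have hfold : ∀ b : ℕ, ∑ a ∈ Finset.range M, ∑' r : ℤ, gaussTerm m τ v (m * (b - a) + M * r) *
      ∑' l : ℤ, jacobiTheta₂_term (m * (b - a) + M * r + 2 * m * (-b + M * l))
        (-u / 2) (τ / (2 * m)) =
      ∑' r : ℤ, gaussTerm m τ v r *
        ∑' l : ℤ, jacobiTheta₂_term (r + 2 * m * (-b + M * l)) (-u / 2) (τ / (2 * m)) := fun b =>
    (tsum_int_eq_sum_range_mul' hM hMm (summable_gaussTerm_mul hm hτ v (hC (-b))) b).symm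
  rw [Finset.sum_comm]
  simp only [hterm, hfold]
  rw [← Summable.tsum_finsetSum fun (b : ℕ) _ => summable_gaussTerm_mul hm hτ v (hC (-b)),
    gaussTheta]
  refine tsum_congr fun r => ?_
  rw [← Finset.mul_sum, bigTheta_eq_tsum _ hm]
  have hs : Summable fun l : ℤ => jacobiTheta₂_term (r + 2 * m * l) (-u / 2) (τ / (2 * m)) :=
    (summable_jacobiTheta₂_term _ (tau_div_im_pos hτ hm)).comp_injective (residue_injective hm r)
  rw [tsum_int_eq_sum_range_mul' (N := 1) hM (by simp) hs 0]
  simp only [Nat.cast_one, one_mul, zero_sub]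

/-- `gaussSum` for `τ` in terms of `gaussSum` for `M²τ`. -/
lemma gaussSum_split {m M : ℕ} (hm : 0 < m) (hM : 0 < M) (hMm : Nat.Coprime M m) {τ : ℂ}
    (hτ : 0 < τ.im) (v u : ℂ) :
    gaussSum m τ v u = ∑ a ∈ Finset.range M, ∑ b ∈ Finset.range M,
      cexp (2 * Real.pi * I * m * (a * b * τ + a * (u / 2 + v) + b * (u / 2 - v))) *
      gaussSum m (M ^ 2 * τ) (M * (v + (b - a : ℤ) * τ / 2)) (M * (u + (a + b : ℤ) * τ)) := by
  have hτ' : 0 < ((M : ℂ) ^ 2 * τ).im := by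
    have := mul_im_pos hτ (k := M ^ 2) (by positivity); push_cast at this; exact this
  simp only [gaussSum_eq_gaussTheta hm hτ, gaussSum_eq_gaussTheta hm hτ', mul_sub,
    Finset.sum_sub_distrib]
  rw [gaussTheta_split hm hM hMm hτ, gaussTheta_split_neg hm hM hMm hτ]
  simp only [mul_sub]

/-! ### Appell sums -/

/-- `z` is not in the lattice `ℤ + ℤτ`. -/
def OffLattice (τ z : ℂ) : Prop := ∀ a b : ℤ, z ≠ a + b * τ

/-- The numerator of the summand of the level `N` Appell sum. -/
noncomputable def appellNum (N : ℕ) (τ z₁ z₂ : ℂ) (j : ℤ) : ℂ :=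
  cexp (2 * Real.pi * I * (j * N * (z₁ + z₂) + (j : ℂ) ^ 2 * N * τ))

/-- The summand of the level `N` Appell sum. -/
noncomputable def appellTerm (N : ℕ) (τ z₁ z₂ : ℂ) (j : ℤ) : ℂ :=
  appellNum N τ z₁ z₂ j / (1 - cexp (2 * Real.pi * I * (z₁ + j * τ)))

/-- The level `N` Appell sum. -/
noncomputable def appell (N : ℕ) (τ z₁ z₂ : ℂ) : ℂ := ∑' j, appellTerm N τ z₁ z₂ j

lemma OffLattice.exp_ne_one {τ z : ℂ} (h : OffLattice τ z) (j : ℤ) :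
    cexp (2 * Real.pi * I * (z + j * τ)) ≠ 1 := by
  rw [Ne, Complex.exp_eq_one_iff]
  rintro ⟨n, hn⟩
  refine h n (-j) ?_
  have h0 := Complex.two_pi_I_ne_zero
  have : z + j * τ = n := mul_left_cancel₀ h0 (by rw [hn]; ring)
  push_cast
  linear_combination this

lemma norm_exp_two_pi_I (z : ℂ) : ‖cexp (2 * Real.pi * I * z)‖ = Real.exp (-(2 * Real.pi * z.im)) := by
  rw [Complex.norm_exp, show (2 * Real.pi * I * z : ℂ) = ((2 * Real.pi : ℝ) : ℂ) * (z * I) by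
    push_cast; ring, re_ofReal_mul, mul_I_re]
  ring_nf

lemma exists_lower_bound_finset {α : Type*} (F : Finset α) {f : α → ℂ → ℝ} {z : ℂ}
    (hc : ∀ j ∈ F, ContinuousAt (f j) z) (hp : ∀ j ∈ F, 0 < f j z) :
    ∃ δ > 0, ∀ᶠ w in 𝓝 z, ∀ j ∈ F, δ ≤ f j w := by
  classical
  induction F using Finset.induction_on with
  | empty => exact ⟨1, one_pos, by simp⟩
  | insert a F ha ih =>
    obtain ⟨δ, hδ, h⟩ := ih (fun j hj => hc j (by simp [hj])) fun j hj => hp j (by simp [hj])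
    have hpa := hp a (by simp)
    have h2 := (hc a (by simp)).eventually (lt_mem_nhds (half_lt_self hpa))
    refine ⟨min δ (f a z / 2), by positivity, ?_⟩
    filter_upwards [h, h2] with w hw hw2 j hj
    rcases Finset.mem_insert.1 hj with rfl | hj
    · exact (min_le_right _ _).trans hw2.le
    · exact (min_le_left _ _).trans (hw j hj)

/-- For |j| > J the imaginary part of w + jτ has absolute value at least 1, so the exponential has
modulus at least e^{2π} or at most 1/2. The finitely many remaining j are handled by continuity. -/
lemma exists_lower_bound {τ : ℂ} (hτ : 0 < τ.im) {s : Set ℤ} {z : ℂ}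
    (hs : ∀ j ∈ s, cexp (2 * Real.pi * I * (z + j * τ)) ≠ 1) :
    ∃ δ > 0, ∃ r > 0, ∀ w ∈ ball z r, ∀ j ∈ s,
      δ ≤ ‖1 - cexp (2 * Real.pi * I * (w + j * τ))‖ := by
  classical
  set C := |z.im| + 1 with hC
  set J := ⌈(C + 1) / τ.im⌉ with hJ
  obtain ⟨δ, hδ, hev⟩ := exists_lower_bound_finset ((Finset.Icc (-J) J).filter (· ∈ s))
    (f := fun j w => ‖1 - cexp (2 * Real.pi * I * (w + j * τ))‖) (z := z)
    (fun j _ => by fun_prop) (fun j hj => norm_pos_iff.2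
      (sub_ne_zero.2 (hs j (Finset.mem_filter.1 hj).2).symm))
  obtain ⟨r, hr, hball⟩ := Metric.eventually_nhds_iff_ball.1 hev
  refine ⟨min δ (1 / 2), by positivity, min r 1, by positivity, fun w hw j hj => ?_⟩
  have hw1 : w ∈ ball z r := ball_subset_ball (min_le_left _ _) hw
  have hwim : |w.im| ≤ C := by
    have h1 : |(w - z).im| ≤ 1 :=
      (abs_im_le_norm _).trans (by
        rw [← dist_eq_norm]; exact (mem_ball.1 hw).le.trans (min_le_right _ _))
    rw [sub_im] at h1
    have := abs_sub_abs_le_abs_sub w.im z.im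
    linarith
  obtain ⟨hwl, hwu⟩ := abs_le.1 hwim
  have him : (w + j * τ).im = w.im + j * τ.im := by simp
  have hJle : C + 1 ≤ J * τ.im := by
    have := Int.le_ceil ((C + 1) / τ.im)
    rwa [div_le_iff₀ hτ] at this
  have h2pi : (2 : ℝ) ≤ Real.exp (2 * Real.pi) := by
    have := Real.add_one_le_exp (2 * Real.pi)
    have := Real.pi_gt_three
    linarith
  by_cases hjJ : j ∈ Finset.Icc (-J) J
  · exact (min_le_left _ _).trans (hball w hw1 j (Finset.mem_filter.2 ⟨hjJ, hj⟩))
  · refine (min_le_right _ _).trans ?_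
    have hn := norm_exp_two_pi_I (w + j * τ)
    rw [him] at hn
    rw [Finset.mem_Icc, not_and_or, not_le, not_le] at hjJ
    rcases hjJ with h | h
    · have hj' : (j : ℝ) ≤ -J := by exact_mod_cast h.le
      have h3 : Real.exp (2 * Real.pi) ≤ ‖cexp (2 * Real.pi * I * (w + j * τ))‖ := by
        rw [hn]
        refine Real.exp_le_exp.2 ?_
        have : w.im + j * τ.im ≤ -1 := by nlinarith
        nlinarith [Real.pi_pos]
      have := norm_sub_norm_le (cexp (2 * Real.pi * I * (w + j * τ))) 1
      rw [norm_one, norm_sub_rev] at this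
      linarith
    · have hj' : (J : ℝ) ≤ j := by exact_mod_cast h.le
      have h3 : ‖cexp (2 * Real.pi * I * (w + j * τ))‖ ≤ 1 / 2 := by
        rw [hn]
        calc _ ≤ Real.exp (-(2 * Real.pi)) := by
              refine Real.exp_le_exp.2 ?_
              have : 1 ≤ w.im + j * τ.im := by nlinarith
              nlinarith [Real.pi_pos]
          _ ≤ 1 / 2 := by
              rw [Real.exp_neg, one_div]
              exact inv_anti₀ two_pos h2pi
      have := norm_sub_norm_le 1 (cexp (2 * Real.pi * I * (w + j * τ)))
      rw [norm_one] at this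
      linarith

lemma appellNum_eq (N : ℕ) (τ z₁ z₂ : ℂ) (j : ℤ) :
    appellNum N τ z₁ z₂ j = jacobiTheta₂_term j (N * (z₁ + z₂)) (2 * N * τ) := by
  rw [appellNum, jacobiTheta₂_term]; congr 1; ring

/-- Restricting to a set of indices allows polar terms to be left out; dropping j = 0 isolates the
residue at z₁ = 0. -/
lemma exists_appell_bound {N : ℕ} (hN : 0 < N) {τ : ℂ} (hτ : 0 < τ.im) {s : Set ℤ} {z₁ : ℂ}
    (hs : ∀ j ∈ s, cexp (2 * Real.pi * I * (z₁ + j * τ)) ≠ 1) (z₂ : ℂ) :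
    ∃ r > 0, ∃ u : ℤ → ℝ, Summable u ∧
      (∀ j, DifferentiableOn ℂ (fun p : ℂ × ℂ => s.indicator (appellTerm N τ p.1 p.2) j)
        (ball (z₁, z₂) r)) ∧
      ∀ j, ∀ p ∈ ball (z₁, z₂) r, ‖s.indicator (appellTerm N τ p.1 p.2) j‖ ≤ u j := by
  obtain ⟨δ, hδ, r, hr, h⟩ := exists_lower_bound hτ hs
  set S : ℝ := N * (‖z₁‖ + ‖z₂‖ + 2 * r) with hS
  have hmem : ∀ p ∈ ball (z₁, z₂) r, p.1 ∈ ball z₁ r ∧ p.2 ∈ ball z₂ r := by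
    intro p hp
    rw [← ball_prod_same] at hp
    exact hp
  refine ⟨r, hr, fun j => δ⁻¹ * ((|j| ^ 0 : ℝ) * Real.exp (-Real.pi *
    ((2 * N * τ).im * j ^ 2 - 2 * S * |j|))), ?_, fun j => ?_, fun j p hp => ?_⟩
  · exact (summable_pow_mul_jacobiTheta₂_term_bound S (two_mul_im_pos hτ hN) 0).mul_left _
  · by_cases hj : j ∈ s
    · simp only [Set.indicator_of_mem hj, appellTerm, appellNum]
      simp only [div_eq_mul_inv]
      refine DifferentiableOn.mul (by fun_prop) (DifferentiableOn.inv (by fun_prop) fun p hp => ?_)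
      have := h p.1 (hmem p hp).1 j hj
      exact norm_pos_iff.1 (hδ.trans_le this)
    · simp only [Set.indicator_of_notMem hj]
      exact differentiableOn_const 0
  · by_cases hj : j ∈ s
    · rw [Set.indicator_of_mem hj, appellTerm, norm_div, div_eq_inv_mul]
      simp only [pow_zero, one_mul]
      obtain ⟨h1, h2⟩ := hmem p hp
      have hd := h p.1 h1 j hj
      rw [appellNum_eq]
      refine mul_le_mul (inv_anti₀ hδ hd) ?_ (norm_nonneg _) (by positivity)
      refine norm_jacobiTheta₂_term_le (two_mul_im_pos hτ hN) ?_ le_rfl j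
      refine (abs_im_le_norm _).trans ?_
      rw [norm_mul, Complex.norm_natCast, hS]
      rw [mem_ball, dist_eq_norm] at h1 h2
      have a1 := norm_le_norm_add_norm_sub' p.1 z₁
      have a2 := norm_le_norm_add_norm_sub' p.2 z₂
      have a3 := norm_add_le p.1 p.2
      gcongr
      linarith
    · rw [Set.indicator_of_notMem hj, norm_zero]
      positivity

lemma differentiableAt_appell_indicator {N : ℕ} (hN : 0 < N) {τ : ℂ} (hτ : 0 < τ.im) {s : Set ℤ}
    {z₁ : ℂ} (hs : ∀ j ∈ s, cexp (2 * Real.pi * I * (z₁ + j * τ)) ≠ 1) (z₂ : ℂ) :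
    DifferentiableAt ℂ (fun p : ℂ × ℂ => ∑' j, s.indicator (appellTerm N τ p.1 p.2) j) (z₁, z₂) := by
  obtain ⟨r, hr, u, hu, hd, hb⟩ := exists_appell_bound hN hτ hs z₂
  exact differentiableAt_tsum_of_norm_le hu hr hd hb

lemma summable_appellTerm {N : ℕ} (hN : 0 < N) {τ : ℂ} (hτ : 0 < τ.im) (z₁ z₂ : ℂ) :
    Summable (appellTerm N τ z₁ z₂) := by
  obtain ⟨r, hr, u, hu, -, hb⟩ := exists_appell_bound hN hτ
    (s := {j | cexp (2 * Real.pi * I * (z₁ + j * τ)) ≠ 1}) (fun j hj => hj) z₂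
  refine .of_norm_bounded hu fun j => ?_
  refine le_trans (le_of_eq ?_) (hb j _ (mem_ball_self hr))
  -- Polar terms are 0, since division by zero gives 0; the series is therefore summable at the
  -- poles too.
  by_cases hj : cexp (2 * Real.pi * I * (z₁ + j * τ)) = 1
  · rw [Set.indicator_of_notMem (by simpa using hj), appellTerm, hj]; simp
  · rw [Set.indicator_of_mem (by simpa using hj)]

lemma differentiableAt_appell {N : ℕ} (hN : 0 < N) {τ : ℂ} (hτ : 0 < τ.im) {z₁ : ℂ}
    (h : OffLattice τ z₁) (z₂ : ℂ) :
    DifferentiableAt ℂ (fun p : ℂ × ℂ => appell N τ p.1 p.2) (z₁, z₂) := by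
  simpa [appell] using differentiableAt_appell_indicator hN hτ (s := Set.univ) (z₁ := z₁)
    (fun j _ => h.exp_ne_one j) z₂

lemma tendsto_mul_inv_one_sub_exp :
    Tendsto (fun z : ℂ => z * (1 / (1 - cexp (2 * Real.pi * I * z)))) (𝓝[≠] 0)
      (𝓝 (-(1 / (2 * Real.pi * I)))) := by
  have hd : HasDerivAt (fun z : ℂ => cexp (2 * Real.pi * I * z)) (2 * Real.pi * I) 0 := by
    simpa using ((hasDerivAt_id (0 : ℂ)).const_mul (2 * Real.pi * I)).cexp
  have h := (hasDerivAt_iff_tendsto_slope.1 hd).inv₀ Complex.two_pi_I_ne_zero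
  have := h.neg
  rw [one_div]
  refine this.congr fun z => ?_
  simp only [slope, vsub_eq_sub, sub_zero, mul_zero, Complex.exp_zero, smul_eq_mul, mul_inv, inv_inv]
  rw [← mul_neg, ← inv_neg, neg_sub, one_div]

lemma zero_exp_ne_one {τ : ℂ} (hτ : 0 < τ.im) (j : ℤ) (hj : j ∈ ({0}ᶜ : Set ℤ)) :
    cexp (2 * Real.pi * I * (0 + j * τ)) ≠ 1 := by
  intro h
  have hn := norm_exp_two_pi_I (0 + j * τ)
  rw [h, norm_one, eq_comm, Real.exp_eq_one_iff] at hn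
  have hj0 : j ≠ 0 := hj
  simp [hτ.ne', hj0] at hn

/-- The residue of the Appell sum at `z₁ = 0`. -/
lemma tendsto_mul_appell {N : ℕ} (hN : 0 < N) {τ : ℂ} (hτ : 0 < τ.im) (z₂ : ℂ) :
    Tendsto (fun z => z * appell N τ z z₂) (𝓝[≠] 0) (𝓝 (-(1 / (2 * Real.pi * I)))) := by
  have hsplit : ∀ z, appell N τ z z₂ = 1 / (1 - cexp (2 * Real.pi * I * z)) +
      ∑' j, ({0}ᶜ : Set ℤ).indicator (appellTerm N τ z z₂) j := by
    intro z
    rw [appell, (summable_appellTerm hN hτ z z₂).tsum_eq_add_tsum_ite 0]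
    congr 1
    · simp [appellTerm, appellNum]
    · refine tsum_congr fun j => ?_
      by_cases hj : j = 0 <;> simp [hj]
  have hc : ContinuousAt (fun z : ℂ =>
      ∑' j, ({0}ᶜ : Set ℤ).indicator (appellTerm N τ z z₂) j) 0 :=
    ContinuousAt.comp (f := fun z : ℂ => (z, z₂))
      (g := fun p : ℂ × ℂ => ∑' j, ({0}ᶜ : Set ℤ).indicator (appellTerm N τ p.1 p.2) j)
      (differentiableAt_appell_indicator hN hτ (zero_exp_ne_one hτ) z₂).continuousAt (by fun_prop)
  have h2 : Tendsto (fun z : ℂ => z * ∑' j, ({0}ᶜ : Set ℤ).indicator (appellTerm N τ z z₂) j)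
      (𝓝[≠] 0) (𝓝 0) := by
    have := (continuousAt_id.mul hc).tendsto
    simp only [id, zero_mul, Pi.mul_apply] at this
    exact tendsto_nhdsWithin_of_tendsto_nhds this
  have := tendsto_mul_inv_one_sub_exp.add h2
  rw [add_zero] at this
  refine this.congr fun z => ?_
  rw [hsplit]; ring

lemma appell_add_one_left (N : ℕ) (τ z₁ z₂ : ℂ) : appell N τ (z₁ + 1) z₂ = appell N τ z₁ z₂ := by
  refine tsum_congr fun j => ?_
  rw [appellTerm, appellTerm, appellNum, appellNum]
  congr 1
  · rw [Complex.exp_eq_exp_iff_exists_int]; exact ⟨j * N, by push_cast; ring⟩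
  · congr 1
    rw [Complex.exp_eq_exp_iff_exists_int]; exact ⟨1, by push_cast; ring⟩

lemma appell_add_one_right (N : ℕ) (τ z₁ z₂ : ℂ) : appell N τ z₁ (z₂ + 1) = appell N τ z₁ z₂ := by
  refine tsum_congr fun j => ?_
  rw [appellTerm, appellTerm, appellNum, appellNum]
  congr 1
  rw [Complex.exp_eq_exp_iff_exists_int]; exact ⟨j * N, by push_cast; ring⟩

lemma appell_tau_add_one (N : ℕ) (τ z₁ z₂ : ℂ) : appell N (τ + 1) z₁ z₂ = appell N τ z₁ z₂ := by
  refine tsum_congr fun j => ?_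
  rw [appellTerm, appellTerm, appellNum, appellNum]
  congr 1
  · rw [Complex.exp_eq_exp_iff_exists_int]; exact ⟨j ^ 2 * N, by push_cast; ring⟩
  · congr 1
    rw [Complex.exp_eq_exp_iff_exists_int]; exact ⟨j, by ring⟩

/-- Multiplication by x^{-N} does not change the polar part at x = 1. Summed over j, the finite
geometric remainder becomes theta functions. -/
lemma inv_pow_div_one_sub {x : ℂ} (hx0 : x ≠ 0) (hx : x ≠ 1) (N : ℕ) :
    x⁻¹ ^ N / (1 - x) = 1 / (1 - x) + ∑ l ∈ Finset.range N, x⁻¹ ^ (l + 1) := by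
  have h1 : (1 - x) ≠ 0 := sub_ne_zero.2 hx.symm
  have h := geom_sum_mul x⁻¹ N
  simp only [pow_succ, ← Finset.sum_mul]
  have e : (∑ l ∈ Finset.range N, x⁻¹ ^ l) * x⁻¹ * (1 - x) = x⁻¹ ^ N - 1 := by
    rw [← h, mul_assoc, mul_sub, inv_mul_cancel₀ hx0, mul_one]
  rw [div_eq_iff h1, add_mul, e, one_div, inv_mul_cancel₀ h1]
  ring

/-- The Appell sum with its summand multiplied by `(e^{2πiz₁}q^j)^{-N}`. -/
lemma tsum_appell_twist {N : ℕ} (hN : 0 < N) {τ : ℂ} (hτ : 0 < τ.im) {z₁ : ℂ}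
    (h : OffLattice τ z₁) (z₂ : ℂ) :
    ∑' j : ℤ, appellTerm N τ z₁ z₂ j * (cexp (2 * Real.pi * I * (z₁ + j * τ)))⁻¹ ^ N =
      appell N τ z₁ z₂ + ∑ l ∈ Finset.range N, zwegersExp N τ ((z₁ - z₂) / 2) (l + 1) *
        bigTheta (-(l + 1)) N τ (z₁ + z₂) := by
  have hNc : (N : ℂ) ≠ 0 := by exact_mod_cast hN.ne'
  have hterm : ∀ (l : ℕ) (j : ℤ), appellNum N τ z₁ z₂ j *
      (cexp (2 * Real.pi * I * (z₁ + j * τ)))⁻¹ ^ (l + 1) =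
      zwegersExp N τ ((z₁ - z₂) / 2) (l + 1) *
        jacobiTheta₂_term (-(l + 1) + 2 * N * j) ((z₁ + z₂) / 2) (τ / (2 * N)) := by
    intro l j
    rw [appellNum, zwegersExp, jacobiTheta₂_term, ← Complex.exp_neg, ← Complex.exp_nat_mul,
      ← Complex.exp_add, ← Complex.exp_add]
    congr 1
    push_cast
    field_simp
    ring
  have hs : ∀ l : ℕ, HasSum (fun j : ℤ => appellNum N τ z₁ z₂ j *
      (cexp (2 * Real.pi * I * (z₁ + j * τ)))⁻¹ ^ (l + 1))
      (zwegersExp N τ ((z₁ - z₂) / 2) (l + 1) * bigTheta (-(l + 1)) N τ (z₁ + z₂)) := by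
    intro l
    simp only [hterm]
    rw [bigTheta_eq_tsum _ hN]
    exact (((summable_jacobiTheta₂_term _ (tau_div_im_pos hτ hN)).comp_injective
      (residue_injective hN (-(l + 1)))).hasSum).mul_left _
  have hsum := (summable_appellTerm hN hτ z₁ z₂).hasSum.add
    (hasSum_sum (s := Finset.range N) fun l _ => hs l)
  rw [appell, ← hsum.tsum_eq]
  refine tsum_congr fun j => ?_
  have hg := inv_pow_div_one_sub (Complex.exp_ne_zero _) (h.exp_ne_one j) N
  rw [← Finset.mul_sum, appellTerm, div_mul_eq_mul_div, mul_div_assoc, hg]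
  ring

lemma appell_add_tau {N : ℕ} (hN : 0 < N) {τ : ℂ} (hτ : 0 < τ.im) {z₁ : ℂ}
    (h : OffLattice τ z₁) (z₂ : ℂ) :
    appell N τ (z₁ + τ) z₂ = cexp (-(2 * Real.pi * I * N * z₂)) *
      (appell N τ z₁ z₂ + ∑ l ∈ Finset.range N, zwegersExp N τ ((z₁ - z₂) / 2) (l + 1) *
        bigTheta (-(l + 1)) N τ (z₁ + z₂)) := by
  -- The shift of z₁ by τ is absorbed by j ↦ j - 1, at the cost of the factor (e^{2πiz₁}q^j)^{-N}
  -- and a common exponential.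
  rw [← tsum_appell_twist hN hτ h, appell, ← (Equiv.subRight (1 : ℤ)).tsum_eq, ← tsum_mul_left]
  refine tsum_congr fun j => ?_
  rw [Equiv.subRight_apply, appellTerm, appellTerm, appellNum, appellNum, ← Complex.exp_neg,
    ← Complex.exp_nat_mul, div_mul_eq_mul_div, ← mul_div_assoc, ← Complex.exp_add, ← Complex.exp_add]
  congr 3
  · push_cast; ring
  · push_cast; congr 1; ring

/-- This is the law for the second Appell sum of `phiMod`, where z₁ occurs as -z₁ in the second
place. -/
lemma appell_sub_tau {N : ℕ} (hN : 0 < N) {τ : ℂ} (hτ : 0 < τ.im) {z₁ : ℂ}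
    (h : OffLattice τ z₁) (z₂ : ℂ) :
    appell N τ z₁ (z₂ - τ) = cexp (2 * Real.pi * I * N * z₁) *
      (appell N τ z₁ z₂ + ∑ l ∈ Finset.range N, zwegersExp N τ ((z₁ - z₂) / 2) (l + 1) *
        bigTheta (-(l + 1)) N τ (z₁ + z₂)) := by
  rw [← tsum_appell_twist hN hτ h, appell, ← tsum_mul_left]
  refine tsum_congr fun j => ?_
  rw [appellTerm, appellTerm, appellNum, appellNum, ← Complex.exp_neg,
    ← Complex.exp_nat_mul, div_mul_eq_mul_div, ← mul_div_assoc, ← Complex.exp_add, ← Complex.exp_add]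
  congr 2
  ring

/-! ### The modified numerator -/

/-- The function `Φ̃^{[N-1]}` at `t = 0`. -/
noncomputable def phiMod (N : ℕ) (τ z₁ z₂ : ℂ) : ℂ :=
  appell N τ z₁ z₂ - appell N τ (-z₂) (-z₁) - 1 / 2 * addSum N τ ((z₁ - z₂) / 2) (z₁ + z₂)

lemma PhiTilde_eq (m : ℕ) {τ : ℂ} (hτ : 0 < τ.im) (z₁ z₂ t : ℂ) :
    PhiTilde m τ z₁ z₂ t = cexp (2 * Real.pi * I * (m + 1) * t) * phiMod (m + 1) τ z₁ z₂ := by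
  have hN : 0 < m + 1 := m.succ_pos
  have h1 : ∑' j : ℤ, (cexp (2 * Real.pi * I * (j * (m + 1) * (z₁ + z₂) + (j : ℂ) ^ 2 * (m + 1) * τ))
          / (1 - cexp (2 * Real.pi * I * (z₁ + j * τ)))
        - cexp (2 * Real.pi * I * (-(j * (m + 1) * (z₁ + z₂)) + (j : ℂ) ^ 2 * (m + 1) * τ))
          / (1 - cexp (2 * Real.pi * I * (-z₂ + j * τ)))) =
      appell (m + 1) τ z₁ z₂ - appell (m + 1) τ (-z₂) (-z₁) := by
    rw [appell, appell, ← (summable_appellTerm hN hτ _ _).tsum_sub (summable_appellTerm hN hτ _ _)]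
    refine tsum_congr fun j => ?_
    rw [appellTerm, appellTerm, appellNum, appellNum]
    push_cast
    congr 3
    ring_nf
  rw [PhiTilde, Phi, h1, PhiAdd, phiMod, addSum]
  simp only [oddTheta]
  rw [show 2 * m + 2 = 2 * (m + 1) by ring]
  ring

lemma OffLattice.neg {τ z : ℂ} (h : OffLattice τ z) : OffLattice τ (-z) := fun a b hab =>
  h (-a) (-b) (by push_cast; linear_combination -hab)

lemma OffLattice.add_int {τ z : ℂ} (h : OffLattice τ z) (n : ℤ) : OffLattice τ (z + n) :=
  fun a b hab => h (a - n) b (by push_cast; linear_combination hab)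

/-- Transfers integral translations from z₁ to z₂. -/
lemma phiMod_neg_swap {N : ℕ} (hN : 0 < N) (τ z₁ z₂ : ℂ) :
    phiMod N τ (-z₂) (-z₁) = -phiMod N τ z₁ z₂ := by
  rw [phiMod, phiMod, show (-z₂ - -z₁) / 2 = (z₁ - z₂) / 2 by ring, show -z₂ + -z₁ = -(z₁ + z₂) by ring,
    addSum_neg hN, neg_neg, neg_neg]
  ring

lemma phiMod_add_one {N : ℕ} (hN : 0 < N) (τ z₁ z₂ : ℂ) :
    phiMod N τ (z₁ + 1) z₂ = phiMod N τ z₁ z₂ := by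
  have h := appell_add_one_right N τ (-z₂) (-(z₁ + 1))
  rw [show -(z₁ + 1) + 1 = -z₁ by ring] at h
  rw [phiMod, phiMod, appell_add_one_left, ← h, show (z₁ + 1 - z₂) / 2 = (z₁ - z₂) / 2 + 1 / 2 by ring,
    show z₁ + 1 + z₂ = z₁ + z₂ + 1 by ring, addSum_add_one hN]

lemma phiMod_add_int {N : ℕ} (hN : 0 < N) (τ z₁ z₂ : ℂ) (n : ℤ) :
    phiMod N τ (z₁ + n) z₂ = phiMod N τ z₁ z₂ := by
  have hp : Function.Periodic (fun z => phiMod N τ z z₂) 1 := fun z => phiMod_add_one hN τ z z₂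
  simpa using hp.int_mul n z₁

lemma phiMod_add_int_right {N : ℕ} (hN : 0 < N) (τ z₁ z₂ : ℂ) (n : ℤ) :
    phiMod N τ z₁ (z₂ + n) = phiMod N τ z₁ z₂ := by
  have h := phiMod_add_int hN τ (-z₂) (-z₁) (-n)
  rw [phiMod_neg_swap hN, show -z₂ + ((-n : ℤ) : ℂ) = -(z₂ + n) by push_cast; ring,
    phiMod_neg_swap hN] at h
  exact neg_injective h

/-- The Appell sums contribute theta terms with 1 ≤ l ≤ N, the correction -1/2 times -2 such terms
with 0 ≤ r < N, and the two contributions cancel. -/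
lemma phiMod_add_tau {N : ℕ} (hN : 0 < N) {τ : ℂ} (hτ : 0 < τ.im) {z₁ z₂ : ℂ}
    (h₁ : OffLattice τ z₁) (h₂ : OffLattice τ z₂) :
    phiMod N τ (z₁ + τ) z₂ = cexp (-(2 * Real.pi * I * N * z₂)) * phiMod N τ z₁ z₂ := by
  set v := (z₁ - z₂) / 2 with hv
  set u := z₁ + z₂ with hu
  have e1 := appell_add_tau hN hτ h₁ z₂
  have e2 := appell_sub_tau hN hτ h₂.neg (-z₁)
  have e3 := addSum_add_tau hN hτ v u
  rw [show -z₁ - τ = -(z₁ + τ) by ring, show (-z₂ - -z₁) / 2 = v by rw [hv]; ring,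
    show -z₂ + -z₁ = -u by rw [hu]; ring, show 2 * Real.pi * I * N * -z₂ =
    -(2 * Real.pi * I * N * z₂) by ring] at e2
  simp only [bigTheta_neg _ hN, neg_neg] at e2
  rw [show 2 * Real.pi * I * N * (v - u / 2) = -(2 * Real.pi * I * N * z₂) by rw [hv, hu]; ring] at e3
  rw [phiMod, phiMod, e1, e2, show (z₁ + τ - z₂) / 2 = v + τ / 2 by rw [hv]; ring,
    show z₁ + τ + z₂ = u + τ by rw [hu]; ring, e3]
  -- The two ranges differ by the ends r = 0 and r = N, where the odd theta function vanishes
  -- because -N ≡ N mod 2N.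
  have hshift : ∑ r ∈ Finset.range N, zwegersExp N τ v r * oddTheta N τ u r =
      ∑ l ∈ Finset.range N, zwegersExp N τ v (l + 1) * oddTheta N τ u (l + 1) := by
    have a := Finset.sum_range_succ (fun r : ℕ => zwegersExp N τ v r * oddTheta N τ u r) N
    have b := Finset.sum_range_succ' (fun r : ℕ => zwegersExp N τ v r * oddTheta N τ u r) N
    have z0 : oddTheta N τ u 0 = 0 := by simp [oddTheta]
    have zN : oddTheta N τ u N = 0 := by
      have := bigTheta_add_two_mul (-N) hN τ u
      rw [oddTheta, ← this, show -(N : ℤ) + 2 * N = N by ring, sub_self]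
    push_cast at a b
    rw [z0, mul_zero, add_zero] at b
    rw [zN, mul_zero, add_zero, b] at a
    exact a.symm
  rw [hshift]
  simp only [oddTheta, mul_sub, Finset.sum_sub_distrib]
  ring

lemma phiMod_tau_add {N : ℕ} (hN : 0 < N) (τ z₁ z₂ : ℂ) (c : ℕ) :
    phiMod N (τ + 4 * N * c) z₁ z₂ = phiMod N τ z₁ z₂ := by
  have hp : ∀ w₁ w₂, appell N (τ + 4 * N * c) w₁ w₂ = appell N τ w₁ w₂ := by
    intro w₁ w₂
    have hp : Function.Periodic (fun τ => appell N τ w₁ w₂) 1 :=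
      fun τ => appell_tau_add_one N τ w₁ w₂
    have := hp.nat_mul (4 * N * c) τ
    push_cast at this
    rwa [mul_one] at this
  have := addSum_tau_add hN c τ ((z₁ - z₂) / 2) (z₁ + z₂)
  push_cast at this
  rw [phiMod, phiMod, hp, hp, this]

/-! ### Differentiability and the residue -/

lemma differentiableAt_appell_pair {N : ℕ} (hN : 0 < N) {τ : ℂ} (hτ : 0 < τ.im) {z₁ z₂ : ℂ}
    (h₁ : OffLattice τ z₁) (h₂ : OffLattice τ z₂) :
    DifferentiableAt ℂ (fun p : ℂ × ℂ => appell N τ p.1 p.2 - appell N τ (-p.2) (-p.1)) (z₁, z₂) := by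
  refine (differentiableAt_appell hN hτ h₁ z₂).sub ?_
  exact (differentiableAt_appell hN hτ h₂.neg (-z₁)).comp (z₁, z₂)
    (f := fun p : ℂ × ℂ => (-p.2, -p.1)) (by fun_prop)

lemma differentiableAt_phiMod {N : ℕ} (hN : 0 < N) {τ : ℂ} (hτ : 0 < τ.im) {z₁ z₂ : ℂ}
    (h₁ : OffLattice τ z₁) (h₂ : OffLattice τ z₂) :
    DifferentiableAt ℝ (fun p : ℂ × ℂ => phiMod N τ p.1 p.2) (z₁, z₂) := by
  refine ((differentiableAt_appell_pair hN hτ h₁ h₂).restrictScalars ℝ).sub ?_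
  refine (DifferentiableAt.const_mul ?_ _)
  exact (differentiable_addSum hN hτ _).comp (z₁, z₂)
    (f := fun p : ℂ × ℂ => ((p.1 - p.2) / 2, p.1 + p.2)) (by fun_prop)

/-- The factor `2 √(N/y)`. -/
noncomputable def gaussSlope (N : ℕ) (y : ℝ) : ℝ := 2 * N / y * Real.sqrt (y / N)

lemma gaussSlope_mul_sq (N : ℕ) (y : ℝ) {c : ℝ} (hc : 0 < c) :
    gaussSlope N (c ^ 2 * y) = c⁻¹ * gaussSlope N y := by
  rw [gaussSlope, gaussSlope, mul_div_assoc (c ^ 2), Real.sqrt_mul (by positivity),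
    Real.sqrt_sq hc.le]
  field_simp

lemma hasDbar_phiMod {N : ℕ} (hN : 0 < N) {τ : ℂ} (hτ : 0 < τ.im) {z₁ z₂ : ℂ}
    (h₁ : OffLattice τ z₁) (h₂ : OffLattice τ z₂) :
    HasDbar (fun z => phiMod N τ z z₂)
      (I * gaussSlope N τ.im / 2 * gaussSum N τ ((z₁ - z₂) / 2) (z₁ + z₂)) z₁ := by
  have h := (differentiableAt_appell_pair hN hτ h₁ h₂).comp z₁
    (f := fun z : ℂ => (z, z₂)) (by fun_prop)
  convert! (hasDbar_zero h).sub ((hasDbar_addSum hN hτ z₁ z₂).const_mul (1 / 2)) using 1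
  rw [gaussSlope]; ring

lemma eventually_offLattice {τ : ℂ} (hτ : 0 < τ.im) (p : ℂ) :
    ∀ᶠ z in 𝓝[≠] p, OffLattice τ z := by
  have := eventually_not_lattice hτ one_pos p
  simpa [OffLattice] using this

/-- `Φ̃` has residue `-1/(2πi)` at `z₁ = 0`. -/
lemma tendsto_mul_phiMod {N : ℕ} (hN : 0 < N) {τ : ℂ} (hτ : 0 < τ.im) {z₂ : ℂ}
    (h₂ : OffLattice τ z₂) :
    Tendsto (fun z => z * phiMod N τ z z₂) (𝓝[≠] 0) (𝓝 (-(1 / (2 * Real.pi * I)))) := by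
  have hc : ContinuousAt (fun z : ℂ => appell N τ (-z₂) (-z) +
      1 / 2 * addSum N τ ((z - z₂) / 2) (z + z₂)) 0 := by
    refine ContinuousAt.add ?_ (ContinuousAt.mul continuousAt_const ?_)
    · exact ContinuousAt.comp (f := fun z : ℂ => (-z₂, -z))
        (g := fun p : ℂ × ℂ => appell N τ p.1 p.2)
        (differentiableAt_appell hN hτ h₂.neg _).continuousAt (by fun_prop)
    · exact ContinuousAt.comp (f := fun z : ℂ => ((z - z₂) / 2, z + z₂))
        (g := fun p : ℂ × ℂ => addSum N τ p.1 p.2)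
        (differentiable_addSum hN hτ).continuous.continuousAt (by fun_prop)
  have h2 := (continuousAt_id.mul hc).tendsto
  simp only [id, zero_mul, Pi.mul_apply] at h2
  have := (tendsto_mul_appell hN hτ z₂).sub (tendsto_nhdsWithin_of_tendsto_nhds h2)
  rw [sub_zero] at this
  refine this.congr fun z => ?_
  simp only [Pi.mul_apply, id, phiMod]
  ring

lemma tendsto_mul_phiMod_int {N : ℕ} (hN : 0 < N) {τ : ℂ} (hτ : 0 < τ.im) {z₂ : ℂ}
    (h₂ : OffLattice τ z₂) (n : ℤ) :
    Tendsto (fun z => (z - n) * phiMod N τ z z₂) (𝓝[≠] (n : ℂ)) (𝓝 (-(1 / (2 * Real.pi * I)))) := by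
  have hmap : Tendsto (fun z : ℂ => z - n) (𝓝[≠] (n : ℂ)) (𝓝[≠] 0) := by
    refine tendsto_nhdsWithin_iff.2 ⟨?_, ?_⟩
    · refine tendsto_nhdsWithin_of_tendsto_nhds ?_
      have : Continuous fun z : ℂ => z - n := by fun_prop
      simpa using this.tendsto (n : ℂ)
    · filter_upwards [self_mem_nhdsWithin] with z hz
      exact sub_ne_zero.2 hz
  refine ((tendsto_mul_phiMod hN hτ h₂).comp hmap).congr fun z => ?_
  have := phiMod_add_int hN τ (z - n) z₂ n
  rw [sub_add_cancel] at this
  rw [Function.comp, this]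

lemma continuousAt_phiMod_left {N : ℕ} (hN : 0 < N) {τ : ℂ} (hτ : 0 < τ.im) {z₁ z₂ : ℂ}
    (h₁ : OffLattice τ z₁) (h₂ : OffLattice τ z₂) :
    ContinuousAt (fun z => phiMod N τ z z₂) z₁ :=
  ContinuousAt.comp (f := fun z : ℂ => (z, z₂)) (g := fun p : ℂ × ℂ => phiMod N τ p.1 p.2)
    (differentiableAt_phiMod hN hτ h₁ h₂).continuousAt (by fun_prop)

lemma continuousAt_phiMod_right {N : ℕ} (hN : 0 < N) {τ : ℂ} (hτ : 0 < τ.im) {z₁ z₂ : ℂ}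
    (h₁ : OffLattice τ z₁) (h₂ : OffLattice τ z₂) :
    ContinuousAt (fun z => phiMod N τ z₁ z) z₂ :=
  ContinuousAt.comp (f := fun z : ℂ => (z₁, z)) (g := fun p : ℂ × ℂ => phiMod N τ p.1 p.2)
    (differentiableAt_phiMod hN hτ h₁ h₂).continuousAt (by fun_prop)

/-! ### The `S`-transformation of `Φ̃` -/

lemma add_int_of_add_one {τ : ℂ} {f : ℂ → ℂ} (h : ∀ z, OffLattice τ z → f (z + 1) = f z) (n : ℤ)
    (z : ℂ) (hz : OffLattice τ z) : f (z + n) = f z := by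
  induction n using Int.induction_on with
  | zero => simp
  | succ i ih =>
    rw [← ih, ← h _ (hz.add_int i)]
    push_cast; ring_nf
  | pred i ih =>
    rw [← ih, ← h _ (hz.add_int _)]
    push_cast; ring_nf

lemma tendsto_sub_const_punctured (c : ℂ) : Tendsto (fun z : ℂ => z - c) (𝓝[≠] c) (𝓝[≠] 0) := by
  refine tendsto_nhdsWithin_iff.2 ⟨?_, ?_⟩
  · refine tendsto_nhdsWithin_of_tendsto_nhds ?_
    have : Continuous fun z : ℂ => z - c := by fun_prop
    simpa using this.tendsto c
  · filter_upwards [self_mem_nhdsWithin] with z hz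
    exact sub_ne_zero.2 hz

lemma eq_zero_of_quasiperiodic_offLattice {τ β : ℂ} (hτ : 0 < τ.im) (hβ0 : β ≠ 0)
    (hβ : ∀ n : ℤ, β ≠ cexp (2 * Real.pi * I * n * τ)) {f : ℂ → ℂ}
    (hd : ∀ z, OffLattice τ z → DifferentiableAt ℂ f z)
    (hp : Tendsto (fun z => z * f z) (𝓝[≠] 0) (𝓝 0))
    (h1 : ∀ z, OffLattice τ z → f (z + 1) = f z)
    (h2 : ∀ z, OffLattice τ z → f (z + τ) = β * f z)
    (z : ℂ) (hz : OffLattice τ z) : f z = 0 := by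
  have hoff : ∀ z, (∀ a b : ℤ, z ≠ a / (1 : ℕ) + b * τ) ↔ OffLattice τ z := fun z => by
    simp [OffLattice]
  refine eq_zero_of_quasiperiodic hτ one_pos hβ0 hβ (fun z hz => hd z ((hoff z).1 hz)) (fun a => ?_)
    (fun z hz => h1 z ((hoff z).1 hz)) (fun z hz => h2 z ((hoff z).1 hz)) z ((hoff z).2 hz)
  simp only [Nat.cast_one, div_one]
  refine (hp.comp (tendsto_sub_const_punctured a)).congr' ?_
  filter_upwards [eventually_offLattice hτ (a : ℂ)] with z hz
  have := add_int_of_add_one h1 (-a) z hz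
  rw [Function.comp, ← this]
  push_cast
  rw [← sub_eq_add_neg]

lemma OffLattice.S {τ z : ℂ} (hτ : τ ≠ 0) (h : OffLattice τ z) : OffLattice (-1 / τ) (z / τ) := by
  intro a b hab
  refine h (-b) a ?_
  field_simp at hab
  push_cast
  linear_combination hab

/-- The multiplier is a power of q only for z in (ℤ + ℤτ)/N; such z₂ are set aside and reached later
by continuity. -/
lemma multiplier_ne {N : ℕ} (hN : 0 < N) {τ z : ℂ} (h : ∀ a b : ℤ, z ≠ a / N + b * (τ / N)) (n : ℤ) :
    cexp (-(2 * Real.pi * I * N * z)) ≠ cexp (2 * Real.pi * I * n * τ) := by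
  rw [Ne, Complex.exp_eq_exp_iff_exists_int]
  rintro ⟨k, hk⟩
  have hN' : (N : ℂ) ≠ 0 := by exact_mod_cast hN.ne'
  have h0 := Complex.two_pi_I_ne_zero
  refine h (-k) (-n) ?_
  have : -(N * z) = n * τ + k := mul_left_cancel₀ h0 (by linear_combination hk)
  field_simp
  push_cast
  linear_combination -this

lemma gaussSlope_S (N : ℕ) {τ : ℂ} (hτ : τ ≠ 0) :
    gaussSlope N (-1 / τ).im = ‖τ‖ * gaussSlope N τ.im := by
  have h : (-1 / τ).im = (‖τ‖⁻¹) ^ 2 * τ.im := by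
    rw [div_im, normSq_eq_norm_sq]; simp; ring
  rw [h, gaussSlope_mul_sq N _ (by positivity), inv_inv]

/-- Both sides, as functions of z₁, have the same ∂̄-derivative, polar part at 0 and multipliers, so
their difference vanishes by rigidity. -/
lemma phiMod_S_of_not_lattice {N : ℕ} (hN : 0 < N) {τ : ℂ} (hτ : 0 < τ.im) {z₁ z₂ : ℂ}
    (h₁ : OffLattice τ z₁) (h₂ : OffLattice τ z₂) (hβ : ∀ a b : ℤ, z₂ ≠ a / N + b * (τ / N)) :
    cexp (-(2 * Real.pi * I * N * z₁ * z₂ / τ)) * phiMod N (-1 / τ) (z₁ / τ) (z₂ / τ) =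
      τ * phiMod N τ z₁ z₂ := by
  have h0 : τ ≠ 0 := by rintro rfl; simp at hτ
  have hτ' := neg_inv_im_pos hτ
  have h₂' := h₂.S h0
  rw [← sub_eq_zero]
  refine eq_zero_of_quasiperiodic_offLattice (f := fun z =>
    cexp (-(2 * Real.pi * I * N * z * z₂ / τ)) * phiMod N (-1 / τ) (z / τ) (z₂ / τ) -
      τ * phiMod N τ z z₂) hτ (exp_ne_zero _) (multiplier_ne hN hβ) (fun z hz => ?_) ?_
    (fun z hz => ?_) (fun z hz => ?_) z₁ h₁
  · have hA := ((hasDbar_phiMod hN hτ' (hz.S h0) h₂').comp (g := fun z => z / τ)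
      ((hasDerivAt_id z).div_const τ)).mul_left
      (g := fun z => cexp (-(2 * Real.pi * I * N * z * z₂ / τ))) (by fun_prop)
    have hB := (hasDbar_phiMod hN hτ hz h₂).const_mul τ
    have hAB := hA.sub hB
    refine HasDbar.differentiableAt ?_
    convert! hAB using 1
    rw [show (z / τ - z₂ / τ) / 2 = ((z - z₂) / 2) / τ by ring,
      show z / τ + z₂ / τ = (z + z₂) / τ by ring, gaussSum_S hN hτ, gaussSlope_S N h0,
      show 2 * Real.pi * I * N * ((z + z₂) ^ 2 / 4 - ((z - z₂) / 2) ^ 2) / τ =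
        2 * Real.pi * I * N * z * z₂ / τ by ring, Complex.exp_neg]
    have he := Complex.exp_ne_zero (2 * Real.pi * I * N * z * z₂ / τ)
    -- One factor |τ| comes from `gaussSlope_S` and one from `gaussSum_S`; with the conjugate of 1/τ
    -- from the chain rule they make the required τ.
    have hc : (starRingEnd ℂ) (1 / τ) * (‖τ‖ : ℂ) ^ 2 = τ := by
      rw [← Complex.conj_mul', map_div₀, map_one]
      have : (starRingEnd ℂ) τ ≠ 0 := by simpa using h0
      field_simp
    push_cast
    set G := gaussSum N τ ((z - z₂) / 2) (z + z₂)
    set s : ℂ := (gaussSlope N τ.im : ℂ)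
    set e := cexp (2 * Real.pi * I * N * z * z₂ / τ)
    have : e⁻¹ * ((starRingEnd ℂ) (1 / τ) * (I * (‖τ‖ * s) / 2 * (‖τ‖ * e * G))) =
      (e⁻¹ * e) * ((starRingEnd ℂ) (1 / τ) * (‖τ‖ : ℂ) ^ 2) * (I * s / 2 * G) := by ring
    rw [this, hc, inv_mul_cancel₀ he]
    ring
  -- In the variable z/τ the residue is the standard one; returning to z multiplies it by τ, as on
  -- the right-hand side.
  · have hmap : Tendsto (fun z : ℂ => z / τ) (𝓝[≠] 0) (𝓝[≠] 0) := by
      refine tendsto_nhdsWithin_iff.2 ⟨?_, ?_⟩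
      · refine tendsto_nhdsWithin_of_tendsto_nhds ?_
        have : Continuous fun z : ℂ => z / τ := by fun_prop
        simpa using this.tendsto 0
      · filter_upwards [self_mem_nhdsWithin] with z hz
        exact div_ne_zero hz h0
    have a1 := (tendsto_mul_phiMod hN hτ' h₂').comp hmap
    have a2 : Tendsto (fun z : ℂ => cexp (-(2 * Real.pi * I * N * z * z₂ / τ))) (𝓝[≠] 0) (𝓝 1) := by
      have : Continuous fun z : ℂ => cexp (-(2 * Real.pi * I * N * z * z₂ / τ)) := by fun_prop
      refine tendsto_nhdsWithin_of_tendsto_nhds ?_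
      simpa using this.tendsto 0
    have a3 := ((a2.mul a1).sub (tendsto_mul_phiMod hN hτ h₂)).const_mul τ
    rw [one_mul, sub_self, mul_zero] at a3
    refine a3.congr fun z => ?_
    simp only [Function.comp]
    field_simp
  -- Adding 1 to z subtracts the period -1/τ from z/τ, so the translation law is used backwards from
  -- z + 1.
  · have e1 := phiMod_add_tau hN hτ' ((hz.add_int 1).S h0) h₂'
    rw [show (z + (1 : ℤ)) / τ + -1 / τ = z / τ by push_cast; field_simp; ring] at e1
    push_cast at e1
    simp only [phiMod_add_one hN]
    rw [e1, ← mul_assoc, ← Complex.exp_add]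
    congr 3
    ring_nf
  · rw [phiMod_add_tau hN hτ hz h₂, show (z + τ) / τ = z / τ + 1 by field_simp,
      phiMod_add_one hN, show -(2 * Real.pi * I * N * (z + τ) * z₂ / τ) =
        -(2 * Real.pi * I * N * z₂) + -(2 * Real.pi * I * N * z * z₂ / τ) by field_simp; ring,
      Complex.exp_add]
    ring

lemma eq_of_continuousAt_of_eventuallyEq {F G : ℂ → ℂ} {p : ℂ} (hF : ContinuousAt F p)
    (hG : ContinuousAt G p) (h : F =ᶠ[𝓝[≠] p] G) : F p = G p :=
  tendsto_nhds_unique_of_eventuallyEq (tendsto_nhdsWithin_of_tendsto_nhds hF)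
    (tendsto_nhdsWithin_of_tendsto_nhds hG) h

lemma eventually_not_lattice_div {τ : ℂ} (hτ : 0 < τ.im) {N : ℕ} (hN : 0 < N) (p : ℂ) :
    ∀ᶠ z in 𝓝[≠] p, ∀ a b : ℤ, z ≠ a / N + b * (τ / N) := by
  refine eventually_not_lattice ?_ hN p
  rw [div_natCast_im]
  positivity

/-- The excluded z₂ are isolated and both sides are continuous in z₂. -/
lemma phiMod_S {N : ℕ} (hN : 0 < N) {τ : ℂ} (hτ : 0 < τ.im) {z₁ z₂ : ℂ}
    (h₁ : OffLattice τ z₁) (h₂ : OffLattice τ z₂) :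
    cexp (-(2 * Real.pi * I * N * z₁ * z₂ / τ)) * phiMod N (-1 / τ) (z₁ / τ) (z₂ / τ) =
      τ * phiMod N τ z₁ z₂ := by
  have h0 : τ ≠ 0 := by rintro rfl; simp at hτ
  refine eq_of_continuousAt_of_eventuallyEq
    (F := fun w => cexp (-(2 * Real.pi * I * N * z₁ * w / τ)) * phiMod N (-1 / τ) (z₁ / τ) (w / τ))
    (G := fun w => τ * phiMod N τ z₁ w) ?_ ?_ ?_
  · refine ContinuousAt.mul (by fun_prop) ?_
    exact ContinuousAt.comp (f := fun w : ℂ => w / τ) (g := fun w => phiMod N (-1 / τ) (z₁ / τ) w)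
      (continuousAt_phiMod_right hN (neg_inv_im_pos hτ) (h₁.S h0) (h₂.S h0)) (by fun_prop)
  · exact continuousAt_const.mul (continuousAt_phiMod_right hN hτ h₁ h₂)
  · filter_upwards [eventually_offLattice hτ z₂, eventually_not_lattice_div hτ hN z₂] with w hw hw2
    exact phiMod_S_of_not_lattice hN hτ h₁ hw hw2

/-! ### The splitting of `Φ̃` -/

/-- The summand of the expansion of `Φ̃(τ)` in terms of `Φ̃(M²τ)`. -/
noncomputable def splitTerm (N M : ℕ) (τ z₁ z₂ : ℂ) (a b : ℤ) : ℂ :=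
  cexp (2 * Real.pi * I * N * (a * b * τ + a * z₁ + b * z₂)) *
    phiMod N (M ^ 2 * τ) (M * (z₁ + b * τ)) (M * (z₂ + a * τ))

/-- `z` is not in `ℤ/M + ℤτ`. -/
def OffLatticeDiv (M : ℕ) (τ z : ℂ) : Prop := ∀ a b : ℤ, z ≠ a / M + b * τ

lemma OffLatticeDiv.offLattice {M : ℕ} (hM : 0 < M) {τ z : ℂ} (h : OffLatticeDiv M τ z) :
    OffLattice τ z := by
  have hM' : (M : ℂ) ≠ 0 := by exact_mod_cast hM.ne'
  intro a b hab
  refine h (a * M) b ?_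
  push_cast
  rw [hab]; field_simp

lemma OffLatticeDiv.mul {M : ℕ} (hM : 0 < M) {τ z : ℂ} (h : OffLatticeDiv M τ z) (c : ℤ) :
    OffLattice (M ^ 2 * τ) (M * (z + c * τ)) := by
  have hM' : (M : ℂ) ≠ 0 := by exact_mod_cast hM.ne'
  intro a b hab
  refine h a (b * M - c) ?_
  push_cast
  field_simp
  linear_combination hab

lemma splitTerm_add_one {N M : ℕ} (hN : 0 < N) (τ z₁ z₂ : ℂ) (a b : ℤ) :
    splitTerm N M τ (z₁ + 1) z₂ a b = splitTerm N M τ z₁ z₂ a b := by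
  have h := phiMod_add_int hN (M ^ 2 * τ) (M * (z₁ + b * τ)) (M * (z₂ + a * τ)) M
  rw [splitTerm, splitTerm, ← h]
  congr 1
  · rw [show 2 * Real.pi * I * N * (a * b * τ + a * (z₁ + 1) + b * z₂) =
      2 * Real.pi * I * N * (a * b * τ + a * z₁ + b * z₂) + (N * a : ℤ) * (2 * Real.pi * I) by
      push_cast; ring, Complex.exp_add, Complex.exp_int_mul_two_pi_mul_I, mul_one]
  · congr 1; push_cast; ring

lemma splitTerm_add_tau (N M : ℕ) (τ z₁ z₂ : ℂ) (a b : ℤ) :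
    splitTerm N M τ (z₁ + τ) z₂ a b =
      cexp (-(2 * Real.pi * I * N * z₂)) * splitTerm N M τ z₁ z₂ a (b + 1) := by
  rw [splitTerm, splitTerm, ← mul_assoc, ← Complex.exp_add]
  congr 1
  · congr 1; push_cast; ring
  · congr 1; push_cast; ring

/-- Since b matters only mod M, the shift b ↦ b + 1 caused by z₁ ↦ z₁ + τ merely permutes the terms.
-/
lemma splitTerm_add_nat {N M : ℕ} (hN : 0 < N) (hM : 0 < M) {τ z₁ z₂ : ℂ} (hτ : 0 < τ.im)
    (h₁ : OffLatticeDiv M τ z₁) (h₂ : OffLatticeDiv M τ z₂) (a b : ℤ) :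
    splitTerm N M τ z₁ z₂ a (b + M) = splitTerm N M τ z₁ z₂ a b := by
  have hτ' : 0 < ((M : ℂ) ^ 2 * τ).im := by
    have := mul_im_pos hτ (k := M ^ 2) (by positivity); push_cast at this; exact this
  have h := phiMod_add_tau hN hτ' (h₁.mul hM b) (h₂.mul hM a)
  rw [splitTerm, splitTerm, show (M : ℂ) * (z₁ + (b + M : ℤ) * τ) = M * (z₁ + b * τ) + M ^ 2 * τ by
    push_cast; ring, h, ← mul_assoc, ← Complex.exp_add]
  congr 2
  push_cast; ring

lemma hasDbar_splitTerm {N M : ℕ} (hN : 0 < N) (hM : 0 < M) {τ z₁ z₂ : ℂ} (hτ : 0 < τ.im)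
    (h₁ : OffLatticeDiv M τ z₁) (h₂ : OffLatticeDiv M τ z₂) (a b : ℤ) :
    HasDbar (fun z => splitTerm N M τ z z₂ a b)
      (I * gaussSlope N τ.im / 2 *
        (cexp (2 * Real.pi * I * N * (a * b * τ + a * z₁ + b * z₂)) *
        gaussSum N (M ^ 2 * τ) (M * ((z₁ - z₂) / 2 + (b - a : ℤ) * τ / 2))
          (M * (z₁ + z₂ + (a + b : ℤ) * τ)))) z₁ := by
  have hMR : (0 : ℝ) < M := by exact_mod_cast hM
  have hM' : (M : ℂ) ≠ 0 := by exact_mod_cast hM.ne'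
  have hτ' : 0 < ((M : ℂ) ^ 2 * τ).im := by
    have := mul_im_pos hτ (k := M ^ 2) (by positivity); push_cast at this; exact this
  have h := ((hasDbar_phiMod hN hτ' (h₁.mul hM b) (h₂.mul hM a)).comp
    (g := fun z => M * (z + b * τ)) (((hasDerivAt_id z₁).add_const _).const_mul _)).mul_left
    (g := fun z => cexp (2 * Real.pi * I * N * (a * b * τ + a * z + b * z₂))) (by fun_prop)
  convert! h using 1
  have him : ((M : ℂ) ^ 2 * τ).im = (M : ℝ) ^ 2 * τ.im := by
    rw [← ofReal_natCast, ← ofReal_pow, im_ofReal_mul]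
  rw [him, gaussSlope_mul_sq N _ hMR, mul_one, map_natCast,
    show ((M : ℂ) * (z₁ + b * τ) - M * (z₂ + a * τ)) / 2 =
      M * ((z₁ - z₂) / 2 + (b - a : ℤ) * τ / 2) by push_cast; ring,
    show (M : ℂ) * (z₁ + b * τ) + M * (z₂ + a * τ) = M * (z₁ + z₂ + (a + b : ℤ) * τ) by
      push_cast; ring]
  push_cast
  field_simp

/-- Among the terms with 0 ≤ b < M only b = 0 has a pole at p/M. Its residue carries a character in
a, to be summed in `phiMod_split_of_not_lattice`. -/
lemma tendsto_mul_splitTerm {N M : ℕ} (hN : 0 < N) (hM : 0 < M) {τ z₂ : ℂ} (hτ : 0 < τ.im)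
    (h₂ : OffLatticeDiv M τ z₂) (a : ℤ) {b : ℕ} (hb : b < M) (p : ℤ) :
    Tendsto (fun z => (z - p / M) * splitTerm N M τ z z₂ a b) (𝓝[≠] (p / M : ℂ))
      (𝓝 (if b = 0 then -(1 / (2 * Real.pi * I)) / M * cexp (2 * Real.pi * I * a * (N * p : ℤ) / M)
        else 0)) := by
  have hM' : (M : ℂ) ≠ 0 := by exact_mod_cast hM.ne'
  have hτ' : 0 < ((M : ℂ) ^ 2 * τ).im := by
    have := mul_im_pos hτ (k := M ^ 2) (by positivity); push_cast at this; exact this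
  have hcont : Continuous fun z : ℂ => cexp (2 * Real.pi * I * N * (a * b * τ + a * z + b * z₂)) := by
    fun_prop
  split_ifs with h
  · subst h
    have hmap : Tendsto (fun z : ℂ => M * z) (𝓝[≠] (p / M : ℂ)) (𝓝[≠] (p : ℂ)) := by
      refine tendsto_nhdsWithin_iff.2 ⟨?_, ?_⟩
      · refine tendsto_nhdsWithin_of_tendsto_nhds ?_
        have : Continuous fun z : ℂ => M * z := by fun_prop
        simpa [mul_div_cancel₀ _ hM'] using this.tendsto (p / M : ℂ)
      · filter_upwards [self_mem_nhdsWithin] with z hz h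
        exact hz (by rw [Set.mem_singleton_iff] at h ⊢; rw [← h]; field_simp)
    have a1 := ((tendsto_mul_phiMod_int hN hτ' (h₂.mul hM a) p).comp hmap).const_mul ((M : ℂ)⁻¹)
    have a2 := a1.mul (tendsto_nhdsWithin_of_tendsto_nhds (hcont.tendsto (p / M : ℂ)))
    convert! a2 using 1
    · funext z
      simp only [splitTerm, Function.comp]
      simp only [Nat.cast_zero, Int.cast_zero, zero_mul, mul_zero, add_zero]
      field_simp
    · congr 1
      rw [div_eq_inv_mul]
      congr 2
      push_cast
      ring
  -- Comparing imaginary parts, a lattice point here would make b a multiple of M.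
  · have hoff : OffLattice (M ^ 2 * τ) (M * (p / M + (b : ℤ) * τ)) := by
      intro x y hxy
      have h3 := congrArg im hxy
      have e1 : (M : ℂ) * (p / M + (b : ℤ) * τ) = p + ((M * b : ℝ) : ℂ) * τ := by
        push_cast; field_simp
      have e2 : (x : ℂ) + y * (M ^ 2 * τ) = x + ((y * M ^ 2 : ℝ) : ℂ) * τ := by push_cast; ring
      rw [e1, e2, add_im, add_im, im_ofReal_mul, im_ofReal_mul, intCast_im, intCast_im, zero_add,
        zero_add] at h3
      have h4 := mul_right_cancel₀ hτ.ne' h3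
      have h5 : (M : ℤ) * b = y * M ^ 2 := by exact_mod_cast h4
      have h6 : (b : ℤ) = y * M := by
        refine mul_left_cancel₀ (a := (M : ℤ)) (by exact_mod_cast hM.ne') ?_
        rw [h5]; ring
      have h7 : (M : ℤ) ∣ b := ⟨y, by rw [h6]; ring⟩
      exact h (Nat.eq_zero_of_dvd_of_lt (by exact_mod_cast h7) hb)
    have hc : ContinuousAt (fun z => (z - p / M) * splitTerm N M τ z z₂ a b) (p / M) := by
      refine ContinuousAt.mul (by fun_prop) (ContinuousAt.mul (by fun_prop) ?_)
      exact ContinuousAt.comp (f := fun z : ℂ => (M : ℂ) * (z + (b : ℤ) * τ))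
        (g := fun w => phiMod N (M ^ 2 * τ) w (M * (z₂ + a * τ)))
        (continuousAt_phiMod_left hN hτ' hoff (h₂.mul hM a)) (by fun_prop)
    have := hc.tendsto
    rw [sub_self, zero_mul] at this
    exact tendsto_nhdsWithin_of_tendsto_nhds this

lemma tendsto_mul_phiMod_div {N M : ℕ} (hN : 0 < N) (hM : 0 < M) {τ z₂ : ℂ} (hτ : 0 < τ.im)
    (h₂ : OffLattice τ z₂) (p : ℤ) :
    Tendsto (fun z => (z - p / M) * phiMod N τ z z₂) (𝓝[≠] (p / M : ℂ))
      (𝓝 (if (M : ℤ) ∣ p then -(1 / (2 * Real.pi * I)) else 0)) := by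
  have hM' : (M : ℂ) ≠ 0 := by exact_mod_cast hM.ne'
  split_ifs with h
  · obtain ⟨n, rfl⟩ := h
    have := tendsto_mul_phiMod_int hN hτ h₂ n
    rwa [show (n : ℂ) = ((M * n : ℤ) : ℂ) / M by push_cast; field_simp] at this
  · have hoff : OffLattice τ (p / M) := by
      intro x y hxy
      have h3 := congrArg im hxy
      have e1 : (p : ℂ) / M = ((p / M : ℝ) : ℂ) := by push_cast; rfl
      have e2 : (x : ℂ) + y * τ = x + ((y : ℝ) : ℂ) * τ := by push_cast; ring
      rw [e1, e2, add_im, im_ofReal_mul, intCast_im, zero_add, ofReal_im] at h3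
      have hy : (y : ℝ) = 0 := by
        rcases mul_eq_zero.1 h3.symm with h | h
        · exact h
        · exact absurd h hτ.ne'
      have hy' : y = 0 := by exact_mod_cast hy
      rw [hy', Int.cast_zero, zero_mul, add_zero, div_eq_iff hM'] at hxy
      exact h ⟨x, by rw [mul_comm]; exact_mod_cast hxy⟩
    have hc : ContinuousAt (fun z => (z - p / M) * phiMod N τ z z₂) (p / M) :=
      ContinuousAt.mul (by fun_prop) (continuousAt_phiMod_left hN hτ hoff h₂)
    have := hc.tendsto
    rw [sub_self, zero_mul] at this
    exact tendsto_nhdsWithin_of_tendsto_nhds this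

/-- The same rigidity argument, now on the finer lattice ℤ/M + ℤτ where the terms on the right have
their poles. -/
lemma phiMod_split_of_not_lattice {N M : ℕ} (hN : 0 < N) (hM : 0 < M) (hMN : Nat.Coprime M N)
    {τ z₁ z₂ : ℂ} (hτ : 0 < τ.im) (h₁ : OffLatticeDiv M τ z₁) (h₂ : OffLatticeDiv M τ z₂)
    (hβ : ∀ a b : ℤ, z₂ ≠ a / N + b * (τ / N)) :
    phiMod N τ z₁ z₂ =
      ∑ a ∈ Finset.range M, ∑ b ∈ Finset.range M, splitTerm N M τ z₁ z₂ a b := by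
  have hM' : (M : ℂ) ≠ 0 := by exact_mod_cast hM.ne'
  have h₂' := h₂.offLattice hM
  rw [← sub_eq_zero]
  refine eq_zero_of_quasiperiodic (f := fun z => phiMod N τ z z₂ -
    ∑ a ∈ Finset.range M, ∑ b ∈ Finset.range M, splitTerm N M τ z z₂ a b) hτ hM (exp_ne_zero _)
    (multiplier_ne hN hβ) (fun z hz => ?_) (fun p => ?_) (fun z hz => ?_) (fun z hz => ?_) z₁ h₁
  · have hz' : OffLatticeDiv M τ z := hz
    have h := (hasDbar_phiMod hN hτ (hz'.offLattice hM) h₂').sub (.sum (s := Finset.range M)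
      fun a _ => .sum (s := Finset.range M) fun b _ => hasDbar_splitTerm hN hM hτ hz' h₂ a b)
    refine HasDbar.differentiableAt ?_
    convert! h using 1
    rw [gaussSum_split hN hM hMN hτ, Finset.mul_sum, eq_comm, sub_eq_zero]
    refine Finset.sum_congr rfl fun a _ => ?_
    rw [Finset.mul_sum]
    refine Finset.sum_congr rfl fun b _ => ?_
    push_cast
    congr 4
    ring
  · have h := (tendsto_mul_phiMod_div (M := M) hN hM hτ h₂' p).sub
      (tendsto_finsetSum (Finset.range M) fun a _ => tendsto_finsetSum (Finset.range M)
        fun b hb => tendsto_mul_splitTerm hN hM hτ h₂ a (Finset.mem_range.1 hb) p)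
    convert! h using 1
    · funext z
      simp only [mul_sub, Finset.mul_sum]
    · congr 1
      -- By coprimality the character sum over a vanishes exactly when M does not divide p, so the
      -- poles at non-integral p/M cancel.
      have hiff : (M : ℤ) ∣ N * p ↔ (M : ℤ) ∣ p :=
        ⟨fun h => (Int.isCoprime_iff_gcd_eq_one.2 (by simpa using hMN)).dvd_of_dvd_mul_left h,
          fun h => h.mul_left _⟩
      have hs := sum_exp_range hM (N * p)
      simp only [Finset.sum_ite_eq', Finset.mem_range, hM, if_true, Int.cast_natCast,
        ← Finset.mul_sum, hs, hiff]
      split_ifs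
      · field_simp; simp
      · simp
  · have hz' : OffLatticeDiv M τ z := hz
    simp only [phiMod_add_one hN, splitTerm_add_one hN]
  · have hz' : OffLatticeDiv M τ z := hz
    simp only [splitTerm_add_tau, mul_sub, Finset.mul_sum]
    rw [phiMod_add_tau hN hτ (hz'.offLattice hM) h₂']
    congr 1
    refine Finset.sum_congr rfl fun a _ => ?_
    rw [← Finset.mul_sum, ← Finset.mul_sum]
    congr 1
    exact sum_range_add_int hM (φ := fun b => splitTerm N M τ z z₂ a b)
      (fun b => splitTerm_add_nat hN hM hτ hz' h₂ a b) 1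

lemma phiMod_split {N M : ℕ} (hN : 0 < N) (hM : 0 < M) (hMN : Nat.Coprime M N)
    {τ z₁ z₂ : ℂ} (hτ : 0 < τ.im) (h₁ : OffLatticeDiv M τ z₁) (h₂ : OffLatticeDiv M τ z₂) :
    phiMod N τ z₁ z₂ =
      ∑ a ∈ Finset.range M, ∑ b ∈ Finset.range M, splitTerm N M τ z₁ z₂ a b := by
  have hτ' : 0 < ((M : ℂ) ^ 2 * τ).im := by
    have := mul_im_pos hτ (k := M ^ 2) (by positivity); push_cast at this; exact this
  refine eq_of_continuousAt_of_eventuallyEq (F := fun w => phiMod N τ z₁ w) (G := fun w =>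
    ∑ a ∈ Finset.range M, ∑ b ∈ Finset.range M, splitTerm N M τ z₁ w a b)
    (continuousAt_phiMod_right hN hτ (h₁.offLattice hM) (h₂.offLattice hM)) ?_ ?_
  · refine tendsto_finsetSum _ fun a _ => tendsto_finsetSum _ fun b _ => ?_
    refine ContinuousAt.mul (by fun_prop) ?_
    exact ContinuousAt.comp (f := fun w : ℂ => (M : ℂ) * (w + (a : ℤ) * τ))
      (g := fun w => phiMod N (M ^ 2 * τ) (M * (z₁ + (b : ℤ) * τ)) w)
      (continuousAt_phiMod_right hN hτ' (h₁.mul hM b) (h₂.mul hM a)) (by fun_prop)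
  · filter_upwards [eventually_not_lattice hτ hM z₂, eventually_not_lattice_div hτ hN z₂]
      with w hw hw2
    exact phiMod_split_of_not_lattice hN hM hMN hτ h₁ hw hw2

/-! ### Wirtinger derivatives -/

lemma wirtinger_congr {f g : ℂ → ℂ} {z : ℂ} (h : f =ᶠ[𝓝 z] g) : wirtinger f z = wirtinger g z := by
  rw [wirtinger, wirtinger, h.fderiv_eq]

lemma wirtinger_mul_left {f g : ℂ → ℂ} {z g' : ℂ} (hg : HasDerivAt g g' z)
    (hf : DifferentiableAt ℝ f z) :
    wirtinger (fun w => g w * f w) z = g' * f z + g z * wirtinger f z := by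
  have h := (hg.hasFDerivAt.restrictScalars ℝ).mul hf.hasFDerivAt
  rw [wirtinger, wirtinger, show (fun w => g w * f w) = g * f from rfl, h.fderiv]
  simp
  linear_combination (1 / 2 * f z * g') * (-I_mul_I)

lemma wirtinger_const_mul (c : ℂ) {f : ℂ → ℂ} {z : ℂ} (hf : DifferentiableAt ℝ f z) :
    wirtinger (fun w => c * f w) z = c * wirtinger f z := by
  rw [wirtinger_mul_left (hasDerivAt_const z c) hf]; ring

lemma wirtinger_of_hasDerivAt {f : ℂ → ℂ} {z f' : ℂ} (hf : HasDerivAt f f' z) :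
    wirtinger f z = f' := by
  rw [wirtinger, (hf.hasFDerivAt.restrictScalars ℝ).fderiv]
  simp
  linear_combination (-1 / 2 * f') * I_mul_I

lemma wirtinger_sum {ι : Type*} {s : Finset ι} {f : ι → ℂ → ℂ} {z : ℂ}
    (hf : ∀ i ∈ s, DifferentiableAt ℝ (f i) z) :
    wirtinger (fun w => ∑ i ∈ s, f i w) z = ∑ i ∈ s, wirtinger (f i) z := by
  simp only [wirtinger]
  rw [fderiv_fun_sum hf]
  simp [Finset.mul_sum, Finset.sum_sub_distrib, mul_sub]

lemma wirtinger_comp_div {f : ℂ → ℂ} (τ : ℂ) {z : ℂ} (hf : DifferentiableAt ℝ f (z / τ)) :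
    wirtinger (fun w => f (w / τ)) z = wirtinger f (z / τ) / τ := by
  have h := hf.hasFDerivAt.comp z ((((hasDerivAt_id z).div_const τ).hasFDerivAt).restrictScalars ℝ)
  set L := fderiv ℝ f (z / τ) with hL
  have key : ∀ x : ℂ, L x = x.re * L 1 + x.im * L I := by
    intro x
    conv_lhs => rw [← re_add_im x]
    have e1 : (x.re : ℂ) = x.re • (1 : ℂ) := by simp
    have e2 : (x.im : ℂ) * I = x.im • I := by simp
    rw [e2, map_add, map_smul, e1, map_smul, real_smul, real_smul]
    simp
  rw [wirtinger, wirtinger, show (fun w => f (w / τ)) = f ∘ (fun w => id w / τ) from rfl, h.fderiv]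
  have e1 : (1 / τ : ℂ) = (1 / τ).re + (1 / τ).im * I := (re_add_im _).symm
  have k1 := key (1 / τ)
  have k2 := key (I * (1 / τ))
  simp only [I_mul_re, I_mul_im, ofReal_neg] at k2
  simp only [ContinuousLinearMap.comp_apply, ContinuousLinearMap.coe_restrictScalars',
    ContinuousLinearMap.toSpanSingleton_apply, smul_eq_mul, one_mul]
  rw [k1, k2, ← hL, div_eq_mul_one_div]
  linear_combination (1 / 2 * (1 / τ).im * L I) * I_mul_I - 1 / 2 * (L 1 - I * L I) * e1

/-! ### The numerators `Ψ̃` -/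

/-- The numerator `Ψ̃^{[M,m-1;ε]}_{j,k;ε'}` at `t = 0`. -/
noncomputable def psiMod (M m : ℕ) (e : Fin 2) (j k τ z₁ z₂ : ℂ) : ℂ :=
  cexp (2 * Real.pi * I * m / M * (j * k * τ + k * z₁ + j * z₂)) *
    phiMod m (M * τ) (z₁ + j * τ + half e) (z₂ + k * τ + half e)

lemma PsiTilde_eq {M m : ℕ} (hM : 0 < M) (hm : 0 < m) (e : Fin 2) (j k : ℂ) {τ : ℂ} (hτ : 0 < τ.im)
    (z₁ z₂ t : ℂ) :
    PsiTilde M (m - 1) e j k τ z₁ z₂ t =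
      cexp (2 * Real.pi * I * m / M * t) * psiMod M m e j k τ z₁ z₂ := by
  obtain ⟨n, rfl⟩ : ∃ n, m = n + 1 := ⟨m - 1, by omega⟩
  rw [PsiTilde, Nat.add_sub_cancel, PhiTilde_eq n (mul_im_pos hτ hM), psiMod, ← mul_assoc,
    ← mul_assoc, ← Complex.exp_add, ← Complex.exp_add, ← Complex.exp_add]
  congr 2
  push_cast
  ring

lemma natCast_one_sub (e : Fin 2) : (((1 - e : Fin 2) : ℕ) : ℂ) = 1 - (e : ℕ) := by
  fin_cases e <;> simp

/-- Regularity keeps z off the zeros of the denominator of R̂, and these contain all the points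
where Ψ̃ could have a pole. -/
lemma ne_of_vartheta_ne_zero {e e' : Fin 2} {τ z : ℂ} (hτ : 0 < τ.im)
    (h : vartheta (1 - e') (1 - e) τ z ≠ 0) (x y : ℤ) : z ≠ half e + x + (half e' + y) * τ := by
  rintro hz
  refine h (vartheta_eq_zero hτ _ _ x y z ?_)
  rw [natCast_one_sub, natCast_one_sub, hz, half, half]
  ring

lemma offLattice_of_vartheta_ne_zero {M : ℕ} {e e' : Fin 2} {τ z : ℂ} (hτ : 0 < τ.im)
    (h : vartheta (1 - e') (1 - e) τ z ≠ 0) (j : ℤ) :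
    OffLattice (M * τ) (z + (j + half e') * τ + half e) := by
  intro a b hab
  refine ne_of_vartheta_ne_zero hτ h (a - (e : ℕ)) (b * M - j - (e' : ℕ)) ?_
  rw [half, half] at *
  push_cast
  linear_combination hab

lemma differentiableAt_psiMod {M m : ℕ} (hM : 0 < M) (hm : 0 < m) {e e' : Fin 2} {τ z₁ z₂ : ℂ}
    (hτ : 0 < τ.im) (h₁ : vartheta (1 - e') (1 - e) τ z₁ ≠ 0)
    (h₂ : vartheta (1 - e') (1 - e) τ z₂ ≠ 0) (j k : ℤ) :
    DifferentiableAt ℝ (fun p : ℂ × ℂ => psiMod M m e (j + half e') (k + half e') τ p.1 p.2)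
      (z₁, z₂) := by
  refine DifferentiableAt.mul (by fun_prop) ?_
  exact DifferentiableAt.comp (z₁, z₂)
    (f := fun p : ℂ × ℂ => (p.1 + (j + half e') * τ + half e, p.2 + (k + half e') * τ + half e))
    (g := fun p : ℂ × ℂ => phiMod m (M * τ) p.1 p.2)
    (differentiableAt_phiMod hm (mul_im_pos hτ hM) (offLattice_of_vartheta_ne_zero hτ h₁ j)
      (offLattice_of_vartheta_ne_zero hτ h₂ k)) (by fun_prop)

lemma differentiableAt_psiMod_left {M m : ℕ} (hM : 0 < M) (hm : 0 < m) {e e' : Fin 2} {τ z₁ z₂ : ℂ}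
    (hτ : 0 < τ.im) (h₁ : vartheta (1 - e') (1 - e) τ z₁ ≠ 0)
    (h₂ : vartheta (1 - e') (1 - e) τ z₂ ≠ 0) (j k : ℤ) :
    DifferentiableAt ℝ (fun z => psiMod M m e (j + half e') (k + half e') τ z z₂) z₁ :=
  DifferentiableAt.comp z₁ (f := fun z : ℂ => (z, z₂))
    (g := fun p : ℂ × ℂ => psiMod M m e (j + half e') (k + half e') τ p.1 p.2)
    (differentiableAt_psiMod hM hm hτ h₁ h₂ j k) (by fun_prop)

lemma differentiableAt_psiMod_right {M m : ℕ} (hM : 0 < M) (hm : 0 < m) {e e' : Fin 2} {τ z₁ z₂ : ℂ}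
    (hτ : 0 < τ.im) (h₁ : vartheta (1 - e') (1 - e) τ z₁ ≠ 0)
    (h₂ : vartheta (1 - e') (1 - e) τ z₂ ≠ 0) (j k : ℤ) :
    DifferentiableAt ℝ (fun z => psiMod M m e (j + half e') (k + half e') τ z₁ z) z₂ :=
  DifferentiableAt.comp z₂ (f := fun z : ℂ => (z₁, z))
    (g := fun p : ℂ × ℂ => psiMod M m e (j + half e') (k + half e') τ p.1 p.2)
    (differentiableAt_psiMod hM hm hτ h₁ h₂ j k) (by fun_prop)

lemma differentiableAt_PsiTilde {M m : ℕ} (hM : 0 < M) (hm : 0 < m) {e e' : Fin 2} {τ z₁ z₂ : ℂ}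
    (hτ : 0 < τ.im) (h₁ : vartheta (1 - e') (1 - e) τ z₁ ≠ 0)
    (h₂ : vartheta (1 - e') (1 - e) τ z₂ ≠ 0) (j k : ℤ) (t : ℂ) :
    DifferentiableAt ℝ (fun p : ℂ × ℂ × ℂ =>
      PsiTilde M (m - 1) e (j + half e') (k + half e') τ p.1 p.2.1 p.2.2) (z₁, z₂, t) := by
  simp only [PsiTilde_eq hM hm _ _ _ hτ]
  refine DifferentiableAt.mul (by fun_prop) ?_
  exact DifferentiableAt.comp (z₁, z₂, t) (f := fun p : ℂ × ℂ × ℂ => (p.1, p.2.1))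
    (g := fun p : ℂ × ℂ => psiMod M m e (j + half e') (k + half e') τ p.1 p.2)
    (differentiableAt_psiMod hM hm hτ h₁ h₂ j k) (by fun_prop)

/-- The value of `D₁` on `e^{2πimt/M} f(z₁,z₂)` at `t = 0`. -/
noncomputable def reducedD (M m : ℕ) (f : ℂ → ℂ → ℂ) (τ z₁ z₂ : ℂ) : ℂ :=
  1 / (2 * Real.pi * I) * (wirtinger (fun w => f w z₂) z₁ - wirtinger (fun w => f z₁ w) z₂) -
    m / M * ((z₁ - z₂) / (2 * τ)) * f z₁ z₂

lemma PsiTildeA_eq {M m : ℕ} (hM : 0 < M) (hm : 0 < m) {e e' : Fin 2} {τ z₁ z₂ : ℂ}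
    (hτ : 0 < τ.im) (h₁ : vartheta (1 - e') (1 - e) τ z₁ ≠ 0)
    (h₂ : vartheta (1 - e') (1 - e) τ z₂ ≠ 0) (j k : ℤ) (t : ℂ) :
    PsiTildeA M m e (j + half e') (k + half e') τ z₁ z₂ t = cexp (2 * Real.pi * I * m / M * t) *
      reducedD M m (psiMod M m e (j + half e') (k + half e') τ) τ z₁ z₂ := by
  rw [PsiTildeA, D₁]
  simp only [PsiTilde_eq hM hm _ _ _ hτ]
  have hd : HasDerivAt (fun w => cexp (2 * Real.pi * I * m / M * w) *
      psiMod M m e (j + half e') (k + half e') τ z₁ z₂)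
      (2 * Real.pi * I * m / M * cexp (2 * Real.pi * I * m / M * t) *
        psiMod M m e (j + half e') (k + half e') τ z₁ z₂) t := by
    have := (((hasDerivAt_id t).const_mul (2 * Real.pi * I * m / M)).cexp).mul_const
      (psiMod M m e (j + half e') (k + half e') τ z₁ z₂)
    convert! this using 1
    simp only [id, mul_one]; ring
  rw [wirtinger_const_mul _ (differentiableAt_psiMod_left hM hm hτ h₁ h₂ j k),
    wirtinger_const_mul _ (differentiableAt_psiMod_right hM hm hτ h₁ h₂ j k),
    wirtinger_of_hasDerivAt hd, reducedD]
  have h0 := Complex.two_pi_I_ne_zero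
  have hM' : (M : ℂ) ≠ 0 := by exact_mod_cast hM.ne'
  have hτ0 : τ ≠ 0 := by rintro rfl; simp at hτ
  field_simp

/-- With σ = τ/M one has M(-1/τ) = -1/σ and M²σ = Mτ. Hence `phiMod_S` at σ, followed by
`phiMod_split` at σ, leads back to numerators at τ. -/
lemma psiMod_S {M m : ℕ} (hM : 0 < M) (hm : 0 < m) (hMm : Nat.Coprime M m) {e e' : Fin 2}
    {τ z₁ z₂ : ℂ} (hτ : 0 < τ.im) (h₁ : vartheta (1 - e) (1 - e') τ z₁ ≠ 0)
    (h₂ : vartheta (1 - e) (1 - e') τ z₂ ≠ 0) (j k : ℤ) :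
    psiMod M m e (j + half e') (k + half e') (-1 / τ) (z₁ / τ) (z₂ / τ) =
      cexp (2 * Real.pi * I * m / M * (z₁ * z₂ / τ)) * (τ / M *
        ∑ a ∈ Finset.range M, ∑ b ∈ Finset.range M,
          cexp (-(2 * Real.pi * I * m / M) *
            ((a + half e) * (k + half e') + (b + half e) * (j + half e'))) *
          psiMod M m e' (a + half e) (b + half e) τ z₁ z₂) := by
  have hτ0 : τ ≠ 0 := by rintro rfl; simp at hτ
  have hM' : (M : ℂ) ≠ 0 := by exact_mod_cast hM.ne'
  set σ := τ / M with hσ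
  have hσ0 : σ ≠ 0 := div_ne_zero hτ0 hM'
  have hσim : 0 < σ.im := by rw [hσ, div_natCast_im]; positivity
  have hoff : ∀ z : ℂ, ∀ l : ℤ, vartheta (1 - e) (1 - e') τ z ≠ 0 →
      OffLatticeDiv M σ ((z - (l + half e') + half e * τ) / M) := by
    intro z l hz x y hxy
    refine ne_of_vartheta_ne_zero hτ hz (x + l) (y - (e : ℕ)) ?_
    rw [hσ] at hxy
    field_simp at hxy
    rw [half, half] at *
    push_cast
    linear_combination hxy
  set w₁ := (z₁ - (j + half e') + half e * τ) / M with hw₁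
  set w₂ := (z₂ - (k + half e') + half e * τ) / M with hw₂
  have o₁ := hoff z₁ j h₁
  have o₂ := hoff z₂ k h₂
  have hS := phiMod_S hm hσim (o₁.offLattice hM) (o₂.offLattice hM)
  have hS' : phiMod m (-1 / σ) (w₁ / σ) (w₂ / σ) =
      cexp (2 * Real.pi * I * m * w₁ * w₂ / σ) * (σ * phiMod m σ w₁ w₂) := by
    rw [← hS, ← mul_assoc, ← Complex.exp_add, add_neg_cancel, Complex.exp_zero, one_mul]
  rw [phiMod_split hm hM hMm hσim o₁ o₂] at hS'
  rw [psiMod, show (M : ℂ) * (-1 / τ) = -1 / σ by rw [hσ]; field_simp,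
    show z₁ / τ + (j + half e') * (-1 / τ) + half e = w₁ / σ by
      rw [hw₁, hσ]; field_simp; ring,
    show z₂ / τ + (k + half e') * (-1 / τ) + half e = w₂ / σ by
      rw [hw₂, hσ]; field_simp; ring, hS']
  simp only [Finset.mul_sum]
  -- In `splitTerm` the first index accompanies z₂, in `psiMod` it accompanies z₁.
  rw [Finset.sum_comm]
  refine Finset.sum_congr rfl fun a _ => Finset.sum_congr rfl fun b _ => ?_
  -- The integer e' is 2ε', so adding j + e' turns the shift -(j + ε') into +ε'; likewise for k.
  have p₁ := phiMod_add_int hm (M ^ 2 * σ) (M * (w₁ + a * σ)) (M * (w₂ + b * σ)) (j + (e' : ℕ))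
  have p₂ := phiMod_add_int_right hm (M ^ 2 * σ) (M * (w₁ + a * σ) + (j + (e' : ℕ) : ℤ))
    (M * (w₂ + b * σ)) (k + (e' : ℕ))
  rw [splitTerm, Int.cast_natCast, Int.cast_natCast, ← p₁, ← p₂, psiMod,
    show (M : ℂ) ^ 2 * σ = M * τ by rw [hσ]; field_simp,
    show M * (w₁ + a * σ) + (j + (e' : ℕ) : ℤ) = z₁ + (a + half e) * τ + half e' by
      rw [hw₁, hσ, half, half]; push_cast; field_simp; ring,
    show M * (w₂ + b * σ) + (k + (e' : ℕ) : ℤ) = z₂ + (b + half e) * τ + half e' by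
      rw [hw₂, hσ, half, half]; push_cast; field_simp; ring]
  set P := phiMod m (M * τ) (z₁ + (a + half e) * τ + half e') (z₂ + (b + half e) * τ + half e')
  have hexp : cexp (2 * Real.pi * I * m / M * ((j + half e') * (k + half e') * (-1 / τ) +
      (k + half e') * (z₁ / τ) + (j + half e') * (z₂ / τ))) *
      cexp (2 * Real.pi * I * m * w₁ * w₂ / σ) *
      cexp (2 * Real.pi * I * m * (b * a * σ + b * w₁ + a * w₂)) =
      cexp (2 * Real.pi * I * m / M * (z₁ * z₂ / τ)) *
      cexp (-(2 * Real.pi * I * m / M) *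
            ((a + half e) * (k + half e') + (b + half e) * (j + half e'))) *
      cexp (2 * Real.pi * I * m / M * ((a + half e) * (b + half e) * τ + (b + half e) * z₁ +
        (a + half e) * z₂)) := by
    simp only [← Complex.exp_add]
    congr 1
    rw [hw₁, hw₂, hσ]
    field_simp
    ring
  linear_combination (σ * P) * hexp

/-! ### The `S`-transformation of the characters -/

lemma Regular.S {e e' : Fin 2} {τ z₁ z₂ : ℂ} (hτ : 0 < τ.im) (h : Regular e' e τ z₁ z₂) :
    Regular e e' (-1 / τ) (z₁ / τ) (z₂ / τ) := by
  have hτ0 : τ ≠ 0 := by rintro rfl; simp at hτ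
  have key : ∀ (a b : Fin 2) (z : ℂ), vartheta b a τ z ≠ 0 → vartheta a b (-1 / τ) (z / τ) ≠ 0 := by
    intro a b z hz
    rw [vartheta_S hτ]
    refine mul_ne_zero (mul_ne_zero (mul_ne_zero (pow_ne_zero _ (by simp)) ?_) (exp_ne_zero _)) hz
    rw [Ne, cpow_eq_zero_iff]
    simp [hτ0]
  obtain ⟨h1, h2, h3, h4⟩ := h
  refine ⟨?_, ?_, key _ _ _ h3, key _ _ _ h4⟩
  · rw [← sub_div]; exact key _ _ _ h1
  · rw [← add_div]; exact key _ _ _ h2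

/-- The exponentials cancel by (z₁ - z₂)² + (z₁ + z₂)² = 2z₁² + 2z₂². With c² = -iτ, the factors are
-τ² from η⁴, -c² from the numerator and c⁴ from the denominator, which leaves iτ. -/
lemma Rhat_S (e e' : Fin 2) {τ z₁ z₂ : ℂ} (hτ : 0 < τ.im) :
    Rhat e e' (-1 / τ) (z₁ / τ) (z₂ / τ) =
      (-1) ^ ((e : ℕ) + (e' : ℕ)) * (I * τ) * Rhat e' e τ z₁ z₂ := by
  have hτ0 : τ ≠ 0 := by rintro rfl; simp at hτ
  rw [Rhat, Rhat, eta_S_pow_four hτ, ← sub_div, ← add_div]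
  simp only [vartheta_S hτ]
  set c := (-I * τ) ^ (1 / 2 : ℂ) with hc
  have hcc : c ^ 2 = -I * τ := by
    rw [hc, ← cpow_nat_mul]; simp
  have hc0 : c ≠ 0 := by
    intro h
    rw [h] at hcc
    simp [hτ0] at hcc
  set n := ((1 - e' : Fin 2) : ℕ) * ((1 - e : Fin 2) : ℕ)
  have hI : ((-I) ^ n) ^ 2 * ((-I) ^ n) ^ 2 = 1 := by
    rw [← pow_add, ← pow_mul, mul_comm, pow_mul]
    have : (-I) ^ (2 + 2) = 1 := by norm_num [I_pow_four, neg_pow]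
    rw [this, one_pow]
  have he : cexp (Real.pi * I * (z₁ - z₂) ^ 2 / τ) * cexp (Real.pi * I * (z₁ + z₂) ^ 2 / τ) =
      cexp (Real.pi * I * z₁ ^ 2 / τ) ^ 2 * cexp (Real.pi * I * z₂ ^ 2 / τ) ^ 2 := by
    rw [← Complex.exp_nat_mul, ← Complex.exp_nat_mul, ← Complex.exp_add, ← Complex.exp_add]
    congr 1
    push_cast
    ring
  have hE1 := exp_ne_zero (Real.pi * I * z₁ ^ 2 / τ)
  have hE2 := exp_ne_zero (Real.pi * I * z₂ ^ 2 / τ)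
  set E1 := cexp (Real.pi * I * z₁ ^ 2 / τ)
  set E2 := cexp (Real.pi * I * z₂ ^ 2 / τ)
  set E3 := cexp (Real.pi * I * (z₁ - z₂) ^ 2 / τ)
  set E4 := cexp (Real.pi * I * (z₁ + z₂) ^ 2 / τ)
  set A := vartheta 1 1 τ (z₁ - z₂)
  set B := vartheta 1 1 τ (z₁ + z₂)
  set U := vartheta (1 - e) (1 - e') τ z₁
  set V := vartheta (1 - e) (1 - e') τ z₂
  have hden : ((-I) ^ n * c * E1 * U) ^ 2 * ((-I) ^ n * c * E2 * V) ^ 2 =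
      (-τ ^ 2 * (E1 ^ 2 * E2 ^ 2)) * (U ^ 2 * V ^ 2) := by
    have : c ^ 2 * c ^ 2 = -τ ^ 2 := by rw [hcc]; linear_combination τ ^ 2 * I_sq
    linear_combination (c ^ 2 * c ^ 2 * E1 ^ 2 * E2 ^ 2 * U ^ 2 * V ^ 2) * hI +
      (E1 ^ 2 * E2 ^ 2 * U ^ 2 * V ^ 2) * this
  have hsgn : ((-1 : ℂ) ^ (e : ℕ)) * (-1) ^ (e : ℕ) = 1 := by
    rw [← pow_add, ← two_mul, pow_mul]; simp
  have hnum : (-1) ^ (e' : ℕ) * (-τ ^ 2 * ModularForm.eta τ ^ 4) *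
      ((-I) ^ (((1 : Fin 2) : ℕ) * ((1 : Fin 2) : ℕ)) * c * E3 * A *
        ((-I) ^ (((1 : Fin 2) : ℕ) * ((1 : Fin 2) : ℕ)) * c * E4 * B)) =
      (-τ ^ 2 * (E1 ^ 2 * E2 ^ 2)) * ((-1) ^ ((e : ℕ) + (e' : ℕ)) * (I * τ) *
        ((-1) ^ (e : ℕ) * ModularForm.eta τ ^ 4 * (A * B))) := by
    simp only [Fin.val_one, mul_one, pow_one]
    rw [pow_add]
    linear_combination (-τ ^ 2 * (-1) ^ (e' : ℕ) * ModularForm.eta τ ^ 4 * A * B) *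
      ((I ^ 2 * E3 * E4) * hcc - I * τ * E3 * E4 * I_sq + I * τ * he -
        I * τ * E1 ^ 2 * E2 ^ 2 * hsgn)
  rw [hden, hnum, mul_div_mul_left _ _ (by simp [hτ0, hE1, hE2]), mul_div_assoc]

lemma eventually_vartheta_ne_zero_nhds {τ : ℂ} (hτ : 0 < τ.im) {a b : Fin 2} {z : ℂ}
    (h : vartheta a b τ z ≠ 0) : ∀ᶠ w in 𝓝 z, vartheta a b τ w ≠ 0 :=
  (differentiable_vartheta hτ a b).continuous.continuousAt.eventually_ne h

/-- Applied to e^{2πi(m/M)z₁z₂/τ}, the operator ∂₁ - ∂₂ yields a multiple of z₂ - z₁. Half of it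
cancels the explicit term at -1/τ, and the other half is the explicit term at τ. -/
lemma reducedD_S {M m : ℕ} (hM : 0 < M) {f g : ℂ → ℂ → ℂ} {τ z₁ z₂ : ℂ} (hτ : τ ≠ 0)
    (hf₁ : DifferentiableAt ℝ (fun w => f w (z₂ / τ)) (z₁ / τ))
    (hf₂ : DifferentiableAt ℝ (fun w => f (z₁ / τ) w) (z₂ / τ))
    (hg₁ : DifferentiableAt ℝ (fun w => g w z₂) z₁) (hg₂ : DifferentiableAt ℝ (fun w => g z₁ w) z₂)
    (h₁ : ∀ᶠ w in 𝓝 z₁, f (w / τ) (z₂ / τ) = cexp (2 * Real.pi * I * m / M * (w * z₂ / τ)) * g w z₂)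
    (h₂ : ∀ᶠ w in 𝓝 z₂, f (z₁ / τ) (w / τ) = cexp (2 * Real.pi * I * m / M * (z₁ * w / τ)) * g z₁ w) :
    reducedD M m f (-1 / τ) (z₁ / τ) (z₂ / τ) =
      cexp (2 * Real.pi * I * m / M * (z₁ * z₂ / τ)) * (τ * reducedD M m g τ z₁ z₂) := by
  have hM' : (M : ℂ) ≠ 0 := by exact_mod_cast hM.ne'
  have hpi := Complex.two_pi_I_ne_zero
  set c := 2 * Real.pi * I * m / M with hc
  have e₁ : HasDerivAt (fun w => cexp (c * (w * z₂ / τ))) (c * z₂ / τ * cexp (c * (z₁ * z₂ / τ))) z₁ := by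
    have := ((((hasDerivAt_id z₁).mul_const z₂).div_const τ).const_mul c).cexp
    convert! this using 1
    simp only [id]; ring
  have e₂ : HasDerivAt (fun w => cexp (c * (z₁ * w / τ))) (c * z₁ / τ * cexp (c * (z₁ * z₂ / τ))) z₂ := by
    have := ((((hasDerivAt_id z₂).const_mul z₁).div_const τ).const_mul c).cexp
    convert! this using 1
    simp only [id]; ring
  have w₁ := wirtinger_comp_div τ hf₁
  rw [wirtinger_congr (g := fun w => cexp (c * (w * z₂ / τ)) * g w z₂) h₁,
    wirtinger_mul_left e₁ hg₁, eq_div_iff hτ] at w₁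
  have w₂ := wirtinger_comp_div τ hf₂
  rw [wirtinger_congr (g := fun w => cexp (c * (z₁ * w / τ)) * g z₁ w) h₂,
    wirtinger_mul_left e₂ hg₂, eq_div_iff hτ] at w₂
  rw [reducedD, reducedD, ← w₁, ← w₂, h₁.self_of_nhds]
  set E := cexp (c * (z₁ * z₂ / τ))
  rw [hc]
  field_simp
  ring

lemma reducedD_const_mul (M m : ℕ) (c : ℂ) {f : ℂ → ℂ → ℂ} {τ z₁ z₂ : ℂ}
    (hf₁ : DifferentiableAt ℝ (fun w => f w z₂) z₁) (hf₂ : DifferentiableAt ℝ (fun w => f z₁ w) z₂) :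
    reducedD M m (fun w₁ w₂ => c * f w₁ w₂) τ z₁ z₂ = c * reducedD M m f τ z₁ z₂ := by
  rw [reducedD, reducedD, wirtinger_const_mul c hf₁, wirtinger_const_mul c hf₂]
  ring

lemma reducedD_sum (M m : ℕ) {ι : Type*} {s : Finset ι} {f : ι → ℂ → ℂ → ℂ} {τ z₁ z₂ : ℂ}
    (hf₁ : ∀ i ∈ s, DifferentiableAt ℝ (fun w => f i w z₂) z₁)
    (hf₂ : ∀ i ∈ s, DifferentiableAt ℝ (fun w => f i z₁ w) z₂) :
    reducedD M m (fun w₁ w₂ => ∑ i ∈ s, f i w₁ w₂) τ z₁ z₂ =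
      ∑ i ∈ s, reducedD M m (f i) τ z₁ z₂ := by
  simp only [reducedD]
  rw [wirtinger_sum hf₁, wirtinger_sum hf₂, Finset.sum_sub_distrib, ← Finset.mul_sum, ← Finset.mul_sum,
    Finset.sum_sub_distrib]

lemma chTilde_eq {M m : ℕ} (hM : 0 < M) (hm : 0 < m) {e e' : Fin 2} {τ z₁ z₂ : ℂ}
    (hτ : 0 < τ.im) (h : Regular e e' τ z₁ z₂) (j k : ℤ) (t : ℂ) :
    chTilde M m e e' (j + half e') (k + half e') τ z₁ z₂ t = cexp (2 * Real.pi * I * m / M * t) *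
      reducedD M m (psiMod M m e (j + half e') (k + half e') τ) τ z₁ z₂ / Rhat e e' τ z₁ z₂ := by
  rw [chTilde, PsiTildeA_eq hM hm hτ h.2.2.1 h.2.2.2]

/-- The scalar is τ from `reducedD_S` times τ/M from `psiMod_S`, divided by ±iτ from `Rhat_S`; t ↦ t
- z₁z₂/τ removes the automorphy exponential. -/
lemma chTilde_S {M m : ℕ} (hM : 0 < M) (hm : 0 < m) (hMm : Nat.Coprime M m) {e e' : Fin 2}
    {τ z₁ z₂ : ℂ} (hτ : 0 < τ.im) (h : Regular e' e τ z₁ z₂) (j k : ℤ) (t : ℂ) :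
    chTilde M m e e' (j + half e') (k + half e') (-1 / τ) (z₁ / τ) (z₂ / τ) (t - z₁ * z₂ / τ) =
      -(-1 : ℂ) ^ (((e : ℕ) : ℤ) - ((e' : ℕ) : ℤ)) * (I * τ / M) *
        ∑ a ∈ Finset.range M, ∑ b ∈ Finset.range M,
          cexp (-(2 * Real.pi * I * m / M) *
            ((a + half e) * (k + half e') + (b + half e) * (j + half e'))) *
          chTilde M m e' e (a + half e) (b + half e) τ z₁ z₂ t := by
  have hτ0 : τ ≠ 0 := by rintro rfl; simp at hτ
  have hM' : (M : ℂ) ≠ 0 := by exact_mod_cast hM.ne'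
  have hS := h.S hτ
  obtain ⟨-, -, h₁, h₂⟩ := id h
  obtain ⟨-, -, h₁', h₂'⟩ := id hS
  have hτ' := neg_inv_im_pos hτ
  have dl : ∀ a b : ℕ, DifferentiableAt ℝ
      (fun z => psiMod M m e' (a + half e) (b + half e) τ z z₂) z₁ := fun a b => by
    exact_mod_cast differentiableAt_psiMod_left hM hm hτ h₁ h₂ (a : ℤ) (b : ℤ)
  have dr : ∀ a b : ℕ, DifferentiableAt ℝ
      (fun z => psiMod M m e' (a + half e) (b + half e) τ z₁ z) z₂ := fun a b => by
    exact_mod_cast differentiableAt_psiMod_right hM hm hτ h₁ h₂ (a : ℤ) (b : ℤ)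
  have hch : ∀ a b : ℕ, chTilde M m e' e (a + half e) (b + half e) τ z₁ z₂ t =
      cexp (2 * Real.pi * I * m / M * t) *
        reducedD M m (psiMod M m e' (a + half e) (b + half e) τ) τ z₁ z₂ / Rhat e' e τ z₁ z₂ :=
    fun a b => by exact_mod_cast chTilde_eq hM hm hτ h (a : ℤ) (b : ℤ) t
  have dls : ∀ a ∈ Finset.range M, ∀ b ∈ Finset.range M, ∀ c : ℂ, DifferentiableAt ℝ
      (fun z => c * psiMod M m e' (a + half e) (b + half e) τ z z₂) z₁ :=
    fun a _ b _ c => (dl a b).const_mul c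
  have drs : ∀ a ∈ Finset.range M, ∀ b ∈ Finset.range M, ∀ c : ℂ, DifferentiableAt ℝ
      (fun z => c * psiMod M m e' (a + half e) (b + half e) τ z₁ z) z₂ :=
    fun a _ b _ c => (dr a b).const_mul c
  have dls' := fun (C : ℕ → ℕ → ℂ) a (ha : a ∈ Finset.range M) =>
    DifferentiableAt.fun_sum (u := Finset.range M) fun b hb => dls a ha b hb (C a b)
  have drs' := fun (C : ℕ → ℕ → ℂ) a (ha : a ∈ Finset.range M) =>
    DifferentiableAt.fun_sum (u := Finset.range M) fun b hb => drs a ha b hb (C a b)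
  have dls'' := fun (C : ℕ → ℕ → ℂ) =>
    DifferentiableAt.fun_sum (u := Finset.range M) fun a ha => dls' C a ha
  have drs'' := fun (C : ℕ → ℕ → ℂ) =>
    DifferentiableAt.fun_sum (u := Finset.range M) fun a ha => drs' C a ha
  set C : ℕ → ℕ → ℂ := fun a b => cexp (-(2 * Real.pi * I * m / M) *
    ((a + half e) * (k + half e') + (b + half e) * (j + half e'))) with hC
  have key := reducedD_S (m := m) hM hτ0
    (f := psiMod M m e (j + half e') (k + half e') (-1 / τ))
    (g := fun w₁ w₂ => τ / M * ∑ a ∈ Finset.range M, ∑ b ∈ Finset.range M,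
      C a b * psiMod M m e' (a + half e) (b + half e) τ w₁ w₂)
    (differentiableAt_psiMod_left hM hm hτ' h₁' h₂' j k)
    (differentiableAt_psiMod_right hM hm hτ' h₁' h₂' j k)
    ((dls'' C).const_mul _) ((drs'' C).const_mul _)
    ((eventually_vartheta_ne_zero_nhds hτ h₁).mono fun w hw => psiMod_S hM hm hMm hτ hw h₂ j k)
    ((eventually_vartheta_ne_zero_nhds hτ h₂).mono fun w hw => psiMod_S hM hm hMm hτ h₁ hw j k)
  rw [reducedD_const_mul _ _ _ (dls'' C) (drs'' C), reducedD_sum _ _ (dls' C) (drs' C)] at key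
  have key2 : ∀ a ∈ Finset.range M, reducedD M m (fun w₁ w₂ => ∑ b ∈ Finset.range M,
      C a b * psiMod M m e' (a + half e) (b + half e) τ w₁ w₂) τ z₁ z₂ =
      ∑ b ∈ Finset.range M, C a b *
        reducedD M m (psiMod M m e' (a + half e) (b + half e) τ) τ z₁ z₂ := by
    intro a ha
    rw [reducedD_sum _ _ (fun b hb => dls a ha b hb (C a b)) (fun b hb => drs a ha b hb (C a b))]
    exact Finset.sum_congr rfl fun b _ => reducedD_const_mul _ _ _ (dl a b) (dr a b)
  rw [Finset.sum_congr rfl key2] at key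
  rw [chTilde_eq hM hm hτ' hS, key, Rhat_S e e' hτ]
  set S := ∑ a ∈ Finset.range M, ∑ b ∈ Finset.range M, C a b *
        reducedD M m (psiMod M m e' (a + half e) (b + half e) τ) τ z₁ z₂
  have hexp : cexp (2 * Real.pi * I * m / M * (t - z₁ * z₂ / τ)) *
      cexp (2 * Real.pi * I * m / M * (z₁ * z₂ / τ)) = cexp (2 * Real.pi * I * m / M * t) := by
    rw [← Complex.exp_add]; congr 1; ring
  have hsgn : ((-1 : ℂ) ^ (((e : ℕ) : ℤ) - ((e' : ℕ) : ℤ))) * (-1) ^ ((e : ℕ) + (e' : ℕ)) = 1 := by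
    rw [zpow_sub₀ (by simp), zpow_natCast, zpow_natCast, pow_add]
    fin_cases e <;> fin_cases e' <;> simp
  have hsum : ∑ a ∈ Finset.range M, ∑ b ∈ Finset.range M, C a b *
      chTilde M m e' e (a + half e) (b + half e) τ z₁ z₂ t =
      cexp (2 * Real.pi * I * m / M * t) * S / Rhat e' e τ z₁ z₂ := by
    simp only [hch, S, Finset.mul_sum, Finset.sum_div]
    exact Finset.sum_congr rfl fun a _ => Finset.sum_congr rfl fun b _ => by ring
  rw [hsum, ← hexp, eq_inv_of_mul_eq_one_left hsgn]
  have hp : ((-1 : ℂ) ^ ((e : ℕ) + (e' : ℕ))) ≠ 0 := pow_ne_zero _ (by simp)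
  by_cases hR : Rhat e' e τ z₁ z₂ = 0
  · simp [hR]
  · field_simp
    linear_combination S * I_sq

/-! ### Translations and the failure of `T`-invariance -/

/-- The factor 2 makes the exponent integral when k + ε' is a half-integer. -/
lemma psiMod_add_two_mul {M m : ℕ} (hM : 0 < M) (hm : 0 < m) (e e' : Fin 2) (j : ℂ) (k : ℤ)
    (τ z₁ z₂ : ℂ) :
    psiMod M m e j (k + half e') τ (z₁ + 2 * M) z₂ = psiMod M m e j (k + half e') τ z₁ z₂ := by
  have hM' : (M : ℂ) ≠ 0 := by exact_mod_cast hM.ne'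
  have h := phiMod_add_int hm (M * τ) (z₁ + j * τ + half e) (z₂ + (k + half e') * τ + half e) (2 * M)
  rw [psiMod, psiMod, ← h]
  congr 1
  · rw [show 2 * Real.pi * I * m / M * (j * (k + half e') * τ + (k + half e') * (z₁ + 2 * M) + j * z₂) =
      2 * Real.pi * I * m / M * (j * (k + half e') * τ + (k + half e') * z₁ + j * z₂) +
        (m * (2 * k + (e' : ℕ)) : ℤ) * (2 * Real.pi * I) by
      rw [half]; push_cast; field_simp; ring, Complex.exp_add, Complex.exp_int_mul_two_pi_mul_I,
      mul_one]
  · congr 1; push_cast; ring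

/-- The period 24Mm also suits η and the ϑ's, and it moves Mτ by 4m · 6M², a multiple of the period
4m of the theta and Zwegers functions of level m. -/
lemma psiMod_tau_add {M m : ℕ} (hM : 0 < M) (hm : 0 < m) (e e' : Fin 2) (j k : ℤ) (τ z₁ z₂ : ℂ) :
    psiMod M m e (j + half e') (k + half e') (τ + 24 * (M * m)) z₁ z₂ =
      psiMod M m e (j + half e') (k + half e') τ z₁ z₂ := by
  have hM' : (M : ℂ) ≠ 0 := by exact_mod_cast hM.ne'
  have h := phiMod_tau_add hm (M * τ) (z₁ + (j + half e') * (τ + 24 * (M * m)) + half e)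
    (z₂ + (k + half e') * (τ + 24 * (M * m)) + half e) (6 * M ^ 2)
  have p₁ := phiMod_add_int hm (M * τ) (z₁ + (j + half e') * τ + half e)
    (z₂ + (k + half e') * τ + half e) (12 * (2 * j + (e' : ℕ)) * (M * m))
  have p₂ := phiMod_add_int_right hm (M * τ) (z₁ + (j + half e') * (τ + 24 * (M * m)) + half e)
    (z₂ + (k + half e') * τ + half e) (12 * (2 * k + (e' : ℕ)) * (M * m))
  rw [show z₁ + (j + half e') * τ + half e + (12 * (2 * j + (e' : ℕ)) * (M * m) : ℤ) =
    z₁ + (j + half e') * (τ + 24 * (M * m)) + half e by rw [half]; push_cast; ring] at p₁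
  rw [show z₂ + (k + half e') * τ + half e + (12 * (2 * k + (e' : ℕ)) * (M * m) : ℤ) =
    z₂ + (k + half e') * (τ + 24 * (M * m)) + half e by rw [half]; push_cast; ring, p₁] at p₂
  rw [p₂] at h
  rw [psiMod, psiMod, ← h]
  congr 1
  · rw [show 2 * Real.pi * I * m / M * ((j + half e') * (k + half e') * (τ + 24 * (M * m)) +
        (k + half e') * z₁ + (j + half e') * z₂) =
      2 * Real.pi * I * m / M * ((j + half e') * (k + half e') * τ +
        (k + half e') * z₁ + (j + half e') * z₂) +
        (6 * m ^ 2 * (2 * j + (e' : ℕ)) * (2 * k + (e' : ℕ)) : ℤ) * (2 * Real.pi * I) by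
      rw [half]; push_cast; field_simp; ring, Complex.exp_add, Complex.exp_int_mul_two_pi_mul_I,
      mul_one]
  · congr 1; push_cast; ring

lemma vartheta_add_two_mul_nat (a b : Fin 2) (τ z : ℂ) (n : ℕ) :
    vartheta a b τ (z + 2 * n) = vartheta a b τ z := by
  rw [← vartheta_add_two_mul a b τ z n, mul_comm]; push_cast; rfl

lemma Rhat_add_two_mul (e e' : Fin 2) (τ z₁ z₂ : ℂ) (n : ℕ) :
    Rhat e e' τ (z₁ + 2 * n) z₂ = Rhat e e' τ z₁ z₂ := by
  rw [Rhat, Rhat, add_sub_right_comm, add_right_comm]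
  simp only [vartheta_add_two_mul_nat]

lemma regular_add_two_mul {e e' : Fin 2} {τ z₁ z₂ : ℂ} (n : ℕ) :
    Regular e e' τ (z₁ + 2 * n) z₂ ↔ Regular e e' τ z₁ z₂ := by
  rw [Regular, Regular, add_sub_right_comm, add_right_comm]
  simp only [vartheta_add_two_mul_nat]

lemma vartheta_tau_add_mul (a b : Fin 2) (τ z : ℂ) (n : ℕ) :
    vartheta a b (τ + 24 * n) z = vartheta a b τ z := by
  rw [← vartheta_tau_add a b τ z (3 * n)]
  congr 1
  push_cast; ring

lemma Rhat_tau_add (e e' : Fin 2) (τ z₁ z₂ : ℂ) (n : ℕ) :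
    Rhat e e' (τ + 24 * n) z₁ z₂ = Rhat e e' τ z₁ z₂ := by
  have := eta_add τ n
  push_cast at this
  simp only [Rhat, vartheta_tau_add_mul, this]

lemma regular_tau_add {e e' : Fin 2} {τ z₁ z₂ : ℂ} (n : ℕ) :
    Regular e e' (τ + 24 * n) z₁ z₂ ↔ Regular e e' τ z₁ z₂ := by
  simp only [Regular, vartheta_tau_add_mul]

lemma Regular.Rhat_ne_zero {e e' : Fin 2} {τ z₁ z₂ : ℂ} (hτ : 0 < τ.im)
    (h : Regular e e' τ z₁ z₂) : Rhat e e' τ z₁ z₂ ≠ 0 := by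
  obtain ⟨h1, h2, h3, h4⟩ := h
  have := eta_ne_zero hτ
  rw [Rhat]
  refine div_ne_zero ?_ (by simp [h3, h4])
  simp [h1, h2, this]

/-- Everything is invariant under z₁ ↦ z₁ + 2M except the coefficient (z₁ - z₂)/(2τ) in D₁, which
grows by M/τ. -/
lemma chTilde_add_two_mul_sub {M m : ℕ} (hM : 0 < M) (hm : 0 < m) {e e' : Fin 2} {τ z₁ z₂ : ℂ}
    (hτ : 0 < τ.im) (h : Regular e e' τ z₁ z₂) (j k : ℤ) :
    chTilde M m e e' (j + half e') (k + half e') τ (z₁ + 2 * M) z₂ 0 -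
        chTilde M m e e' (j + half e') (k + half e') τ z₁ z₂ 0 =
      -(m / τ) * (psiMod M m e (j + half e') (k + half e') τ z₁ z₂ / Rhat e e' τ z₁ z₂) := by
  have hM' : (M : ℂ) ≠ 0 := by exact_mod_cast hM.ne'
  have hτ0 : τ ≠ 0 := by rintro rfl; simp at hτ
  rw [chTilde_eq hM hm hτ h, chTilde_eq hM hm hτ ((regular_add_two_mul M).2 h), Rhat_add_two_mul,
    ← sub_div, mul_zero, Complex.exp_zero, one_mul, one_mul, reducedD, reducedD]
  have hw : wirtinger (fun w => psiMod M m e (j + half e') (k + half e') τ w z₂) (z₁ + 2 * M) =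
      wirtinger (fun w => psiMod M m e (j + half e') (k + half e') τ w z₂) z₁ := by
    rw [wirtinger, wirtinger, ← fderiv_comp_add_right]
    simp only [psiMod_add_two_mul hM hm]
  rw [hw]
  simp only [psiMod_add_two_mul hM hm]
  have hR := h.Rhat_ne_zero hτ
  field_simp
  ring

lemma psiMod_eq_zero_of_T_invariance {M m : ℕ} (hM : 0 < M) (hm : 0 < m) {e e' : Fin 2} {j k : ℤ}
    {c : Fin 2 → Fin 2 → ℕ → ℕ → ℂ}
    (hc : ∀ τ z₁ z₂ t : ℂ, 0 < τ.im → (∀ f f' : Fin 2, Regular f f' τ z₁ z₂) →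
      chTilde M m e e' (j + half e') (k + half e') (τ + 1) z₁ z₂ t =
        ∑ f : Fin 2, ∑ f' : Fin 2, ∑ a ∈ Finset.range M, ∑ b ∈ Finset.range M,
          c f f' a b * chTilde M m f f' (a + half f') (b + half f') τ z₁ z₂ t)
    {τ z₁ z₂ : ℂ} (hτ : 0 < τ.im) (h : ∀ f f' : Fin 2, Regular f f' τ z₁ z₂)
    (h1 : Regular e e' (τ + 1) z₁ z₂) :
    psiMod M m e (j + half e') (k + half e') (τ + 1) z₁ z₂ = 0 := by
  have hm' : (m : ℂ) ≠ 0 := by exact_mod_cast hm.ne'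
  have hM' : (M : ℂ) ≠ 0 := by exact_mod_cast hM.ne'
  set B : ℂ → ℂ := fun τ => ∑ f : Fin 2, ∑ f' : Fin 2, ∑ a ∈ Finset.range M, ∑ b ∈ Finset.range M,
    c f f' a b * (psiMod M m f (a + half f') (b + half f') τ z₁ z₂ / Rhat f f' τ z₁ z₂) with hB
  set A : ℂ → ℂ := fun τ =>
    psiMod M m e (j + half e') (k + half e') τ z₁ z₂ / Rhat e e' τ z₁ z₂ with hA
  -- The supposed relation at z₁ + 2M minus the one at z₁; the constants c do not depend on z₁.
  have key : ∀ τ : ℂ, 0 < τ.im → (∀ f f' : Fin 2, Regular f f' τ z₁ z₂) →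
      Regular e e' (τ + 1) z₁ z₂ → A (τ + 1) * τ = B τ * (τ + 1) := by
    intro τ hτ h h1
    have hτ1 : 0 < (τ + 1).im := by simpa using hτ
    have hτ0 : τ ≠ 0 := by rintro rfl; simp at hτ
    have hτ10 : τ + 1 ≠ 0 := by intro h; rw [h] at hτ1; simp at hτ1
    have e1 := hc τ (z₁ + 2 * M) z₂ 0 hτ fun f f' => (regular_add_two_mul M).2 (h f f')
    have e2 := congrArg₂ (· - ·) e1 (hc τ z₁ z₂ 0 hτ h)
    simp only [chTilde_add_two_mul_sub hM hm hτ1 h1, ← Finset.sum_sub_distrib, ← mul_sub] at e2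
    have e3 : ∀ (f f' : Fin 2) (a b : ℕ),
        chTilde M m f f' (a + half f') (b + half f') τ (z₁ + 2 * M) z₂ 0 -
          chTilde M m f f' (a + half f') (b + half f') τ z₁ z₂ 0 =
        -(m / τ) * (psiMod M m f (a + half f') (b + half f') τ z₁ z₂ / Rhat f f' τ z₁ z₂) :=
      fun f f' a b => by
        exact_mod_cast chTilde_add_two_mul_sub hM hm hτ (h f f') (a : ℤ) (b : ℤ)
    simp only [e3, mul_left_comm (c _ _ _ _), ← Finset.mul_sum] at e2
    change -(m / (τ + 1)) * A (τ + 1) = -(m / τ) * B τ at e2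
    field_simp at e2
    linear_combination -e2
  have hAP : A (τ + 24 * (M * m) + 1) = A (τ + 1) := by
    have := Rhat_tau_add e e' (τ + 1) z₁ z₂ (M * m)
    push_cast at this
    simp only [hA]
    rw [add_right_comm, psiMod_tau_add hM hm, this]
  have hBP : B (τ + 24 * (M * m)) = B τ := by
    have e1 : ∀ f f' : Fin 2, Rhat f f' (τ + 24 * (M * m)) z₁ z₂ = Rhat f f' τ z₁ z₂ := fun f f' => by
      exact_mod_cast Rhat_tau_add f f' τ z₁ z₂ (M * m)
    have e2 : ∀ (f f' : Fin 2) (a b : ℕ),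
        psiMod M m f (a + half f') (b + half f') (τ + 24 * (M * m)) z₁ z₂ =
          psiMod M m f (a + half f') (b + half f') τ z₁ z₂ := fun f f' a b => by
      exact_mod_cast psiMod_tau_add hM hm f f' (a : ℤ) (b : ℤ) τ z₁ z₂
    simp only [hB, e1, e2]
  -- A and B are unchanged by τ ↦ τ + 24Mm while the factors τ and τ + 1 are not: comparing the two
  -- relations gives A = B, and then A = 0.
  have k1 := key τ hτ h h1
  have k2 := key (τ + 24 * (M * m)) (by simpa using hτ)
    (fun f f' => by exact_mod_cast (regular_tau_add (M * m)).2 (h f f'))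
    (by rw [add_right_comm]; exact_mod_cast (regular_tau_add (M * m)).2 h1)
  rw [hAP, hBP] at k2
  have hAB : A (τ + 1) = B τ := by
    have hP : (24 * (M * m) : ℂ) ≠ 0 := by simp [hm', hM']
    exact mul_right_cancel₀ hP (by linear_combination k2 - k1)
  have hA0 : A (τ + 1) = 0 := by rw [← hAB] at k1; linear_combination -k1
  exact (div_eq_zero_iff.1 hA0).resolve_right (h1.Rhat_ne_zero (by simpa using hτ))

lemma tendsto_add_const_punctured (p c : ℂ) :
    Tendsto (fun z : ℂ => z + c) (𝓝[≠] p) (𝓝[≠] (p + c)) := by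
  refine tendsto_nhdsWithin_iff.2 ⟨?_, ?_⟩
  · refine tendsto_nhdsWithin_of_tendsto_nhds ?_
    have : Continuous fun z : ℂ => z + c := by fun_prop
    exact this.tendsto p
  · filter_upwards [self_mem_nhdsWithin] with z hz h
    exact hz (add_right_cancel h)

lemma eventually_regular {τ z₂ : ℂ} (hτ : 0 < τ.im) (h : ∀ a b, vartheta a b τ z₂ ≠ 0) (p : ℂ) :
    ∀ᶠ z in 𝓝[≠] p, ∀ f f' : Fin 2, Regular f f' τ z z₂ := by
  have h1 := (tendsto_add_const_punctured p (-z₂)).eventually (eventually_vartheta_ne_zero hτ 1 1 _)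
  have h2 := (tendsto_add_const_punctured p z₂).eventually (eventually_vartheta_ne_zero hτ 1 1 _)
  have h3 : ∀ᶠ z in 𝓝[≠] p, ∀ a b, vartheta a b τ z ≠ 0 :=
    eventually_all.2 fun a => eventually_all.2 fun b => eventually_vartheta_ne_zero hτ a b p
  filter_upwards [h1, h2, h3] with z h1 h2 h3 f f'
  rw [← sub_eq_add_neg] at h1
  exact ⟨h1, h2, h3 _ _, h _ _⟩

/-- It suffices to look at τ = i: near a suitable z₁ the numerator at i + 1 would vanish at all
nearby points, although `phiMod` has a nonzero residue there. -/
lemma not_T_invariant {M m : ℕ} (hM : 0 < M) (hm : 0 < m) (e e' : Fin 2) (j k : ℤ) :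
    ¬ ∃ c : Fin 2 → Fin 2 → ℕ → ℕ → ℂ,
      ∀ τ z₁ z₂ t : ℂ, 0 < τ.im → (∀ f f' : Fin 2, Regular f f' τ z₁ z₂) →
        chTilde M m e e' (j + half e') (k + half e') (τ + 1) z₁ z₂ t =
          ∑ f : Fin 2, ∑ f' : Fin 2, ∑ a ∈ Finset.range M, ∑ b ∈ Finset.range M,
            c f f' a b * chTilde M m f f' (a + half f') (b + half f') τ z₁ z₂ t := by
  rintro ⟨c, hc⟩
  set σ : ℂ := I + 1 with hσdef
  have hI : 0 < I.im := by simp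
  have hσ : 0 < σ.im := by simp [hσdef]
  have hMσ := mul_im_pos hσ hM
  obtain ⟨z₂, hI₂, hσ₂, hoff⟩ : ∃ z₂, (∀ a b, vartheta a b I z₂ ≠ 0) ∧
      (∀ a b, vartheta a b σ z₂ ≠ 0) ∧
      OffLattice (M * σ) (z₂ + ((k + half e') * σ + half e)) := by
    have h1 : ∀ᶠ z in 𝓝[≠] (0 : ℂ), ∀ a b, vartheta a b I z ≠ 0 :=
      eventually_all.2 fun a => eventually_all.2 fun b => eventually_vartheta_ne_zero hI a b 0
    have h2 : ∀ᶠ z in 𝓝[≠] (0 : ℂ), ∀ a b, vartheta a b σ z ≠ 0 :=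
      eventually_all.2 fun a => eventually_all.2 fun b => eventually_vartheta_ne_zero hσ a b 0
    have h3 := (tendsto_add_const_punctured 0 ((k + half e') * σ + half e)).eventually
      (eventually_offLattice hMσ _)
    obtain ⟨z, h⟩ := (h1.and (h2.and h3)).exists
    exact ⟨z, h.1, h.2.1, h.2.2⟩
  rw [← add_assoc] at hoff
  -- At z₁ = w + p the first argument of `phiMod` is w itself, which puts the pole at w = 0.
  set p : ℂ := -((j + half e') * σ + half e) with hp
  have ht := tendsto_add_const_punctured 0 p
  have hev : ∀ᶠ w in 𝓝[≠] (0 : ℂ),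
      w * phiMod m (M * σ) w (z₂ + (k + half e') * σ + half e) = 0 := by
    filter_upwards [ht.eventually (eventually_regular hI hI₂ _),
      ht.eventually (eventually_regular hσ hσ₂ _)] with w h1 h2
    have h0 := psiMod_eq_zero_of_T_invariance hM hm hc hI h1 (h2 e e')
    rw [psiMod, mul_eq_zero] at h0
    have h3 := h0.resolve_left (exp_ne_zero _)
    rw [← hσdef, show w + p + (j + half e') * σ + half e = w by rw [hp]; ring] at h3
    rw [h3, mul_zero]
  have hlim := tendsto_mul_phiMod hm hMσ hoff
  have h0 : Tendsto (fun w => w * phiMod m (M * σ) w (z₂ + (k + half e') * σ + half e)) (𝓝[≠] 0)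
      (𝓝 0) := tendsto_const_nhds.congr' (hev.mono fun w hw => hw.symm)
  have := tendsto_nhds_unique hlim h0
  simp at this

end A11

theorem theorem8p4 (M m : ℕ) (hM : 0 < M) (hm : 0 < m)
    (hgcd : 1 < m → Nat.gcd M (2 * m) = 1) :
    -- at the points considered, the derivatives that enter `D₁` exist
    (∀ (e e' : Fin 2) (j k : ℤ) (τ z₁ z₂ t : ℂ), 0 < τ.im → A11.Regular e e' τ z₁ z₂ →
      DifferentiableAt ℝ
        (fun p : ℂ × ℂ × ℂ =>
          A11.PsiTilde M (m - 1) e (j + A11.half e') (k + A11.half e') τ p.1 p.2.1 p.2.2)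
        (z₁, z₂, t)) ∧
    -- the transformation under `S`
    (∀ (e e' : Fin 2) (j k : ℤ) (τ z₁ z₂ t : ℂ), 0 < τ.im → A11.Regular e' e τ z₁ z₂ →
      A11.Regular e e' (-1 / τ) (z₁ / τ) (z₂ / τ) ∧
      A11.chTilde M m e e' (j + A11.half e') (k + A11.half e')
          (-1 / τ) (z₁ / τ) (z₂ / τ) (t - z₁ * z₂ / τ) =
        -(-1 : ℂ) ^ (((e : ℕ) : ℤ) - ((e' : ℕ) : ℤ)) * (Complex.I * τ / M) *
          ∑ a ∈ Finset.range M, ∑ b ∈ Finset.range M,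
            Complex.exp (-(2 * Real.pi * Complex.I * m / M) *
              ((a + A11.half e) * (k + A11.half e') + (b + A11.half e) * (j + A11.half e'))) *
            A11.chTilde M m e' e (a + A11.half e) (b + A11.half e) τ z₁ z₂ t) ∧
    -- no invariance under `T`
    (∀ (e e' : Fin 2) (j k : ℤ), ¬ ∃ c : Fin 2 → Fin 2 → ℕ → ℕ → ℂ,
      ∀ τ z₁ z₂ t : ℂ, 0 < τ.im → (∀ f f' : Fin 2, A11.Regular f f' τ z₁ z₂) →
        A11.chTilde M m e e' (j + A11.half e') (k + A11.half e') (τ + 1) z₁ z₂ t =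
          ∑ f : Fin 2, ∑ f' : Fin 2, ∑ a ∈ Finset.range M, ∑ b ∈ Finset.range M,
            c f f' a b *
              A11.chTilde M m f f' (a + A11.half f') (b + A11.half f') τ z₁ z₂ t) := by
  -- For m = 1 coprimality is automatic; otherwise it follows from gcd(M, 2m) = 1.
  have hMm : Nat.Coprime M m := by
    rcases (Nat.one_le_iff_ne_zero.2 hm.ne').eq_or_lt with h | h
    · rw [← h]; exact Nat.coprime_one_right M
    · exact Nat.Coprime.coprime_mul_left_right (hgcd h)
  exact ⟨fun e e' j k τ z₁ z₂ t hτ h => A11.differentiableAt_PsiTilde hM hm hτ h.2.2.1 h.2.2.2 j k t,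
    fun e e' j k τ z₁ z₂ t hτ h => ⟨h.S hτ, A11.chTilde_S hM hm hMm hτ h j k t⟩,
    fun e e' j k => A11.not_T_invariant hM hm e e' j k⟩
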